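/- Let $n\ge 1$. For $z>0$ let $J_\nu(z)$ be the Bessel function of the first kind, put $$f_n(\eta)=\eta^{1-n}\int_0^\infty e^{-s^4}(\eta s)^{n/2}J_{\frac{n-2}{2}}(\eta s)\,ds\quad(\eta>0),\qquad f_n(0)=\lim_{\eta\to0^+}f_n(\eta),$$ and let $$B(x,t)=B_{(x_0,t_0)}(x,t)=\frac{\alpha_n}{(t_0-t)^{n/4}}\,f_n\!\left(\frac{|x-x_0|}{(t_0-t)^{1/4}}\right),\qquad t<t_0,\quad \alpha_n=(2\pi)^{-n/2},$$ be the backwards biharmonic heat kernel. With $T_R(t_0)=\mathbb R^n\times(t_0-16R^4,\,t_0-R^4)$ and $S_R(t_0)=\mathbb R^n\times\{t_0-R^4\}$ put $$\Psi(u,R,\varphi)=\frac12\int_{T_R(t_0)}|\Delta u|^2B\varphi\,dx\,dt-\frac12\int_{T_R(t_0)}|\nabla u|^2\,\Delta B\,\varphi\,dx\,dt,$$ $$\Phi(u,R,\varphi)=\frac{R^4}2\int_{S_R(t_0)}|\Delta u|^2B\varphi\,dx-\frac{R^4}2\int_{S_R(t_0)}|\nabla u|^2\,\Delta B\,\varphi\,dx,$$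 and $\operatorname{Sol}u=\nabla u\cdot(x-x_0)+4(t-t_0)\,\partial_tu$. Let $\mathcal S$ be the class of smooth solutions $u:\mathbb R^n\times[0,\infty)\to\mathbb R$ of $\partial_tu=-\Delta^2u$ such that, for $l=1,2,3$, $\int_{\mathbb R^n}|\nabla^lu(x,t)|^2dx<\infty$ for every $t\ge0$ and $\int_0^T\!\int_{\mathbb R^n}|\nabla^lu|^2dx\,dt<\infty$ for every $T<\infty$. Write $u_0=u(\cdot,0)$. **Theorem.** There is a constant $C>0$ depending only on $n$, and for every $R_0\in(0,1]$ there is a cut-off function $\varphi_0\in C_c^\infty(\mathbb R^n)$ depending only on $n$ and $R_0$, with $0\le\varphi_0\le1$ and $\varphi_0=1$ in a neighbourhood of $0$, such that the following holds for all $x_0\in\mathbb R^n$ and $t_0>0$ with $R_0\le t_0^{1/4}/2$, with $\varphi(x)=\varphi_0(x-x_0)$. 1. For every $u\in\mathcal S$ and every $R$ with $R_0\le R\le t_0^{1/4}/2$, the integrals in $\Psi(u,R,\varphi)$ and $\Phi(u,R,\varphi)$ converge, and both terms of $\Psi$ and both terms of $\Phi$ (each with its sign) are non-negative. 2. For every $u\in\mathcal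 S$ and every $R$ with $R_0\le R<t_0^{1/4}/2$, the function $\Psi(u,\cdot,\varphi)$ is differentiable at $R$, the integral over $T_R(t_0)$ on the right-hand side below converges, and $$\frac{\partial}{\partial R}\Psi(u,R,\varphi)\ \ge\ \frac1{2R}\int_{T_R(t_0)}\frac{|\operatorname{Sol}u|^2}{4|t_0-t|}B\varphi\,dx\,dt-C(1+R^{1-n})\int_{\mathbb R^n}|\nabla u_0|^2dx-C(R^4+R^{3-n})\int_{\mathbb R^n}|\Delta u_0|^2dx.$$ 3. If $n=1$, then for every $u\in\mathcal S$ and $R_0\le R_1<R_2\le\min\{t_0^{1/4}/2,1\}$ $$\Psi(u,R_1,\varphi)\le\Psi(u,R_2,\varphi)+C(R_2-R_1)\int_{\mathbb R}|u_0'|^2dx+C(R_2^3-R_1^3)\int_{\mathbb R}|u_0''|^2dx.$$ 4. If $n=1$, then $\Psi$ is a pre-entropy, that is: * (i) for every $u\in\mathcal S$, $\Psi(u,R,\varphi)\ge0$ for $R_0\le R\le\min\{t_0^{1/4}/2,1\}$, and $\Psi(u,R,\varphi)=\Psi(u_R,1,\varphi_R)$ for all $R>0$ with $16R^4\le t_0$,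 where $u_R(x,t)=u(x_0+R(x-x_0),\,t_0+R^4(t-t_0))$ and $\varphi_R(x)=\varphi(x_0+R(x-x_0))$; * (ii) shrinking solitons are critical points: if $v$ is a smooth solution of $\partial_tv=-\Delta^2v$ on $\mathbb R^n\times(a,t_0)$ with $\operatorname{Sol}v=0$ there, then $\frac{d}{dR}\Psi(v,R,1)=0$ for every $R>0$ with $t_0-16R^4>a$ (an integral that diverges being read as $0$); * (iii) there are integers $\alpha,\beta\ge1$ and constants $c_1,c_2\ge0$ such that for all $u\in\mathcal S$ and $R_0\le R_1<R_2\le\min\{t_0^{1/4}/2,1\}$ $$\Psi(u,R_1,\varphi)\le e^{c_1(R_2^\alpha-R_1^\alpha)}\,\Psi(u,R_2,\varphi)+c_2(R_2^\beta-R_1^\beta)\Big(\tfrac12\int_{\mathbb R^n}|\Delta u_0|^2dx+\int_{\mathbb R^n}|\nabla u_0|^2dx\Big).$$ -/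

import Mathlib

open MeasureTheory Set Filter Topology
open scoped ContDiff

noncomputable section

namespace Biheat

/-- Euclidean space `ℝⁿ`. -/
abbrev Euc (n : ℕ) : Type := EuclideanSpace ℝ (Fin n)

/-! ### The biharmonic heat kernel -/

/-- The entire factor `P_ν(z) = ∑ₘ (-1)ᵐ (z/2)²ᵐ / (m! Γ(ν+m+1))` of the Bessel function. -/
def besselP (ν z : ℝ) : ℝ :=
  ∑' m : ℕ, (-1) ^ m * (z / 2) ^ (2 * m) / ((m.factorial : ℝ) * Real.Gamma (ν + m + 1))

/-- The Bessel function of the first kind `J_ν(z)`, for `z > 0`. -/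
def besselJ (ν z : ℝ) : ℝ := (z / 2) ^ ν * besselP ν z

/-- The profile `f_n` of the biharmonic heat kernel. For `η > 0` it equals
`η^(1-n) ∫₀^∞ exp(-s⁴) (η s)^(n/2) J_{(n-2)/2}(η s) ds`, see `profile_eq_bessel`; the power of `η`
is cancelled here, so that the formula also gives the continuous extension to `η = 0`. -/
def profile (n : ℕ) (η : ℝ) : ℝ :=
  2 ^ (-(((n : ℝ) - 2) / 2)) *
    ∫ s in Ioi (0 : ℝ), Real.exp (-s ^ 4) * s ^ (n - 1) * besselP (((n : ℝ) - 2) / 2) (η * s)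

theorem profile_eq_bessel {n : ℕ} (hn : 1 ≤ n) {η : ℝ} (hη : 0 < η) :
    profile n η = η ^ (1 - (n : ℝ)) *
      ∫ s in Ioi (0 : ℝ), Real.exp (-s ^ 4) * (η * s) ^ ((n : ℝ) / 2) *
        besselJ (((n : ℝ) - 2) / 2) (η * s) := by
  unfold profile
  rw [← integral_const_mul, ← integral_const_mul]
  refine setIntegral_congr_fun measurableSet_Ioi fun s hs => ?_
  have hs : 0 < s := hs
  have hηs : 0 < η * s := mul_pos hη hs
  have h1 : s ^ (n - 1) = s ^ ((n : ℝ) - 1) := by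
    rw [← Real.rpow_natCast, Nat.cast_sub hn, Nat.cast_one]
  have h2 : (η * s) ^ ((n : ℝ) / 2) * (η * s / 2) ^ (((n : ℝ) - 2) / 2)
      = 2 ^ (-(((n : ℝ) - 2) / 2)) * (η ^ ((n : ℝ) - 1) * s ^ ((n : ℝ) - 1)) := by
    rw [Real.div_rpow hηs.le (by norm_num), Real.rpow_neg (by norm_num), ← Real.mul_rpow hη.le hs.le,
      mul_div_assoc', ← Real.rpow_add hηs, div_eq_inv_mul]
    congr 2
    ring
  have h3 : η ^ (1 - (n : ℝ)) * η ^ ((n : ℝ) - 1) = 1 := by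
    rw [← Real.rpow_add hη]; simp
  simp only [besselJ]
  rw [h1]
  generalize η ^ (1 - (n : ℝ)) = a at h3 ⊢
  generalize η ^ ((n : ℝ) - 1) = b at h2 h3
  generalize s ^ ((n : ℝ) - 1) = c at h2 ⊢
  generalize besselP (((n : ℝ) - 2) / 2) (η * s) = P
  generalize (η * s) ^ ((n : ℝ) / 2) = d at h2 ⊢
  generalize (η * s / 2) ^ (((n : ℝ) - 2) / 2) = e at h2 ⊢
  generalize (2 : ℝ) ^ (-(((n : ℝ) - 2) / 2)) = k at h2 ⊢
  linear_combination (-a * Real.exp (-s ^ 4) * P) * h2 - k * Real.exp (-s ^ 4) * c * P * h3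

/-- The biharmonic heat kernel `b(x,t) = α_n t^(-n/4) f_n(|x| / t^(1/4))` (for `t > 0`). The
normalization `α_n = (2π)^(-n/2)` gives it total mass one. -/
def kernel (n : ℕ) (x : Euc n) (t : ℝ) : ℝ :=
  (2 * Real.pi) ^ (-((n : ℝ) / 2)) * profile n (‖x‖ / t ^ (1 / 4 : ℝ)) / t ^ ((n : ℝ) / 4)

/-- The backwards kernel `B_{(x₀,t₀)}(x,t) = b(x - x₀, t₀ - t)` (for `t < t₀`). -/
def backKernel {n : ℕ} (x₀ : Euc n) (t₀ : ℝ) (x : Euc n) (t : ℝ) : ℝ :=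
  kernel n (x - x₀) (t₀ - t)

/-! ### Differential operators, solutions, solitons -/

/-- The spatial Laplacian `Δu(x,t)`. -/
def lap {n : ℕ} (u : Euc n → ℝ → ℝ) (x : Euc n) (t : ℝ) : ℝ :=
  Laplacian.laplacian (fun y => u y t) x

/-- The spatial gradient `∇u(x,t)`. -/
def grad {n : ℕ} (u : Euc n → ℝ → ℝ) (x : Euc n) (t : ℝ) : Euc n :=
  gradient (fun y => u y t) x

/-- `u` is smooth on `ℝⁿ × I` and solves `∂ₜu = -Δ²u` there. (At a boundary point of the interval
`I` the equation follows from the interior by continuity.) -/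
def IsBiheatSolution {n : ℕ} (I : Set ℝ) (u : Euc n → ℝ → ℝ) : Prop :=
  ContDiffOn ℝ ∞ (fun p : Euc n × ℝ => u p.1 p.2) (univ ×ˢ I) ∧
    ∀ x, ∀ t ∈ interior I, deriv (fun s => u x s) t = -lap (lap u) x t

/-- A smooth solution of the biheat equation on `ℝⁿ × [0,∞)` such that, for `l = 1,2,3`,
`∇ˡu(·,t)` is in `L²(ℝⁿ)` for every `t ≥ 0` and `∇ˡu` is in `L²(ℝⁿ × (0,T))` for every `T`. -/
structure IsFiniteEnergySolution {n : ℕ} (u : Euc n → ℝ → ℝ) : Prop where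
  solution : IsBiheatSolution (Ici 0) u
  integrable_slice : ∀ l ∈ Finset.Icc 1 3, ∀ t, 0 ≤ t →
    Integrable (fun x => ‖iteratedFDeriv ℝ l (fun y => u y t) x‖ ^ 2)
  integrable_slab : ∀ l ∈ Finset.Icc 1 3, ∀ T : ℝ,
    IntegrableOn (fun p : Euc n × ℝ => ‖iteratedFDeriv ℝ l (fun y => u y p.2) p.1‖ ^ 2)
      (univ ×ˢ Ioo 0 T)

/-- `Sol u = ∇u · (x - x₀) + 4 (t - t₀) ∂ₜu`. -/
def sol {n : ℕ} (x₀ : Euc n) (t₀ : ℝ) (u : Euc n → ℝ → ℝ) (x : Euc n) (t : ℝ) : ℝ :=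
  inner ℝ (grad u x t) (x - x₀) + 4 * (t - t₀) * deriv (fun s => u x s) t

/-- A shrinking soliton with respect to `(x₀,t₀)`, on the time interval `(a,t₀)`. -/
def IsShrinkingSoliton {n : ℕ} (x₀ : Euc n) (t₀ a : ℝ) (v : Euc n → ℝ → ℝ) : Prop :=
  IsBiheatSolution (Ioo a t₀) v ∧ ∀ x, ∀ t ∈ Ioo a t₀, sol x₀ t₀ v x t = 0

/-! ### The functionals `Ψ` and `Φ` -/

/-- The horizontal layer `T_R(t₀) = {(x,t) : t₀ - 16R⁴ < t < t₀ - R⁴}`. -/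
def layer (n : ℕ) (t₀ R : ℝ) : Set (Euc n × ℝ) :=
  {p | t₀ - 16 * R ^ 4 < p.2 ∧ p.2 < t₀ - R ^ 4}

/-- The integrand `|Δu|² B φ`. -/
def lapDensity {n : ℕ} (x₀ : Euc n) (t₀ : ℝ) (u : Euc n → ℝ → ℝ) (φ : Euc n → ℝ)
    (x : Euc n) (t : ℝ) : ℝ :=
  lap u x t ^ 2 * backKernel x₀ t₀ x t * φ x

/-- The integrand `|∇u|² ΔB φ`. -/
def gradDensity {n : ℕ} (x₀ : Euc n) (t₀ : ℝ) (u : Euc n → ℝ → ℝ) (φ : Euc n → ℝ)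
    (x : Euc n) (t : ℝ) : ℝ :=
  ‖grad u x t‖ ^ 2 * lap (backKernel x₀ t₀) x t * φ x

/-- The integrand `|Sol u|² / (4|t₀ - t|) B φ`. -/
def solDensity {n : ℕ} (x₀ : Euc n) (t₀ : ℝ) (u : Euc n → ℝ → ℝ) (φ : Euc n → ℝ)
    (x : Euc n) (t : ℝ) : ℝ :=
  sol x₀ t₀ u x t ^ 2 / (4 * |t₀ - t|) * backKernel x₀ t₀ x t * φ x

/-- First term of `Ψ`. -/
def psiLap {n : ℕ} (x₀ : Euc n) (t₀ : ℝ) (u : Euc n → ℝ → ℝ) (R : ℝ) (φ : Euc n → ℝ) : ℝ :=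
  1 / 2 * ∫ p in layer n t₀ R, lapDensity x₀ t₀ u φ p.1 p.2

/-- Second term of `Ψ`, with its sign. -/
def psiGrad {n : ℕ} (x₀ : Euc n) (t₀ : ℝ) (u : Euc n → ℝ → ℝ) (R : ℝ) (φ : Euc n → ℝ) : ℝ :=
  -(1 / 2 * ∫ p in layer n t₀ R, gradDensity x₀ t₀ u φ p.1 p.2)

/-- `Ψ(u,R,φ)`. -/
def Psi {n : ℕ} (x₀ : Euc n) (t₀ : ℝ) (u : Euc n → ℝ → ℝ) (R : ℝ) (φ : Euc n → ℝ) : ℝ :=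
  psiLap x₀ t₀ u R φ + psiGrad x₀ t₀ u R φ

/-- First term of `Φ(u,R,φ)`, an integral over the slice `S_R(t₀) = ℝⁿ × {t₀ - R⁴}`. -/
def phiLap {n : ℕ} (x₀ : Euc n) (t₀ : ℝ) (u : Euc n → ℝ → ℝ) (R : ℝ) (φ : Euc n → ℝ) : ℝ :=
  R ^ 4 / 2 * ∫ x, lapDensity x₀ t₀ u φ x (t₀ - R ^ 4)

/-- Second term of `Φ(u,R,φ)`, with its sign. -/
def phiGrad {n : ℕ} (x₀ : Euc n) (t₀ : ℝ) (u : Euc n → ℝ → ℝ) (R : ℝ) (φ : Euc n → ℝ) : ℝ :=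
  -(R ^ 4 / 2 * ∫ x, gradDensity x₀ t₀ u φ x (t₀ - R ^ 4))

/-- `∫ |∇u₀|²`. -/
def dirichlet {n : ℕ} (u : Euc n → ℝ → ℝ) : ℝ := ∫ x, ‖grad u x 0‖ ^ 2

/-- `∫ |Δu₀|²`. -/
def bienergy {n : ℕ} (u : Euc n → ℝ → ℝ) : ℝ := ∫ x, lap u x 0 ^ 2

/-! ### Pre-entropies -/

/-- The parabolic rescaling of `u` by the factor `R` about `(x₀,t₀)`. -/
def rescale {n : ℕ} (x₀ : Euc n) (t₀ R : ℝ) (u : Euc n → ℝ → ℝ) : Euc n → ℝ → ℝ :=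
  fun x t => u (x₀ + R • (x - x₀)) (t₀ + R ^ 4 * (t - t₀))

/-- The functional `F(u,R,φ)` is a pre-entropy (with cut-off function `φ`, for the radii in
`[R₀,R₁]`) for the biheat flow, the gradient flow of `½ ∫ |Δu|²`. The quantity `Q` of the initial
datum is the one that is added to the initial energy in the error term. -/
structure IsPreEntropy {n : ℕ} (x₀ : Euc n) (t₀ R₀ R₁ : ℝ) (φ : Euc n → ℝ)
    (F : (Euc n → ℝ → ℝ) → ℝ → (Euc n → ℝ) → ℝ) (Q : (Euc n → ℝ → ℝ) → ℝ) : Prop where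
  nonneg : ∀ u, IsFiniteEnergySolution u → ∀ R, R₀ ≤ R → R ≤ R₁ → 0 ≤ F u R φ
  scaling : ∀ u, IsFiniteEnergySolution u → ∀ R, 0 < R → 16 * R ^ 4 ≤ t₀ →
    F u R φ = F (rescale x₀ t₀ R u) 1 (fun x => φ (x₀ + R • (x - x₀)))
  soliton_critical : ∀ a v, IsShrinkingSoliton x₀ t₀ a v → ∀ R, 0 < R → a < t₀ - 16 * R ^ 4 →
    HasDerivAt (fun r => F v r (fun _ => 1)) 0 R
  monotone : ∃ α β : ℕ, ∃ c₁ c₂ : ℝ, 1 ≤ α ∧ 1 ≤ β ∧ 0 ≤ c₁ ∧ 0 ≤ c₂ ∧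
    ∀ u, IsFiniteEnergySolution u → ∀ r s, R₀ ≤ r → r < s → s ≤ R₁ →
      F u r φ ≤ Real.exp (c₁ * (s ^ α - r ^ α)) * F u s φ
        + c₂ * (s ^ β - r ^ β) * (1 / 2 * bienergy u + Q u)

end Biheat

end

/-! Only the behaviour of the kernel near its centre matters. Expanding the Bessel function and
integrating term by term turns the profile into a power series in `η²` whose constant coefficient is
positive and whose linear coefficient is negative. Hence at time one the kernel is non-negative and
its Laplacian non-positive on some ball of radius `c`, with bounds (`exists_unitKernel_bounds`). By
parabolic scaling `B ≥ 0 ≥ ΔB` for `|x - x₀| < cR₀/2` and `t ≤ t₀ - (R₀/2)⁴`. The cut-off is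
supported in that ball, which gives the signs, while continuity and compact support give
convergence.

The differential inequality does not come from a monotonicity identity. Let `E(t)` be the slice
integral of `(|Δu|²B - |∇u|²ΔB)φ`. By Fubini (`Psi_eq`) `Ψ` is half the integral of `E` over `(t₀ -
16R⁴, t₀ - R⁴)`, so `∂Ψ/∂R = 2R³(16E(t₀ - 16R⁴) - E(t₀ - R⁴))`. The first term is non-negative and
is dropped. Both the second term and the integral of `|Sol u|²` are dominated by the error terms
(`sliceEnergy_le`, `integral_solDensity_le`), because `B ≤ CR⁻ⁿ` and `|ΔB| ≤ CR⁻ⁿ⁻²` on the support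
of the cut-off, because `∂ₜu = -Δ²u`, and because of energy estimates.

Those estimates (`Solves.energy_le`) apply to `∂ᵢu` and `Δu`, which solve the same equation. They
bound `∫|∇u|²` and `∫|Δu|²` at positive times, and the space-time integral of `|Δ²u|²`, by the
initial energies. They follow from testing with a large cut-off and letting its radius tend to
infinity.

In dimension one the error terms are integrable in `R`, which gives the monotonicity formula. The
scaling law is a change of variables. A soliton is constant along the curves of the parabolic
homothety, so its `Ψ` with `φ = 1` does not depend on the radius. -/

namespace Biheat

/-! ### The Laplacian in coordinates -/

/-- The standard basis vector of `ℝⁿ`. -/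
noncomputable abbrev stdVec {n : ℕ} (i : Fin n) : Euc n := EuclideanSpace.basisFun (Fin n) ℝ i

theorem laplacian_eq_sum {n : ℕ} {f : Euc n → ℝ} {x : Euc n} (hf : ContDiffAt ℝ 2 f x) :
    Laplacian.laplacian f x =
      ∑ i, fderiv ℝ (fun y => fderiv ℝ f y (stdVec i)) x (stdVec i) := by
  rw [InnerProductSpace.laplacian_eq_iteratedFDeriv_orthonormalBasis f
    (EuclideanSpace.basisFun (Fin n) ℝ)]
  refine Finset.sum_congr rfl fun i _ => ?_
  have hd : DifferentiableAt ℝ (fderiv ℝ f) x :=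
    (hf.fderiv_right (m := 1) (by norm_num)).differentiableAt (by norm_num)
  rw [iteratedFDeriv_two_apply, fderiv_clm_apply hd (by fun_prop)]
  simp

/-- Composition with a linear equivalence commutes with iterated derivatives even where `f` is not
differentiable. This and the companion rules can therefore be used on the kernel far from its centre
and on arbitrary `u`. -/
theorem laplacian_comp_smul {n : ℕ} (f : Euc n → ℝ) {c : ℝ} (hc : c ≠ 0) (x : Euc n) :
    Laplacian.laplacian (fun y => f (c • y)) x = c ^ 2 * Laplacian.laplacian f (c • x) := by
  rw [InnerProductSpace.laplacian_eq_iteratedFDeriv_orthonormalBasis _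
    (EuclideanSpace.basisFun (Fin n) ℝ), InnerProductSpace.laplacian_eq_iteratedFDeriv_orthonormalBasis _
    (EuclideanSpace.basisFun (Fin n) ℝ)]
  have h := (ContinuousLinearEquiv.smulLeft (Units.mk0 c hc) :
    Euc n ≃L[ℝ] Euc n).iteratedFDerivWithin_comp_right f (uniqueDiffOn_univ) (x := x)
      (mem_univ _) 2
  simp only [preimage_univ, iteratedFDerivWithin_univ] at h
  have h2 : (f ∘ ⇑(ContinuousLinearEquiv.smulLeft (Units.mk0 c hc) : Euc n ≃L[ℝ] Euc n))
    = fun y => f (c • y) := by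
    ext y; simp [Units.smul_def]
  rw [h2] at h
  beta_reduce
  rw [h, Finset.mul_sum]
  refine Finset.sum_congr rfl fun i _ => ?_
  simp only [ContinuousMultilinearMap.compContinuousLinearMap_apply]
  have h3 : (fun j : Fin 2 => (((ContinuousLinearEquiv.smulLeft (Units.mk0 c hc) :
      Euc n ≃L[ℝ] Euc n) : Euc n →L[ℝ] Euc n)
      ((![stdVec i, stdVec i] : Fin 2 → Euc n) j))) =
      fun j => c • (![stdVec i, stdVec i] : Fin 2 → Euc n) j := by
    ext j; simp [Units.smul_def]
  rw [h3, ContinuousMultilinearMap.map_smul_univ]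
  simp [Units.smul_def, pow_two]

theorem laplacian_comp_sub {n : ℕ} (f : Euc n → ℝ) (a x : Euc n) :
    Laplacian.laplacian (fun y => f (y - a)) x = Laplacian.laplacian f (x - a) := by
  rw [InnerProductSpace.laplacian_eq_iteratedFDeriv_orthonormalBasis _
    (EuclideanSpace.basisFun (Fin n) ℝ), InnerProductSpace.laplacian_eq_iteratedFDeriv_orthonormalBasis _
    (EuclideanSpace.basisFun (Fin n) ℝ)]
  simp only [iteratedFDeriv_comp_sub]

theorem laplacian_comp_add {n : ℕ} (f : Euc n → ℝ) (a x : Euc n) :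
    Laplacian.laplacian (fun y => f (a + y)) x = Laplacian.laplacian f (a + x) := by
  rw [InnerProductSpace.laplacian_eq_iteratedFDeriv_orthonormalBasis _
    (EuclideanSpace.basisFun (Fin n) ℝ), InnerProductSpace.laplacian_eq_iteratedFDeriv_orthonormalBasis _
    (EuclideanSpace.basisFun (Fin n) ℝ)]
  simp only [iteratedFDeriv_comp_add_left]

theorem laplacian_const_mul {n : ℕ} (f : Euc n → ℝ) (c : ℝ) (x : Euc n) :
    Laplacian.laplacian (fun y => c * f y) x = c * Laplacian.laplacian f x := by
  rcases eq_or_ne c 0 with rfl | hc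
  · simp [InnerProductSpace.laplacian_eq_iteratedFDeriv_orthonormalBasis _
      (EuclideanSpace.basisFun (Fin n) ℝ)]
  · have := InnerProductSpace.laplacian_CLE_comp_left (f := f)
      (l := (ContinuousLinearEquiv.smulLeft (Units.mk0 c hc) : ℝ ≃L[ℝ] ℝ))
    exact congrFun this x

/-! ### The profile of the kernel near the origin -/

/-- The moments `∫₀^∞ e^{-s⁴} s^(n-1+2m) ds`. -/
noncomputable def moment (n m : ℕ) : ℝ :=
  ∫ s in Ioi (0 : ℝ), Real.exp (-s ^ 4) * s ^ (n - 1 + 2 * m)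

theorem integrableOn_pow_mul_exp (k : ℕ) {b : ℝ} (hb : 0 < b) :
    IntegrableOn (fun s : ℝ => Real.exp (-b * s ^ 4) * s ^ k) (Ioi 0) := by
  have h := integrableOn_rpow_mul_exp_neg_mul_rpow (p := 4) (s := k) (b := b)
    (by have : (0 : ℝ) ≤ k := k.cast_nonneg
        linarith) (by norm_num) hb
  refine h.congr_fun (fun s _ => ?_) measurableSet_Ioi
  have h4 : s ^ (4 : ℝ) = s ^ 4 := by norm_cast
  simp only [Real.rpow_natCast, h4]
  ring

theorem moment_integrable (n m : ℕ) :
    IntegrableOn (fun s : ℝ => Real.exp (-s ^ 4) * s ^ (n - 1 + 2 * m)) (Ioi 0) := by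
  simpa using integrableOn_pow_mul_exp (n - 1 + 2 * m) one_pos

theorem moment_pos (n m : ℕ) : 0 < moment n m := by
  have h := integral_rpow_mul_exp_neg_rpow (p := 4) (q := (n - 1 + 2 * m : ℕ)) (by norm_num)
    (by have : (0 : ℝ) ≤ (n - 1 + 2 * m : ℕ) := Nat.cast_nonneg _
        linarith)
  have h2 : moment n m = 1 / 4 * Real.Gamma (((n - 1 + 2 * m : ℕ) + 1) / 4) := by
    rw [← h, moment]
    refine setIntegral_congr_fun measurableSet_Ioi fun s _ => ?_
    have h4 : s ^ (4 : ℝ) = s ^ 4 := by norm_cast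
    simp only [Real.rpow_natCast, h4]
    ring
  rw [h2]
  have : 0 < Real.Gamma (((n - 1 + 2 * m : ℕ) + 1 : ℝ) / 4) := Real.Gamma_pos_of_pos (by positivity)
  positivity

/-- From `s^(2m) ≤ m! exp(s²)` and `s² ≤ 1/2 + s⁴/2`: half of the decay of `exp(-s⁴)` absorbs the
exponential. The factorial will cancel against the one in the Bessel coefficient. -/
theorem exists_moment_le (n : ℕ) : ∃ M, 0 < M ∧ ∀ m, moment n m ≤ m.factorial * M := by
  have hi := (integrableOn_pow_mul_exp (n - 1) (b := 1 / 2) (by norm_num)).const_mul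
    (Real.exp (1 / 2))
  refine ⟨1 + ∫ s in Ioi (0 : ℝ), Real.exp (1 / 2) * (Real.exp (-(1 / 2) * s ^ 4) * s ^ (n - 1)),
    ?_, fun m => ?_⟩
  · have : 0 ≤ ∫ s in Ioi (0 : ℝ),
        Real.exp (1 / 2) * (Real.exp (-(1 / 2) * s ^ 4) * s ^ (n - 1)) := by
      refine setIntegral_nonneg measurableSet_Ioi fun s (hs : 0 < s) => by positivity
    linarith
  · have h1 : moment n m ≤ ∫ s in Ioi (0 : ℝ), (m.factorial : ℝ) *
        (Real.exp (1 / 2) * (Real.exp (-(1 / 2) * s ^ 4) * s ^ (n - 1))) := by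
      refine setIntegral_mono_on (moment_integrable n m) (hi.const_mul _) measurableSet_Ioi ?_
      intro s (hs : 0 < s)
      have hf : (0 : ℝ) < m.factorial := by positivity
      have h2 : s ^ (2 * m) ≤ m.factorial * Real.exp (s ^ 2) := by
        have := Real.pow_div_factorial_le_exp (s ^ 2) (by positivity) m
        rw [div_le_iff₀ hf] at this
        rw [pow_mul]; linarith
      have h3 : Real.exp (-s ^ 4) * Real.exp (s ^ 2) ≤
          Real.exp (1 / 2) * Real.exp (-(1 / 2) * s ^ 4) := by
        rw [← Real.exp_add, ← Real.exp_add]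
        apply Real.exp_le_exp.2
        nlinarith [sq_nonneg (s ^ 2 - 1)]
      calc Real.exp (-s ^ 4) * s ^ (n - 1 + 2 * m)
          = (Real.exp (-s ^ 4) * s ^ (n - 1)) * s ^ (2 * m) := by rw [pow_add]; ring
        _ ≤ (Real.exp (-s ^ 4) * s ^ (n - 1)) * (m.factorial * Real.exp (s ^ 2)) := by gcongr
        _ = (Real.exp (-s ^ 4) * Real.exp (s ^ 2)) * (m.factorial * s ^ (n - 1)) := by ring
        _ ≤ (Real.exp (1 / 2) * Real.exp (-(1 / 2) * s ^ 4)) * (m.factorial * s ^ (n - 1)) := by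
            gcongr
        _ = _ := by ring
    rw [integral_const_mul] at h1
    have hf : (0 : ℝ) < m.factorial := by positivity
    nlinarith

/-- The coefficients of `P_ν` with `ν = (n-2)/2`, as a power series in `z²`. -/
noncomputable def besselCoeff (n m : ℕ) : ℝ :=
  (-1) ^ m / 4 ^ m / ((m.factorial : ℝ) * Real.Gamma (((n : ℝ) - 2) / 2 + m + 1))

/-- Each use of `Γ(z+1) = zΓ(z)` has `z ≥ n/2 ≥ 1/2`. The resulting loss of `2^m` in the reciprocal
is harmless against the `4^m` in the Bessel coefficient. -/
theorem gamma_lower_bound {n : ℕ} (hn : 1 ≤ n) (m : ℕ) :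
    Real.Gamma ((n : ℝ) / 2) * (1 / 2) ^ m ≤ Real.Gamma (((n : ℝ) - 2) / 2 + m + 1) := by
  have hn' : (1 : ℝ) ≤ n := by exact_mod_cast hn
  induction m with
  | zero =>
    apply le_of_eq
    rw [pow_zero, mul_one]
    congr 1
    push_cast
    ring
  | succ m ih =>
    have hpos : 0 < ((n : ℝ) - 2) / 2 + m + 1 := by
      have : (0 : ℝ) ≤ m := m.cast_nonneg
      linarith
    have h1 := Real.Gamma_add_one hpos.ne'
    have h2 : ((n : ℝ) - 2) / 2 + (m + 1 : ℕ) + 1 = ((n : ℝ) - 2) / 2 + m + 1 + 1 := by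
      push_cast; ring
    rw [h2, h1, pow_succ]
    have h3 : 1 / 2 ≤ ((n : ℝ) - 2) / 2 + m + 1 := by
      have : (0 : ℝ) ≤ m := m.cast_nonneg
      linarith
    have h4 : 0 < Real.Gamma ((n : ℝ) / 2) := Real.Gamma_pos_of_pos (by linarith)
    calc Real.Gamma ((n : ℝ) / 2) * ((1 / 2) ^ m * (1 / 2))
        = (1 / 2) * (Real.Gamma ((n : ℝ) / 2) * (1 / 2) ^ m) := by ring
      _ ≤ _ := by gcongr

/-- The coefficients of the profile, as a power series in `η²`. -/
noncomputable def profileCoeff (n m : ℕ) : ℝ :=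
  2 ^ (-(((n : ℝ) - 2) / 2)) * (besselCoeff n m * moment n m)

theorem abs_besselCoeff_mul_moment_le {n : ℕ} (hn : 1 ≤ n) :
    ∃ A, 0 < A ∧ ∀ m, |besselCoeff n m| * moment n m ≤ A * (1 / 2) ^ m := by
  obtain ⟨M, hM, h⟩ := exists_moment_le n
  have hn' : (1 : ℝ) ≤ n := by exact_mod_cast hn
  have hG : 0 < Real.Gamma ((n : ℝ) / 2) := Real.Gamma_pos_of_pos (by linarith)
  refine ⟨M / Real.Gamma ((n : ℝ) / 2), by positivity, fun m => ?_⟩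
  have hg := gamma_lower_bound hn m
  have hf : (0 : ℝ) < m.factorial := by positivity
  have hb : 0 < Real.Gamma ((n : ℝ) / 2) * (1 / 2) ^ m := by positivity
  have e : |besselCoeff n m| = 1 / 4 ^ m /
      ((m.factorial : ℝ) * Real.Gamma (((n : ℝ) - 2) / 2 + m + 1)) := by
    rw [besselCoeff, abs_div, abs_div, abs_pow, abs_neg, abs_one, one_pow,
      abs_of_pos (mul_pos hf (hb.trans_le hg)), abs_of_pos (by positivity : (0 : ℝ) < 4 ^ m)]
  rw [e]
  calc 1 / 4 ^ m / ((m.factorial : ℝ) * Real.Gamma (((n : ℝ) - 2) / 2 + m + 1)) * moment n m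
      ≤ 1 / 4 ^ m / ((m.factorial : ℝ) * (Real.Gamma ((n : ℝ) / 2) * (1 / 2) ^ m)) *
        (m.factorial * M) := by
        gcongr
        · exact (moment_pos n m).le
        · exact h m
    _ = M / Real.Gamma ((n : ℝ) / 2) * (1 / 2) ^ m := by
        have : (4 : ℝ) ^ m = 2 ^ m * 2 ^ m := by rw [← mul_pow]; norm_num
        rw [this, one_div_pow]
        field_simp

/-- For `|η| ≤ 1` the `L¹` norms of the terms are dominated by a geometric series, so sum and
integral may be exchanged. Larger `η` is never needed. -/
theorem profile_eq_tsum {n : ℕ} (hn : 1 ≤ n) {η : ℝ} (hη : |η| ≤ 1) :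
    profile n η = ∑' m, profileCoeff n m * (η ^ 2) ^ m := by
  obtain ⟨A, hA, hb⟩ := abs_besselCoeff_mul_moment_le hn
  have hη2 : η ^ 2 ≤ 1 := by rw [← sq_abs]; exact pow_le_one₀ (abs_nonneg _) hη
  set F : ℕ → ℝ → ℝ := fun m s =>
    (besselCoeff n m * (η ^ 2) ^ m) * (Real.exp (-s ^ 4) * s ^ (n - 1 + 2 * m)) with hF
  have hint : ∀ m, IntegrableOn (F m) (Ioi 0) := fun m => (moment_integrable n m).const_mul _
  have hnorm : ∀ m, ∫ s in Ioi (0 : ℝ), ‖F m s‖ = |besselCoeff n m| * (η ^ 2) ^ m * moment n m := by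
    intro m
    rw [moment, ← integral_const_mul]
    refine setIntegral_congr_fun measurableSet_Ioi fun s (hs : 0 < s) => ?_
    simp only [hF, Real.norm_eq_abs, abs_mul, abs_pow, Real.abs_exp, abs_of_pos hs, sq_abs]
  have hsum : Summable fun m => ∫ s in Ioi (0 : ℝ), ‖F m s‖ := by
    refine Summable.of_nonneg_of_le (fun m => integral_nonneg fun s => norm_nonneg _) (fun m => ?_)
      ((summable_geometric_of_lt_one (r := (1 : ℝ) / 2) (by norm_num) (by norm_num)).mul_left A)
    rw [hnorm]
    have h1 : (η ^ 2) ^ m ≤ 1 := pow_le_one₀ (sq_nonneg _) hη2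
    calc |besselCoeff n m| * (η ^ 2) ^ m * moment n m
        ≤ |besselCoeff n m| * 1 * moment n m := by
          gcongr
          exact (moment_pos n m).le
      _ ≤ _ := by rw [mul_one]; exact hb m
  have key := integral_tsum_of_summable_integral_norm hint hsum
  have h2 : (∫ s in Ioi (0 : ℝ), Real.exp (-s ^ 4) * s ^ (n - 1) *
      besselP (((n : ℝ) - 2) / 2) (η * s)) = ∫ s in Ioi (0 : ℝ), ∑' m, F m s := by
    refine setIntegral_congr_fun measurableSet_Ioi fun s _ => ?_
    simp only [besselP]
    rw [← tsum_mul_left]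
    refine tsum_congr fun m => ?_
    simp only [hF, besselCoeff]
    have h4 : (η * s / 2) ^ (2 * m) = (η ^ 2) ^ m * s ^ (2 * m) / 4 ^ m := by
      rw [pow_mul, pow_mul, ← mul_pow, ← div_pow]
      ring
    rw [h4, pow_add]
    ring
  rw [profile, h2, ← key, ← tsum_mul_left]
  refine tsum_congr fun m => ?_
  simp only [hF]
  rw [integral_const_mul, profileCoeff, moment]
  ring

/-- The profile as a function of `η²`, as a power series. -/
noncomputable def profileSeries (n : ℕ) : FormalMultilinearSeries ℝ ℝ ℝ :=
  FormalMultilinearSeries.ofScalars ℝ (profileCoeff n)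

theorem profileSeries_radius_pos {n : ℕ} (hn : 1 ≤ n) : 0 < (profileSeries n).radius := by
  obtain ⟨A, hA, hb⟩ := abs_besselCoeff_mul_moment_le hn
  have h : ((1 : NNReal) : ENNReal) ≤ (profileSeries n).radius := by
    refine FormalMultilinearSeries.le_radius_of_bound _
      (2 ^ (-(((n : ℝ) - 2) / 2)) * A) fun m => ?_
    rw [profileSeries, FormalMultilinearSeries.ofScalars_norm, profileCoeff, norm_mul, norm_mul,
      Real.norm_eq_abs, Real.norm_eq_abs, Real.norm_eq_abs,
      abs_of_pos (by positivity : (0 : ℝ) < 2 ^ (-(((n : ℝ) - 2) / 2))),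
      abs_of_pos (moment_pos n m)]
    simp only [NNReal.coe_one, one_pow, mul_one]
    gcongr
    refine (hb m).trans ?_
    have : ((1 : ℝ) / 2) ^ m ≤ 1 := pow_le_one₀ (by norm_num) (by norm_num)
    nlinarith
  exact lt_of_lt_of_le (by simp) h

theorem profile_eq_sum {n : ℕ} (hn : 1 ≤ n) {η : ℝ} (hη : |η| ≤ 1) :
    profile n η = (profileSeries n).sum (η ^ 2) := by
  rw [profile_eq_tsum hn hη, profileSeries]
  change _ = FormalMultilinearSeries.ofScalarsSum (profileCoeff n) (η ^ 2)
  rw [FormalMultilinearSeries.ofScalars_sum_eq]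
  simp

theorem profileCoeff_zero_pos {n : ℕ} (hn : 1 ≤ n) : 0 < profileCoeff n 0 := by
  have hn' : (1 : ℝ) ≤ n := by exact_mod_cast hn
  have h : 0 < Real.Gamma (((n : ℝ) - 2) / 2 + (0 : ℕ) + 1) :=
    Real.Gamma_pos_of_pos (by push_cast; linarith)
  have := moment_pos n 0
  unfold profileCoeff besselCoeff
  positivity

/-- The alternating sign of the Bessel series is the source of `ΔB ≤ 0` near the centre. -/
theorem profileCoeff_one_neg {n : ℕ} (hn : 1 ≤ n) : profileCoeff n 1 < 0 := by
  have hn' : (1 : ℝ) ≤ n := by exact_mod_cast hn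
  have h : 0 < Real.Gamma (((n : ℝ) - 2) / 2 + (1 : ℕ) + 1) :=
    Real.Gamma_pos_of_pos (by push_cast; linarith)
  have := moment_pos n 1
  have h2 : profileCoeff n 1 = - (2 ^ (-(((n : ℝ) - 2) / 2)) *
    (1 / 4 / ((Nat.factorial 1 : ℝ) * Real.Gamma (((n : ℝ) - 2) / 2 + (1 : ℕ) + 1)) *
      moment n 1)) := by
    unfold profileCoeff besselCoeff
    ring
  rw [h2, neg_lt_zero]
  positivity

theorem continuousAt_laplacian {n : ℕ} {f : Euc n → ℝ} {x : Euc n} (hf : ContDiffAt ℝ 2 f x) :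
    ContinuousAt (Laplacian.laplacian f) x := by
  rw [InnerProductSpace.laplacian_eq_iteratedFDeriv_orthonormalBasis f
    (EuclideanSpace.basisFun (Fin n) ℝ)]
  have h : ContinuousAt (iteratedFDeriv ℝ 2 f) x := by
    have := (hf.iteratedFDeriv_right (m := 0) (i := 2) (by norm_num))
    exact this.continuousAt
  unfold ContinuousAt
  refine tendsto_finsetSum _ fun i _ => ?_
  exact ((ContinuousMultilinearMap.apply ℝ (fun _ : Fin 2 => Euc n) ℝ
    ![stdVec i, stdVec i]).continuous.continuousAt (x := iteratedFDeriv ℝ 2 f x)).tendsto.comp h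

/-- The `i`-th partial derivative is `2yᵢ g'(|y|²)`. At the origin only the derivative of the factor
`yᵢ` survives, contributing `2g'(0)` for each `i`. -/
theorem laplacian_comp_norm_sq_zero {n : ℕ} {g : ℝ → ℝ} (hg : ContDiffAt ℝ 2 g 0) :
    Laplacian.laplacian (fun x : Euc n => g (‖x‖ ^ 2)) 0 = 2 * n * deriv g 0 := by
  have hN : ContDiff ℝ 2 (fun x : Euc n => ‖x‖ ^ 2) := contDiff_norm_sq ℝ
  have h0 : ‖(0 : Euc n)‖ ^ 2 = 0 := by simp
  have hcomp : ContDiffAt ℝ 2 (fun x : Euc n => g (‖x‖ ^ 2)) 0 :=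
    ContDiffAt.comp (0 : Euc n) (by rwa [h0]) hN.contDiffAt
  rw [laplacian_eq_sum hcomp]
  have hev : ∀ᶠ y in 𝓝 (0 : ℝ), ContDiffAt ℝ 2 g y := hg.eventually (by simp)
  have hev2 : ∀ᶠ x in 𝓝 (0 : Euc n), ContDiffAt ℝ 2 g (‖x‖ ^ 2) := by
    have : Tendsto (fun x : Euc n => ‖x‖ ^ 2) (𝓝 0) (𝓝 0) := by
      have := hN.continuous.tendsto 0
      rwa [h0] at this
    exact this.eventually hev
  have hterm : ∀ i : Fin n, fderiv ℝ (fun y : Euc n =>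
      fderiv ℝ (fun x : Euc n => g (‖x‖ ^ 2)) y (stdVec i)) 0 (stdVec i) = 2 * deriv g 0 := by
    intro i
    have h1 : (fun y : Euc n => fderiv ℝ (fun x : Euc n => g (‖x‖ ^ 2)) y (stdVec i)) =ᶠ[𝓝 0]
        fun y => deriv g (‖y‖ ^ 2) * (2 * inner ℝ y (stdVec i)) := by
      filter_upwards [hev2] with y hy
      have hd := (hy.differentiableAt (by norm_num)).hasDerivAt
      have := hd.comp_hasFDerivAt y (hasStrictFDerivAt_norm_sq y).hasFDerivAt
      have h2 := this.fderiv
      change fderiv ℝ (fun x : Euc n => g (‖x‖ ^ 2)) y = _ at h2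
      rw [h2]
      simp
    rw [h1.fderiv_eq]
    have hd1 : DifferentiableAt ℝ (fun y : Euc n => deriv g (‖y‖ ^ 2)) 0 := by
      have hdg : DifferentiableAt ℝ (deriv g) (‖(0 : Euc n)‖ ^ 2) := by
        rw [h0]
        have hfd : DifferentiableAt ℝ (fderiv ℝ g) 0 :=
          (hg.fderiv_right (m := 1) (by norm_num)).differentiableAt (by norm_num)
        exact hfd.clm_apply (differentiableAt_const (1 : ℝ))
      exact hdg.comp (0 : Euc n) (hN.differentiable (by norm_num) 0)
    have hd2 : HasFDerivAt (fun y : Euc n => 2 * inner ℝ y (stdVec i))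
        ((2 : ℝ) • innerSL ℝ (stdVec i)) 0 := by
      have := ((innerSL ℝ (stdVec i : Euc n)).hasFDerivAt (x := 0)).const_mul 2
      refine this.congr_of_eventuallyEq (Eventually.of_forall fun y => ?_)
      simp [real_inner_comm]
    have h3 := (hd1.hasFDerivAt.mul hd2).fderiv
    simp only [Pi.mul_def] at h3
    rw [h3]
    simp
    ring
  rw [Finset.sum_congr rfl fun i _ => hterm i]
  simp
  ring

/-- The kernel at time one. -/
noncomputable def unitKernel (n : ℕ) (x : Euc n) : ℝ := kernel n x 1

/-- Writing the time as `ρ⁴` removes all fractional exponents; the kernel is used in this form from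
here on. -/
theorem kernel_pow_four {n : ℕ} (x : Euc n) {ρ : ℝ} (hρ : 0 < ρ) :
    kernel n x (ρ ^ 4) = (ρ ^ n)⁻¹ * unitKernel n (ρ⁻¹ • x) := by
  have h1 : (ρ ^ 4) ^ (1 / 4 : ℝ) = ρ := by
    rw [← Real.rpow_natCast, ← Real.rpow_mul hρ.le]; norm_num
  have h2 : (ρ ^ 4) ^ ((n : ℝ) / 4) = ρ ^ n := by
    rw [← Real.rpow_natCast, ← Real.rpow_mul hρ.le, ← Real.rpow_natCast]
    congr 1
    push_cast
    ring
  have h3 : ‖ρ⁻¹ • x‖ = ‖x‖ / ρ := by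
    rw [norm_smul, norm_inv, Real.norm_of_nonneg hρ.le]; ring
  simp only [unitKernel, kernel, h1, h2, h3, Real.one_rpow, div_one]
  ring

theorem laplacian_kernel_pow_four {n : ℕ} (x : Euc n) {ρ : ℝ} (hρ : 0 < ρ) :
    Laplacian.laplacian (fun y : Euc n => kernel n y (ρ ^ 4)) x =
      (ρ ^ (n + 2))⁻¹ * Laplacian.laplacian (unitKernel n) (ρ⁻¹ • x) := by
  have : (fun y : Euc n => kernel n y (ρ ^ 4)) =
      fun y => (ρ ^ n)⁻¹ * (fun z => unitKernel n (ρ⁻¹ • z)) y :=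
    funext fun y => kernel_pow_four y hρ
  rw [this, laplacian_const_mul, laplacian_comp_smul _ (inv_ne_zero hρ.ne'), pow_add, mul_inv, inv_pow]
  ring

theorem unitKernel_eq {n : ℕ} (hn : 1 ≤ n) {x : Euc n} (hx : ‖x‖ ≤ 1) :
    unitKernel n x = (2 * Real.pi) ^ (-((n : ℝ) / 2)) * (profileSeries n).sum (‖x‖ ^ 2) := by
  simp only [unitKernel, kernel, Real.one_rpow, div_one]
  rw [profile_eq_sum hn (by simpa using hx)]

/-- The first two coefficients of the profile make the kernel positive and its Laplacian negative at
the origin. Both are continuous there, so the signs persist on a small ball. -/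
theorem exists_unitKernel_bounds {n : ℕ} (hn : 1 ≤ n) :
    ∃ c C : ℝ, 0 < c ∧ c ≤ 1 ∧ 0 < C ∧ ContinuousOn (unitKernel n) (Metric.ball 0 c) ∧
      ContinuousOn (Laplacian.laplacian (unitKernel n)) (Metric.ball 0 c) ∧
      ∀ x ∈ Metric.ball (0 : Euc n) c, 0 ≤ unitKernel n x ∧ unitKernel n x ≤ C ∧
        -C ≤ Laplacian.laplacian (unitKernel n) x ∧
        Laplacian.laplacian (unitKernel n) x ≤ 0 := by
  have hps := (profileSeries n).hasFPowerSeriesOnBall (profileSeries_radius_pos hn)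
  set G := (profileSeries n).sum with hG
  have hGa : AnalyticAt ℝ G 0 := hps.analyticAt
  have hG2 : ContDiffAt ℝ 2 G 0 := hGa.contDiffAt
  have hG0 : G 0 = profileCoeff n 0 := by
    rw [← hps.coeff_zero ![]]
    simp [profileSeries]
  have hG1 : deriv G 0 = profileCoeff n 1 := by
    rw [hps.hasFPowerSeriesAt.deriv]
    simp [profileSeries]
  set α : ℝ := (2 * Real.pi) ^ (-((n : ℝ) / 2)) with hα
  have hαpos : 0 < α := by positivity
  have hN : ContDiff ℝ 2 (fun x : Euc n => ‖x‖ ^ 2) := contDiff_norm_sq ℝ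
  have heq : unitKernel n =ᶠ[𝓝 0] fun x => α * (fun y : Euc n => G (‖y‖ ^ 2)) x := by
    filter_upwards [Metric.closedBall_mem_nhds (0 : Euc n) one_pos] with x hx
    exact unitKernel_eq hn (by simpa using hx)
  have hcd : ContDiffAt ℝ 2 (unitKernel n) 0 := by
    refine ContDiffAt.congr_of_eventuallyEq ?_ heq
    have : ContDiffAt ℝ 2 (G ∘ fun y : Euc n => ‖y‖ ^ 2) 0 :=
      ContDiffAt.comp (0 : Euc n) (by simpa using hG2) hN.contDiffAt
    exact contDiffAt_const.mul this
  have hn0 : (0 : ℝ) < n := by exact_mod_cast hn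
  have hv : 0 < unitKernel n 0 := by
    rw [heq.self_of_nhds]
    simp only [norm_zero, ne_eq, OfNat.ofNat_ne_zero, not_false_eq_true, zero_pow, hG0]
    exact mul_pos hαpos (profileCoeff_zero_pos hn)
  have hl : Laplacian.laplacian (unitKernel n) 0 < 0 := by
    rw [(InnerProductSpace.laplacian_congr_nhds heq).self_of_nhds, laplacian_const_mul,
      laplacian_comp_norm_sq_zero hG2, hG1]
    have := profileCoeff_one_neg hn
    have h2 : 0 < α * (2 * n) := by positivity
    nlinarith
  have hc1 : ∀ᶠ x in 𝓝 (0 : Euc n), ContDiffAt ℝ 2 (unitKernel n) x := hcd.eventually (by simp)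
  have hk := hcd.continuousAt
  have hL := continuousAt_laplacian hcd
  -- Both contributions to this difference are positive, so it strictly exceeds the value of the
  -- kernel and minus the value of its Laplacian at the origin.
  set C := unitKernel n 0 - Laplacian.laplacian (unitKernel n) 0 with hC
  have e1 := hk.eventually (Ioo_mem_nhds hv (by linarith : unitKernel n 0 < C))
  have e2 := hL.eventually (Ioo_mem_nhds (by linarith : -C < _) hl)
  obtain ⟨c, hc, hcb⟩ := Metric.eventually_nhds_iff_ball.1 ((hc1.and e1).and e2)
  have hsub : Metric.ball (0 : Euc n) (min c 1) ⊆ Metric.ball 0 c :=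
    Metric.ball_subset_ball (min_le_left _ _)
  refine ⟨min c 1, C, by positivity, min_le_right _ _, by linarith, fun x hx => ?_, fun x hx => ?_,
    fun x hx => ?_⟩
  · exact (hcb x (hsub hx)).1.1.continuousAt.continuousWithinAt
  · exact (continuousAt_laplacian (hcb x (hsub hx)).1.1).continuousWithinAt
  · obtain ⟨⟨_, h1⟩, h2⟩ := hcb x (hsub hx)
    exact ⟨h1.1.le, h1.2.le, h2.1.le, h2.2.le⟩

/-! ### Partial derivatives of smooth functions on `ℝⁿ` -/

theorem two_le_infty : (2 : WithTop ℕ∞) ≤ ∞ := by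
  have : ((2 : ℕ∞) : WithTop ℕ∞) ≤ ((⊤ : ℕ∞) : WithTop ℕ∞) := WithTop.coe_le_coe.2 le_top
  exact this

/-- The partial derivative `∂ᵢf`. -/
noncomputable def partialD {n : ℕ} (i : Fin n) (f : Euc n → ℝ) (x : Euc n) : ℝ :=
  fderiv ℝ f x (stdVec i)

section Slices

variable {n : ℕ} {f g : Euc n → ℝ}

theorem contDiff_partialD (hf : ContDiff ℝ ∞ f) (i : Fin n) : ContDiff ℝ ∞ (partialD i f) :=
  (hf.fderiv_right (m := ∞) (by simp)).clm_apply contDiff_const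

theorem laplacian_eq_sum_partialD (hf : ContDiff ℝ ∞ f) :
    Laplacian.laplacian f = fun x => ∑ i, partialD i (partialD i f) x := by
  ext x
  rw [laplacian_eq_sum (hf.contDiffAt.of_le two_le_infty)]
  rfl

theorem contDiff_laplacian (hf : ContDiff ℝ ∞ f) : ContDiff ℝ ∞ (Laplacian.laplacian f) := by
  rw [laplacian_eq_sum_partialD hf]
  exact ContDiff.sum fun i _ => contDiff_partialD (contDiff_partialD hf i) i

theorem partialD_comm (hf : ContDiff ℝ ∞ f) (i j : Fin n) :
    partialD i (partialD j f) = partialD j (partialD i f) := by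
  ext x
  have hd : DifferentiableAt ℝ (fderiv ℝ f) x :=
    ((hf.fderiv_right (m := ∞) (by simp)).differentiable (by simp)) x
  have hs : IsSymmSndFDerivAt ℝ f x :=
    (hf.contDiffAt (x := x)).isSymmSndFDerivAt (by simpa using two_le_infty)
  have key : ∀ k l : Fin n, partialD k (partialD l f) x =
      fderiv ℝ (fderiv ℝ f) x (stdVec k) (stdVec l) := by
    intro k l
    unfold partialD
    rw [fderiv_clm_apply hd (by fun_prop)]
    simp
  rw [key, key, hs]

theorem partialD_sum {ι : Type*} (s : Finset ι) {F : ι → Euc n → ℝ}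
    (hF : ∀ a, ContDiff ℝ ∞ (F a)) (i : Fin n) :
    partialD i (fun x => ∑ a ∈ s, F a x) = fun x => ∑ a ∈ s, partialD i (F a) x := by
  ext x
  unfold partialD
  rw [fderiv_fun_sum fun a _ => (hF a).differentiable (by simp) x]
  simp

theorem laplacian_sum {ι : Type*} (s : Finset ι) {F : ι → Euc n → ℝ}
    (hF : ∀ a, ContDiff ℝ ∞ (F a)) :
    Laplacian.laplacian (fun x => ∑ a ∈ s, F a x) =
      fun x => ∑ a ∈ s, Laplacian.laplacian (F a) x := by
  rw [laplacian_eq_sum_partialD (ContDiff.sum fun a _ => hF a)]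
  simp only [partialD_sum s hF, partialD_sum s (fun a => contDiff_partialD (hF a) _)]
  ext x
  rw [Finset.sum_comm]
  exact Finset.sum_congr rfl fun a _ => by rw [laplacian_eq_sum_partialD (hF a)]

theorem partialD_laplacian (hf : ContDiff ℝ ∞ f) (i : Fin n) :
    partialD i (Laplacian.laplacian f) = Laplacian.laplacian (partialD i f) := by
  rw [laplacian_eq_sum_partialD hf, laplacian_eq_sum_partialD (contDiff_partialD hf i),
    partialD_sum _ (fun j => contDiff_partialD (contDiff_partialD hf j) j)]
  ext x
  refine Finset.sum_congr rfl fun j _ => ?_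
  rw [partialD_comm (contDiff_partialD hf j), partialD_comm hf i j]

theorem partialD_neg (f : Euc n → ℝ) (i : Fin n) (x : Euc n) :
    partialD i (fun y => -f y) x = -partialD i f x := by
  simp [partialD]

theorem partialD_mul (hf : ContDiff ℝ ∞ f) (hg : ContDiff ℝ ∞ g) (i : Fin n) (x : Euc n) :
    partialD i (fun y => f y * g y) x = partialD i f x * g x + f x * partialD i g x := by
  unfold partialD
  rw [fderiv_fun_mul (hf.differentiable (by simp) x) (hg.differentiable (by simp) x)]
  simp
  ring

theorem laplacian_mul (hf : ContDiff ℝ ∞ f) (hg : ContDiff ℝ ∞ g) (x : Euc n) :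
    Laplacian.laplacian (fun y => f y * g y) x =
      Laplacian.laplacian f x * g x + 2 * ∑ i, partialD i f x * partialD i g x +
        f x * Laplacian.laplacian g x := by
  rw [laplacian_eq_sum_partialD (hf.mul hg), laplacian_eq_sum_partialD hf,
    laplacian_eq_sum_partialD hg]
  simp only
  rw [Finset.sum_mul, Finset.mul_sum, Finset.mul_sum, ← Finset.sum_add_distrib,
    ← Finset.sum_add_distrib]
  refine Finset.sum_congr rfl fun i _ => ?_
  have h1 : partialD i (fun y => f y * g y) =
      fun y => partialD i f y * g y + f y * partialD i g y := funext (partialD_mul hf hg i)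
  have hfi := contDiff_partialD hf i
  have hgi := contDiff_partialD hg i
  have h2 : partialD i (fun y => partialD i f y * g y + f y * partialD i g y) x =
      partialD i (fun y => partialD i f y * g y) x + partialD i (fun y => f y * partialD i g y) x := by
    change fderiv ℝ (fun y => partialD i f y * g y + f y * partialD i g y) x (stdVec i) = _
    rw [fderiv_fun_add ((hfi.mul hg).differentiable (by simp) x)
      ((hf.mul hgi).differentiable (by simp) x)]
    rfl
  rw [h1, h2, partialD_mul hfi hg, partialD_mul hf hgi]
  ring

theorem norm_gradient_sq (f : Euc n → ℝ) (x : Euc n) :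
    ‖gradient f x‖ ^ 2 = ∑ i, partialD i f x ^ 2 := by
  rw [← (EuclideanSpace.basisFun (Fin n) ℝ).sum_sq_norm_inner_right (gradient f x)]
  refine Finset.sum_congr rfl fun i _ => ?_
  rw [Real.norm_eq_abs, sq_abs, real_inner_comm, gradient, InnerProductSpace.toDual_symm_apply]
  rfl

theorem norm_iteratedFDeriv_partialD_le (hf : ContDiff ℝ ∞ f) (i : Fin n) (k : ℕ) (x : Euc n) :
    ‖iteratedFDeriv ℝ k (partialD i f) x‖ ≤ ‖iteratedFDeriv ℝ (k + 1) f x‖ := by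
  have h := (ContinuousLinearMap.apply ℝ ℝ (stdVec i : Euc n)).norm_iteratedFDeriv_comp_left
    ((hf.fderiv_right (m := ∞) (by simp)).contDiffAt (x := x)) (n := k)
    (by exact_mod_cast le_top)
  have hL : ‖ContinuousLinearMap.apply ℝ ℝ (stdVec i : Euc n)‖ ≤ 1 := by
    refine ContinuousLinearMap.opNorm_le_bound _ zero_le_one fun L => ?_
    have := L.le_opNorm (stdVec i : Euc n)
    simpa using this
  rw [norm_iteratedFDeriv_fderiv] at h
  refine h.trans ?_
  exact mul_le_of_le_one_left (norm_nonneg _) hL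

theorem abs_partialD_le (hf : ContDiff ℝ ∞ f) (i : Fin n) (x : Euc n) :
    |partialD i f x| ≤ ‖iteratedFDeriv ℝ 1 f x‖ := by
  have := norm_iteratedFDeriv_partialD_le hf i 0 x
  simpa using this

theorem abs_partialD_partialD_le (hf : ContDiff ℝ ∞ f) (i j : Fin n) (x : Euc n) :
    |partialD j (partialD i f) x| ≤ ‖iteratedFDeriv ℝ 2 f x‖ :=
  (abs_partialD_le (contDiff_partialD hf i) j x).trans (norm_iteratedFDeriv_partialD_le hf i 1 x)

theorem abs_partialD_partialD_partialD_le (hf : ContDiff ℝ ∞ f) (i j k : Fin n) (x : Euc n) :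
    |partialD k (partialD j (partialD i f)) x| ≤ ‖iteratedFDeriv ℝ 3 f x‖ :=
  (abs_partialD_partialD_le (contDiff_partialD hf i) j k x).trans
    (norm_iteratedFDeriv_partialD_le hf i 2 x)

theorem abs_laplacian_le (hf : ContDiff ℝ ∞ f) (x : Euc n) :
    |Laplacian.laplacian f x| ≤ n * ‖iteratedFDeriv ℝ 2 f x‖ := by
  rw [laplacian_eq_sum_partialD hf]
  refine (Finset.abs_sum_le_sum_abs _ _).trans ?_
  refine (Finset.sum_le_sum fun i _ => abs_partialD_partialD_le hf i i x).trans ?_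
  simp

theorem abs_partialD_laplacian_le (hf : ContDiff ℝ ∞ f) (j : Fin n) (x : Euc n) :
    |partialD j (Laplacian.laplacian f) x| ≤ n * ‖iteratedFDeriv ℝ 3 f x‖ := by
  rw [laplacian_eq_sum_partialD hf,
    partialD_sum _ (fun i => contDiff_partialD (contDiff_partialD hf i) i)]
  refine (Finset.abs_sum_le_sum_abs _ _).trans ?_
  refine (Finset.sum_le_sum fun i _ => abs_partialD_partialD_partialD_le hf i i j x).trans ?_
  simp

/-- Green's formula, one of the two functions having compact support. -/
theorem integral_laplacian_mul (hf : ContDiff ℝ ∞ f) (hg : ContDiff ℝ ∞ g)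
    (hgs : HasCompactSupport g) :
    ∫ x, Laplacian.laplacian f x * g x = ∫ x, f x * Laplacian.laplacian g x := by
  have hcs : ∀ {h : Euc n → ℝ}, HasCompactSupport h → ∀ i : Fin n,
      HasCompactSupport (partialD i h) := by
    intro h hh i
    exact hh.fderiv_apply (𝕜 := ℝ) (stdVec i)
  have hint : ∀ {a b : Euc n → ℝ}, ContDiff ℝ ∞ a → ContDiff ℝ ∞ b → HasCompactSupport b →
      Integrable fun x => a x * b x := by
    intro a b ha hb hbs
    exact (ha.continuous.mul hb.continuous).integrable_of_hasCompactSupport hbs.mul_left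
  have hpart : ∀ {a b : Euc n → ℝ}, ContDiff ℝ ∞ a → ContDiff ℝ ∞ b → HasCompactSupport b →
      ∀ i : Fin n, ∫ x, a x * partialD i b x = -∫ x, partialD i a x * b x := by
    intro a b ha hb hbs i
    exact integral_mul_fderiv_eq_neg_fderiv_mul_of_integrable
      (hint (contDiff_partialD ha i) hb hbs) (hint ha (contDiff_partialD hb i) (hcs hbs i))
      (hint ha hb hbs) (fun x _ => ha.differentiable (by simp) x)
      (fun x _ => hb.differentiable (by simp) x)
  rw [laplacian_eq_sum_partialD hf, laplacian_eq_sum_partialD hg]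
  simp only [Finset.sum_mul, Finset.mul_sum]
  rw [integral_finsetSum, integral_finsetSum]
  · refine Finset.sum_congr rfl fun i _ => ?_
    have hfi := contDiff_partialD hf i
    have hgi := contDiff_partialD hg i
    have h1 := hpart hf hgi (hcs hgs i) i
    have h2 := hpart hfi hg hgs i
    linarith
  · intro i _
    exact hint hf (contDiff_partialD (contDiff_partialD hg i) i) (hcs (hcs hgs i) i)
  · intro i _
    exact hint (contDiff_partialD (contDiff_partialD hf i) i) hg hgs

end Slices

/-! ### Smooth functions on the closed half space `ℝⁿ × [0,∞)` -/

/-- `u` is smooth on `ℝⁿ × [0,∞)`. -/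
def Smooth {n : ℕ} (u : Euc n → ℝ → ℝ) : Prop :=
  ContDiffOn ℝ ∞ (fun p : Euc n × ℝ => u p.1 p.2) (univ ×ˢ Ici 0)

/-- The spatial partial derivative `∂ᵢu(x,t)`. -/
noncomputable def pd {n : ℕ} (i : Fin n) (u : Euc n → ℝ → ℝ) (x : Euc n) (t : ℝ) : ℝ :=
  partialD i (fun y => u y t) x

section SpaceTime

variable {n : ℕ} {u v : Euc n → ℝ → ℝ}

theorem uniqueDiffOn_halfSpace : UniqueDiffOn ℝ ((univ : Set (Euc n)) ×ˢ Ici (0 : ℝ)) :=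
  uniqueDiffOn_univ.prod (uniqueDiffOn_Ici 0)

protected theorem Smooth.slice (hu : Smooth u) {t : ℝ} (ht : 0 ≤ t) : ContDiff ℝ ∞ (fun x => u x t) := by
  rw [← contDiffOn_univ]
  refine ContDiffOn.comp (t := univ ×ˢ Ici (0 : ℝ)) (f := fun x : Euc n => (x, t)) hu ?_ ?_
  · exact (contDiff_id.prodMk contDiff_const).contDiffOn
  · intro x _; exact ⟨mem_univ _, ht⟩

protected theorem Smooth.continuousOn (hu : Smooth u) :
    ContinuousOn (fun p : Euc n × ℝ => u p.1 p.2) (univ ×ˢ Ici 0) :=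
  ContDiffOn.continuousOn hu

protected theorem Smooth.congr (hu : Smooth u) (h : ∀ x t, 0 ≤ t → v x t = u x t) : Smooth v :=
  ContDiffOn.congr hu fun p hp => h p.1 p.2 hp.2

/-- Horizontal directions stay in the half space, so the derivative of a slice can be read off the
derivative within the half space, also at `t = 0`. This carries smoothness up to the initial time
over to spatial derivatives. -/
theorem Smooth.fderivWithin_apply (hu : Smooth u) {t : ℝ} (ht : 0 ≤ t) (x : Euc n) (i : Fin n) :
    fderivWithin ℝ (fun p : Euc n × ℝ => u p.1 p.2) (univ ×ˢ Ici 0) (x, t) (stdVec i, 0) =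
      pd i u x t := by
  have h1 : HasFDerivWithinAt (fun p : Euc n × ℝ => u p.1 p.2)
      (fderivWithin ℝ (fun p : Euc n × ℝ => u p.1 p.2) (univ ×ˢ Ici 0) (x, t))
      (univ ×ˢ Ici 0) (x, t) :=
    (ContDiffOn.differentiableOn hu (by simp) (x, t) ⟨mem_univ _, ht⟩).hasFDerivWithinAt
  have h2 : HasFDerivWithinAt (fun y : Euc n => (y, t)) (ContinuousLinearMap.inl ℝ (Euc n) ℝ)
      univ x := (hasFDerivAt_prodMk_left x t).hasFDerivWithinAt
  have h3 := h1.comp x h2 (t := univ ×ˢ Ici 0) (fun y _ => ⟨mem_univ _, ht⟩)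
  rw [hasFDerivWithinAt_univ] at h3
  have h4 := h3.fderiv
  change fderiv ℝ (fun y => u y t) x = _ at h4
  simp [pd, partialD, h4]

protected theorem Smooth.pd (hu : Smooth u) (i : Fin n) : Smooth (pd i u) := by
  have h : ContDiffOn ℝ ∞ (fun p : Euc n × ℝ =>
      fderivWithin ℝ (fun p : Euc n × ℝ => u p.1 p.2) (univ ×ˢ Ici 0) p (stdVec i, 0))
      (univ ×ˢ Ici 0) :=
    (ContDiffOn.fderivWithin (m := ∞) hu uniqueDiffOn_halfSpace (by simp)).clm_apply
      contDiffOn_const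
  exact h.congr fun p hp => (hu.fderivWithin_apply hp.2 p.1 i).symm

protected theorem Smooth.sum {ι : Type*} (s : Finset ι) {F : ι → Euc n → ℝ → ℝ} (hF : ∀ a, Smooth (F a)) :
    Smooth (fun x t => ∑ a ∈ s, F a x t) :=
  ContDiffOn.sum fun a _ => hF a

theorem Smooth.lap_eq (hu : Smooth u) {t : ℝ} (ht : 0 ≤ t) (x : Euc n) :
    lap u x t = ∑ i, pd i (pd i u) x t := by
  unfold lap
  rw [laplacian_eq_sum_partialD (hu.slice ht)]
  rfl

protected theorem Smooth.lap (hu : Smooth u) : Smooth (lap u) :=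
  (Smooth.sum Finset.univ fun i => (hu.pd i).pd i).congr fun x _ ht => hu.lap_eq ht x

/-- Symmetry of the second derivative in space-time, which is available at interior times. -/
protected theorem Smooth.hasDerivAt_pd (hu : Smooth u) {t : ℝ} (ht : 0 < t) (x : Euc n) (i : Fin n) :
    HasDerivAt (fun s => pd i u x s) (partialD i (fun y => deriv (fun s => u y s) t) x) t := by
  set U : Euc n × ℝ → ℝ := fun p => u p.1 p.2 with hU
  have hnhds : ∀ y : Euc n, ∀ s : ℝ, 0 < s → ContDiffAt ℝ ∞ U (y, s) := fun y s hs =>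
    ContDiffOn.contDiffAt hu (prod_mem_nhds univ_mem (Ici_mem_nhds hs))
  have hV : DifferentiableAt ℝ (fderiv ℝ U) (x, t) :=
    ((hnhds x t ht).fderiv_right (m := ∞) (by simp)).differentiableAt (by simp)
  have hx : ∀ s : ℝ, 0 < s → pd i u x s = fderiv ℝ U (x, s) (stdVec i, 0) := by
    intro s hs
    have h1 := ((hnhds x s hs).differentiableAt (by simp)).hasFDerivAt.comp
      (f := fun y : Euc n => (y, s)) x (hasFDerivAt_prodMk_left x s)
    have h4 := h1.fderiv
    change fderiv ℝ (fun y => u y s) x = _ at h4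
    simp [pd, partialD, h4]
  have hT : ∀ y : Euc n, deriv (fun s => u y s) t = fderiv ℝ U (y, t) (0, 1) := by
    intro y
    have h1 := ((hnhds y t ht).differentiableAt (by simp)).hasFDerivAt.comp_hasDerivAt t
      ((hasDerivAt_const t y).prodMk (hasDerivAt_id t))
    exact h1.deriv
  have e1 : HasDerivAt (fun s => fderiv ℝ U (x, s) (stdVec i, 0))
      (fderiv ℝ (fderiv ℝ U) (x, t) (0, 1) (stdVec i, 0)) t := by
    have := hV.hasFDerivAt.comp_hasDerivAt t ((hasDerivAt_const t x).prodMk (hasDerivAt_id t))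
    have h2 := this.clm_apply (hasDerivAt_const t ((stdVec i, 0) : Euc n × ℝ))
    simpa using h2
  have e2 : partialD i (fun y => deriv (fun s => u y s) t) x =
      fderiv ℝ (fderiv ℝ U) (x, t) (stdVec i, 0) (0, 1) := by
    simp only [hT]
    have h1 := hV.hasFDerivAt.comp (f := fun y : Euc n => (y, t)) x (hasFDerivAt_prodMk_left x t)
    have h2 := h1.clm_apply (hasFDerivAt_const ((0, 1) : Euc n × ℝ) x)
    have h4 := h2.fderiv
    simp only [Function.comp_def] at h4
    simp [partialD, h4]
  have hs : IsSymmSndFDerivAt ℝ U (x, t) := (hnhds x t ht).isSymmSndFDerivAt (by simpa using two_le_infty)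
  rw [e2, hs]
  refine e1.congr_of_eventuallyEq ?_
  filter_upwards [Ioi_mem_nhds ht] with s hs using hx s hs

/-- `u` is smooth on `ℝⁿ × [0,∞)` and solves `∂ₜu = -Δ²u` for positive times. -/
structure Solves (u : Euc n → ℝ → ℝ) : Prop where
  smooth : Smooth u
  hasDerivAt : ∀ x t, 0 < t → HasDerivAt (fun s => u x s) (-lap (lap u) x t) t

theorem lap_congr_slice {t : ℝ} (h : ∀ x, u x t = v x t) (x : Euc n) : lap u x t = lap v x t := by
  unfold lap
  rw [funext h]

protected theorem Solves.congr (hu : Solves u) (h : ∀ x t, 0 ≤ t → v x t = u x t) : Solves v where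
  smooth := hu.smooth.congr h
  hasDerivAt x t ht := by
    have h1 : lap (lap v) x t = lap (lap u) x t :=
      lap_congr_slice (fun y => lap_congr_slice (fun z => h z t ht.le) y) x
    rw [h1]
    refine (hu.hasDerivAt x t ht).congr_of_eventuallyEq ?_
    filter_upwards [Ioi_mem_nhds ht] with s hs using h x s (le_of_lt hs)

/-- The equation has constant coefficients: `∂ᵢ` commutes with `∂ₜ` and with `Δ²`. This makes the
energy inequality applicable to derivatives of a solution. -/
protected theorem Solves.pd (hu : Solves u) (i : Fin n) : Solves (pd i u) where
  smooth := hu.smooth.pd i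
  hasDerivAt x t ht := by
    have h := hu.smooth.hasDerivAt_pd ht x i
    simp only [fun y => (hu.hasDerivAt y t ht).deriv, partialD_neg] at h
    convert h using 2
    have h0 := hu.smooth.slice ht.le
    exact (congrFun ((congrArg Laplacian.laplacian (partialD_laplacian h0 i)).symm.trans
      (partialD_laplacian (contDiff_laplacian h0) i).symm) x)

protected theorem Solves.sum {ι : Type*} (s : Finset ι) {F : ι → Euc n → ℝ → ℝ} (hF : ∀ a, Solves (F a)) :
    Solves (fun x t => ∑ a ∈ s, F a x t) where
  smooth := Smooth.sum s fun a => (hF a).smooth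
  hasDerivAt x t ht := by
    have h : lap (lap (fun x t => ∑ a ∈ s, F a x t)) x t = ∑ a ∈ s, lap (lap (F a)) x t := by
      have h1 : ∀ y, lap (fun x t => ∑ a ∈ s, F a x t) y t =
          (fun x t => ∑ a ∈ s, lap (F a) x t) y t := fun y =>
        congrFun (laplacian_sum s fun a => (hF a).smooth.slice ht.le) y
      rw [lap_congr_slice (v := fun x t => ∑ a ∈ s, lap (F a) x t) h1]
      exact congrFun (laplacian_sum s fun a => (hF a).smooth.lap.slice ht.le) x
    rw [h, ← Finset.sum_neg_distrib]
    exact HasDerivAt.fun_sum fun a _ => (hF a).hasDerivAt x t ht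

protected theorem Solves.lap (hu : Solves u) : Solves (lap u) :=
  (Solves.sum Finset.univ fun i => (hu.pd i).pd i).congr fun x _ ht => hu.smooth.lap_eq ht x

theorem IsBiheatSolution.solves (hu : IsBiheatSolution (Ici 0) u) : Solves u where
  smooth := hu.1
  hasDerivAt x t ht := by
    have h1 : ContDiffAt ℝ ∞ (fun p : Euc n × ℝ => u p.1 p.2) (x, t) :=
      hu.1.contDiffAt (prod_mem_nhds univ_mem (Ici_mem_nhds ht))
    have h2 := (h1.differentiableAt (by simp)).hasFDerivAt.comp_hasDerivAt t
      ((hasDerivAt_const t x).prodMk (hasDerivAt_id t))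
    rw [← hu.2 x t (by simpa using ht)]
    exact h2.differentiableAt.hasDerivAt

end SpaceTime

/-! ### Cut-off functions -/

section Cutoff

variable {n : ℕ}

theorem partialD_comp_smul {f : Euc n → ℝ} (hf : ContDiff ℝ ∞ f) (c : ℝ) (i : Fin n) (x : Euc n) :
    partialD i (fun y => f (c • y)) x = c * partialD i f (c • x) := by
  have h1 : HasFDerivAt (fun y : Euc n => c • y) (c • ContinuousLinearMap.id ℝ (Euc n)) x :=
    (hasFDerivAt_id x).const_smul c
  have h2 := ((hf.differentiable (by simp)) (c • x)).hasFDerivAt.comp x h1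
  have h3 := h2.fderiv
  simp only [Function.comp_def] at h3
  simp [partialD, h3]

theorem hasCompactSupport_partialD {f : Euc n → ℝ} (hf : HasCompactSupport f) (i : Fin n) :
    HasCompactSupport (partialD i f) :=
  hf.fderiv_apply (𝕜 := ℝ) (stdVec i)

theorem exists_abs_le_of_hasCompactSupport {f : Euc n → ℝ} (hf : ContDiff ℝ ∞ f)
    (hs : HasCompactSupport f) : ∃ C, 0 ≤ C ∧ ∀ x, |f x| ≤ C := by
  obtain ⟨C, hC⟩ := hs.exists_bound_of_continuous hf.continuous
  exact ⟨C, (norm_nonneg _).trans (hC 0), hC⟩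

theorem exists_bound_partialD {f : Euc n → ℝ} (hf : ContDiff ℝ ∞ f)
    (hs : HasCompactSupport f) : ∃ C, 0 ≤ C ∧ ∀ i x, |partialD i f x| ≤ C := by
  choose C hC0 hC using fun i : Fin n => exists_abs_le_of_hasCompactSupport
    (contDiff_partialD hf i) (hasCompactSupport_partialD hs i)
  exact ⟨∑ i, C i, Finset.sum_nonneg fun i _ => hC0 i, fun i x => (hC i x).trans
    (Finset.single_le_sum (f := C) (fun j _ => hC0 j) (Finset.mem_univ i))⟩

/-- The test function will be `q²`. A bound on `Δ(q²) = 2qΔq + 2|∇q|²` that is linear in `q`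
requires `|∇q|²` to be controlled by `q`. Taking `q = ζ²` for a bump `ζ` achieves this, since `|∇q|²
= 4q|∇ζ|²`. -/
theorem exists_cutoff (n : ℕ) : ∃ K : ℝ, 0 < K ∧ ∀ ρ : ℝ, 1 ≤ ρ → ∃ q : Euc n → ℝ,
    ContDiff ℝ ∞ q ∧ HasCompactSupport q ∧ (∀ x, 0 ≤ q x ∧ q x ≤ 1) ∧ (∀ x, ‖x‖ ≤ ρ → q x = 1) ∧
    (∀ i x, |partialD i (fun y => q y * q y) x| ≤ K / ρ * q x) ∧
    ∀ x, |Laplacian.laplacian (fun y => q y * q y) x| ≤ K / ρ * q x := by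
  let ζ : ContDiffBump (0 : Euc n) := ⟨1, 2, one_pos, one_lt_two⟩
  have hζ : ContDiff ℝ ∞ ζ := ζ.contDiff
  have hζs : HasCompactSupport ζ := ζ.hasCompactSupport
  set q₁ : Euc n → ℝ := fun x => ζ x * ζ x with hq₁
  have hq : ContDiff ℝ ∞ q₁ := hζ.mul hζ
  have hqs : HasCompactSupport q₁ := hζs.mul_left
  have hq0 : ∀ x, 0 ≤ q₁ x := fun x => mul_self_nonneg _
  have hq1 : ∀ x, q₁ x ≤ 1 := fun x => by
    have := ζ.le_one (x := x)
    have := ζ.nonneg (x := x)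
    simp only [hq₁]; nlinarith
  obtain ⟨A, hA0, hA⟩ := exists_bound_partialD hq hqs
  obtain ⟨B, hB0, hB⟩ := exists_bound_partialD hζ hζs
  obtain ⟨D, hD0, hD⟩ := exists_abs_le_of_hasCompactSupport (contDiff_laplacian hq) (by
    rw [laplacian_eq_sum_partialD hq]
    refine HasCompactSupport.of_support_subset_isCompact hqs.isCompact ?_
    intro x hx
    by_contra hxs
    apply hx
    refine Finset.sum_eq_zero fun i _ => ?_
    have h1 : q₁ =ᶠ[𝓝 x] 0 := notMem_tsupport_iff_eventuallyEq.1 hxs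
    have h2 : partialD i q₁ =ᶠ[𝓝 x] 0 := by
      filter_upwards [h1.eventuallyEq_nhds] with y hy
      simp [partialD, hy.fderiv_eq]
    simp [partialD, h2.fderiv_eq])
  refine ⟨1 + 2 * A + (2 * D + 8 * n * B ^ 2), by positivity, fun ρ hρ => ?_⟩
  have hρ0 : 0 < ρ := by linarith
  have hρi : ρ⁻¹ ≤ 1 := inv_le_one_of_one_le₀ hρ
  have hρp : 0 < ρ⁻¹ := by positivity
  have hχ : ContDiff ℝ ∞ (fun y => q₁ y * q₁ y) := hq.mul hq
  have hpart : ∀ i x, |partialD i (fun y => q₁ y * q₁ y) x| ≤ (2 * A) * q₁ x := by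
    intro i x
    rw [partialD_mul hq hq, show partialD i q₁ x * q₁ x + q₁ x * partialD i q₁ x =
      2 * partialD i q₁ x * q₁ x by ring, abs_mul, abs_mul, abs_of_nonneg (hq0 x), abs_two]
    have := hA i x
    have := hq0 x
    gcongr
  have hlap : ∀ x, |Laplacian.laplacian (fun y => q₁ y * q₁ y) x| ≤
      (2 * D + 8 * n * B ^ 2) * q₁ x := by
    intro x
    have h1 : ∑ i, partialD i q₁ x * partialD i q₁ x = q₁ x * ∑ i, 4 * (partialD i ζ x) ^ 2 := by
      rw [Finset.mul_sum]
      refine Finset.sum_congr rfl fun i _ => ?_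
      rw [hq₁, partialD_mul hζ hζ]
      ring
    have h2 : ∑ i, 4 * (partialD i ζ x) ^ 2 ≤ 4 * n * B ^ 2 := by
      calc ∑ i, 4 * (partialD i ζ x) ^ 2 ≤ ∑ _i : Fin n, 4 * B ^ 2 := by
            refine Finset.sum_le_sum fun i _ => ?_
            rw [← sq_abs]
            have := hB i x
            gcongr
        _ = _ := by simp; ring
    have h3 : 0 ≤ ∑ i, 4 * (partialD i ζ x) ^ 2 := Finset.sum_nonneg fun i _ => by positivity
    rw [laplacian_mul hq hq, h1]
    have h4 := abs_le.1 (hD x)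
    have := hq0 x
    rw [abs_le]
    constructor <;> nlinarith
  refine ⟨fun x => q₁ (ρ⁻¹ • x), hq.comp (contDiff_const_smul _), ?_, fun x => ⟨hq0 _, hq1 _⟩,
    fun x hx => ?_, fun i x => ?_, fun x => ?_⟩
  · exact hqs.comp_smul hρp.ne'
  · have : ζ (ρ⁻¹ • x) = 1 := by
      apply ζ.one_of_mem_closedBall
      simp only [mem_closedBall_zero_iff, norm_smul, norm_inv, Real.norm_of_nonneg hρ0.le]
      rw [inv_mul_le_iff₀ hρ0]
      simpa [ζ] using hx
    simp [hq₁, this]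
  · rw [partialD_comp_smul hχ, abs_mul, abs_of_pos hρp, div_eq_mul_inv]
    have h1 := hpart i (ρ⁻¹ • x)
    have h2 := hq0 (ρ⁻¹ • x)
    have h3 : 0 ≤ (1 + (2 * D + 8 * n * B ^ 2)) * q₁ (ρ⁻¹ • x) := by positivity
    calc ρ⁻¹ * |partialD i (fun y => q₁ y * q₁ y) (ρ⁻¹ • x)|
        ≤ ρ⁻¹ * ((1 + 2 * A + (2 * D + 8 * n * B ^ 2)) * q₁ (ρ⁻¹ • x)) := by
          gcongr; linarith
      _ = _ := by ring
  -- Scaling yields `ρ⁻²`, which is weakened to `ρ⁻¹` by `ρ ≥ 1` so that both bounds have the same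
  -- form.
  · rw [laplacian_comp_smul (fun y => q₁ y * q₁ y) hρp.ne', abs_mul,
      abs_of_pos (by positivity : 0 < ρ⁻¹ ^ 2), div_eq_mul_inv]
    have h1 := hlap (ρ⁻¹ • x)
    have h2 := hq0 (ρ⁻¹ • x)
    have h3 : 0 ≤ (1 + 2 * A) * q₁ (ρ⁻¹ • x) := by positivity
    calc ρ⁻¹ ^ 2 * |Laplacian.laplacian (fun y => q₁ y * q₁ y) (ρ⁻¹ • x)|
        ≤ ρ⁻¹ * ((1 + 2 * A + (2 * D + 8 * n * B ^ 2)) * q₁ (ρ⁻¹ • x)) := by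
          gcongr
          · rw [pow_two]; exact mul_le_of_le_one_left hρp.le hρi
          · linarith
      _ = _ := by ring

end Cutoff

/-! ### Integrals over slabs -/

section Slab

variable {n : ℕ} {d : Euc n × ℝ → ℝ} {a b : ℝ}

theorem integrableOn_slab {K : Set (Euc n)} (hK : IsCompact K)
    (hd : ContinuousOn d (univ ×ˢ Icc a b)) (h0 : ∀ x, x ∉ K → ∀ t, d (x, t) = 0) :
    IntegrableOn d (univ ×ˢ Ioo a b) := by
  have h1 : IntegrableOn d (K ×ˢ Icc a b) :=
    (hd.mono (prod_mono_left (subset_univ _))).integrableOn_compact (hK.prod isCompact_Icc)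
  refine IntegrableOn.of_forall_sdiff_eq_zero h1 (MeasurableSet.univ.prod measurableSet_Ioo) ?_
  rintro ⟨x, t⟩ ⟨h2, h3⟩
  refine h0 x (fun hx => h3 ⟨hx, Ioo_subset_Icc_self h2.2⟩) t

theorem volume_restrict_slab (s : Set ℝ) :
    (volume : Measure (Euc n × ℝ)).restrict (univ ×ˢ s) =
      (volume : Measure (Euc n)).prod ((volume : Measure ℝ).restrict s) := by
  rw [Measure.volume_eq_prod, ← Measure.prod_restrict, Measure.restrict_univ]

theorem slab_integral_left {s : Set ℝ} (hd : IntegrableOn d (univ ×ˢ s)) :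
    ∫ p in univ ×ˢ s, d p = ∫ x, ∫ t in s, d (x, t) := by
  rw [IntegrableOn, volume_restrict_slab] at hd
  rw [volume_restrict_slab, integral_prod _ hd]

theorem slab_integral_right {s : Set ℝ} (hd : IntegrableOn d (univ ×ˢ s)) :
    ∫ p in univ ×ˢ s, d p = ∫ t in s, ∫ x, d (x, t) := by
  rw [IntegrableOn, volume_restrict_slab] at hd
  rw [volume_restrict_slab, integral_prod_symm _ hd]

end Slab

/-! ### The energy inequality -/

section Energy

variable {n : ℕ} {w : Euc n → ℝ → ℝ} {T : ℝ}

theorem Smooth.slice_integrable_mul {f : Euc n → ℝ → ℝ} (hf : Smooth f) {t : ℝ} (ht : 0 ≤ t)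
    {χ : Euc n → ℝ} (hχ : Continuous χ) (hs : HasCompactSupport χ) :
    Integrable fun x => f x t * χ x :=
  ((hf.slice ht).continuous.mul hχ).integrable_of_hasCompactSupport hs.mul_left

theorem Smooth.slab_integrable_mul {f : Euc n → ℝ → ℝ} (hf : Smooth f)
    {χ : Euc n → ℝ} (hχ : Continuous χ) (hs : HasCompactSupport χ) :
    IntegrableOn (fun p : Euc n × ℝ => f p.1 p.2 * χ p.1) (univ ×ˢ Ioo 0 T) := by
  refine integrableOn_slab hs.isCompact ?_ ?_
  · refine (hf.continuousOn.mono ?_).mul (hχ.comp continuous_fst).continuousOn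
    exact prod_mono_right Icc_subset_Ici_self
  · intro x hx t
    simp [image_eq_zero_of_notMem_tsupport hx]

protected theorem Smooth.mul {f g : Euc n → ℝ → ℝ} (hf : Smooth f) (hg : Smooth g) :
    Smooth (fun x t => f x t * g x t) :=
  ContDiffOn.mul hf hg

/-- Integrate the time derivative of `w²χ` at each point, exchange the integrals, and move one
Laplacian from `Δ²w` onto `wχ` by Green's formula on each slice. The compact support of `χ` removes
all questions of decay. -/
theorem Solves.energy_identity (hw : Solves w) (hT : 0 < T) {χ : Euc n → ℝ}
    (hχ : ContDiff ℝ ∞ χ) (hs : HasCompactSupport χ) :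
    IntegrableOn (fun p : Euc n × ℝ => -2 * (lap w p.1 p.2 *
        (lap w p.1 p.2 * χ p.1 + 2 * ∑ i, pd i w p.1 p.2 * partialD i χ p.1 +
          w p.1 p.2 * Laplacian.laplacian χ p.1))) (univ ×ˢ Ioo 0 T) ∧
    (∫ x, w x T * w x T * χ x) - ∫ x, w x 0 * w x 0 * χ x =
      ∫ p in univ ×ˢ Ioo 0 T, -2 * (lap w p.1 p.2 *
        (lap w p.1 p.2 * χ p.1 + 2 * ∑ i, pd i w p.1 p.2 * partialD i χ p.1 +
          w p.1 p.2 * Laplacian.laplacian χ p.1)) := by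
  have hL := hw.smooth.lap
  have hLL := hL.lap
  have hi : IntegrableOn (fun p : Euc n × ℝ => -2 * ((w p.1 p.2 * lap (lap w) p.1 p.2) * χ p.1))
      (univ ×ˢ Ioo 0 T) := ((hw.smooth.mul hLL).slab_integrable_mul hχ.continuous hs).const_mul _
  have h1 : ∀ x, ∫ t in Ioo 0 T, -2 * ((w x t * lap (lap w) x t) * χ x) =
      w x T * w x T * χ x - w x 0 * w x 0 * χ x := by
    intro x
    have hcw : ContinuousOn (fun t => w x t) (Icc 0 T) :=
      hw.smooth.continuousOn.comp (f := fun t : ℝ => (x, t)) (by fun_prop)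
        fun t ht => ⟨mem_univ _, ht.1⟩
    have hcL : ContinuousOn (fun t => lap (lap w) x t) (Icc 0 T) :=
      hLL.continuousOn.comp (f := fun t : ℝ => (x, t)) (by fun_prop)
        fun t ht => ⟨mem_univ _, ht.1⟩
    have h := intervalIntegral.integral_eq_sub_of_hasDerivAt_of_le hT.le
      (f := fun t => w x t * w x t * χ x)
      (f' := fun t => -2 * ((w x t * lap (lap w) x t) * χ x))
      ((hcw.mul hcw).mul continuousOn_const) (fun t ht => ?_) ?_
    · rw [← h, intervalIntegral.integral_of_le hT.le, integral_Ioc_eq_integral_Ioo]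
    · have hd := hw.hasDerivAt x t ht.1
      refine ((hd.mul hd).mul_const (χ x)).congr_deriv ?_
      ring
    · refine ContinuousOn.intervalIntegrable ?_
      rw [uIcc_of_le hT.le]
      exact continuousOn_const.mul ((hcw.mul hcL).mul continuousOn_const)
  have hTi := (hw.smooth.mul hw.smooth).slice_integrable_mul hT.le hχ.continuous hs
  have h0i := (hw.smooth.mul hw.smooth).slice_integrable_mul le_rfl hχ.continuous hs
  have hLi : IntegrableOn (fun p : Euc n × ℝ => -2 * (lap w p.1 p.2 *
        (lap w p.1 p.2 * χ p.1 + 2 * ∑ i, pd i w p.1 p.2 * partialD i χ p.1 +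
          w p.1 p.2 * Laplacian.laplacian χ p.1))) (univ ×ˢ Ioo 0 T) := by
    refine integrableOn_slab hs.isCompact ?_ ?_
    · have hsub : (univ : Set (Euc n)) ×ˢ Icc 0 T ⊆ univ ×ˢ Ici 0 :=
        prod_mono_right Icc_subset_Ici_self
      have c1 := hL.continuousOn.mono hsub
      have c2 := hw.smooth.continuousOn.mono hsub
      have c3 : ∀ i, ContinuousOn (fun p : Euc n × ℝ => pd i w p.1 p.2) (univ ×ˢ Icc 0 T) :=
        fun i => (hw.smooth.pd i).continuousOn.mono hsub
      have d1 : ContinuousOn (fun p : Euc n × ℝ => χ p.1) (univ ×ˢ Icc 0 T) :=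
        (hχ.continuous.comp continuous_fst).continuousOn
      have d2 : ContinuousOn (fun p : Euc n × ℝ => Laplacian.laplacian χ p.1) (univ ×ˢ Icc 0 T) :=
        ((contDiff_laplacian hχ).continuous.comp continuous_fst).continuousOn
      have d3 : ∀ i, ContinuousOn (fun p : Euc n × ℝ => partialD i χ p.1) (univ ×ˢ Icc 0 T) :=
        fun i => ((contDiff_partialD hχ i).continuous.comp continuous_fst).continuousOn
      exact continuousOn_const.mul (c1.mul (((c1.mul d1).add (continuousOn_const.mul
        (continuousOn_finsetSum _ fun i _ => (c3 i).mul (d3 i)))).add (c2.mul d2)))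
    · intro x hx t
      have e1 : χ =ᶠ[𝓝 x] 0 := notMem_tsupport_iff_eventuallyEq.1 hx
      have e2 : ∀ i, partialD i χ x = 0 := fun i => by simp [partialD, e1.fderiv_eq]
      have e3 : Laplacian.laplacian χ x = 0 := by
        rw [(InnerProductSpace.laplacian_congr_nhds e1).self_of_nhds]
        exact congrFun (InnerProductSpace.laplacian_const (c := (0 : ℝ))) x
      simp [e1.self_of_nhds, e2, e3]
  refine ⟨hLi, ?_⟩
  rw [← integral_sub hTi h0i]
  simp only [← h1]
  rw [← slab_integral_left hi, slab_integral_right hi, slab_integral_right hLi]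
  refine setIntegral_congr_fun measurableSet_Ioo fun t ht => ?_
  have ht0 : 0 ≤ t := ht.1.le
  have hws := hw.smooth.slice ht0
  have hg := integral_laplacian_mul (hL.slice ht0) (hws.mul hχ) hs.mul_left
  simp only
  rw [integral_const_mul, integral_const_mul]
  congr 1
  refine Eq.trans ?_ (hg.trans ?_)
  · refine integral_congr_ae (Eventually.of_forall fun x => ?_)
    simp only [lap]
    ring
  · refine integral_congr_ae (Eventually.of_forall fun x => ?_)
    simp only [laplacian_mul hws hχ]
    rfl

/-- The terms containing derivatives of the test function are at most `2(|L|q)b` with `b =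
(K/ρ)(2∑|pᵢ| + |f|)`. Young's inequality absorbs them into half of the good term `-2L²q²`, at the
cost of `b²`. -/
theorem cutoff_pointwise {K ρ L q f g : ℝ} {p e : Fin n → ℝ} (hK : 0 < K) (hρ : 0 < ρ)
    (_hq : 0 ≤ q) (he : ∀ i, |e i| ≤ K / ρ * q) (hg : |g| ≤ K / ρ * q) :
    -2 * (L * (L * (q * q) + 2 * ∑ i, p i * e i + f * g)) ≤
      -(L * L * (q * q)) + (8 * n + 2) * (K / ρ) ^ 2 * (f ^ 2 + ∑ i, p i ^ 2) := by
  have hk : 0 < K / ρ := by positivity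
  set κ := K / ρ
  have h1 : |∑ i, p i * e i| ≤ κ * q * ∑ i, |p i| := by
    refine (Finset.abs_sum_le_sum_abs _ _).trans ?_
    rw [Finset.mul_sum]
    refine Finset.sum_le_sum fun i _ => ?_
    rw [abs_mul, mul_comm]
    have := he i
    gcongr
  have h2 : (∑ i, |p i|) ^ 2 ≤ n * ∑ i, p i ^ 2 := by
    have := sq_sum_le_card_mul_sum_sq (s := (Finset.univ : Finset (Fin n))) (f := fun i => |p i|)
    simpa using this
  have h3 : |f * g| ≤ κ * q * |f| := by
    rw [abs_mul, mul_comm]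
    gcongr
  set S := ∑ i, |p i|
  have hS : 0 ≤ S := Finset.sum_nonneg fun i _ => abs_nonneg _
  set E := 2 * ∑ i, p i * e i + f * g with hE
  have h4 : |E| ≤ q * (κ * (2 * S + |f|)) := by
    calc |E| ≤ |2 * ∑ i, p i * e i| + |f * g| := abs_add_le _ _
      _ ≤ 2 * (κ * q * S) + κ * q * |f| := by
        rw [abs_mul, abs_two]; gcongr
      _ = _ := by ring
  set b := κ * (2 * S + |f|) with hb
  -- The constant comes from `(2S + |f|)² ≤ 8S² + 2f²` and the Cauchy–Schwarz bound `S² ≤ n∑pᵢ²`.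
  have h5 : b ^ 2 ≤ (8 * n + 2) * κ ^ 2 * (f ^ 2 + ∑ i, p i ^ 2) := by
    have e1 : (2 * S + |f|) ^ 2 ≤ 8 * S ^ 2 + 2 * f ^ 2 := by
      have := sq_abs f
      nlinarith [sq_nonneg (2 * S - |f|)]
    have e2 : 0 ≤ ∑ i, p i ^ 2 := Finset.sum_nonneg fun i _ => sq_nonneg _
    have e3 : (0 : ℝ) ≤ n := n.cast_nonneg
    have e4 : 8 * S ^ 2 + 2 * f ^ 2 ≤ (8 * n + 2) * (f ^ 2 + ∑ i, p i ^ 2) := by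
      nlinarith [sq_nonneg f, mul_nonneg e3 (sq_nonneg f)]
    calc b ^ 2 = κ ^ 2 * (2 * S + |f|) ^ 2 := by rw [hb]; ring
      _ ≤ κ ^ 2 * ((8 * n + 2) * (f ^ 2 + ∑ i, p i ^ 2)) := by gcongr; linarith
      _ = _ := by ring
  have h6 : -2 * (L * E) ≤ 2 * (|L| * q * b) := by
    have : |L * E| ≤ |L| * (q * b) := by rw [abs_mul]; gcongr
    have := neg_abs_le (L * E)
    nlinarith
  have h7 : (|L| * q) ^ 2 = L * L * (q * q) := by rw [mul_pow, sq_abs]; ring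
  have h8 : L * (L * (q * q) + 2 * ∑ i, p i * e i + f * g) = L * L * (q * q) + L * E := by
    rw [hE]; ring
  rw [h8]
  nlinarith [sq_nonneg (|L| * q - b)]

/-- Square integrability of `w` and `∇w` over the slab makes the error left by Young's inequality
`O(ρ⁻²)`, with a constant independent of `ρ`. -/
theorem Solves.energy_cutoff (hw : Solves w) (hT : 0 < T)
    (h0 : Integrable fun x => w x 0 ^ 2)
    (h1 : IntegrableOn (fun p : Euc n × ℝ => w p.1 p.2 ^ 2) (univ ×ˢ Ioo 0 T))
    (h2 : ∀ i, IntegrableOn (fun p : Euc n × ℝ => pd i w p.1 p.2 ^ 2) (univ ×ˢ Ioo 0 T)) :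
    ∃ A, ∀ ρ : ℝ, 1 ≤ ρ →
      (∫ x in Metric.closedBall 0 ρ, w x T ^ 2) +
        (∫ p in Metric.closedBall 0 ρ ×ˢ Ioo 0 T, lap w p.1 p.2 ^ 2) ≤
        (∫ x, w x 0 ^ 2) + A * (ρ⁻¹) ^ 2 := by
  obtain ⟨K, hK, hcut⟩ := exists_cutoff n
  set M := ∫ p in (univ : Set (Euc n)) ×ˢ Ioo 0 T, (w p.1 p.2 ^ 2 + ∑ i, pd i w p.1 p.2 ^ 2)
  have hMi : IntegrableOn (fun p : Euc n × ℝ => w p.1 p.2 ^ 2 + ∑ i, pd i w p.1 p.2 ^ 2)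
      (univ ×ˢ Ioo 0 T) := h1.add (integrable_finsetSum _ fun i _ => h2 i)
  refine ⟨(8 * n + 2) * K ^ 2 * M, fun ρ hρ => ?_⟩
  have hρ0 : 0 < ρ := by linarith
  obtain ⟨q, hq, hqs, hq01, hqρ, hqp, hql⟩ := hcut ρ hρ
  have hχ : ContDiff ℝ ∞ (fun y => q y * q y) := hq.mul hq
  have hχs : HasCompactSupport (fun y => q y * q y) := hqs.mul_left
  obtain ⟨hint, key⟩ := hw.energy_identity hT hχ hχs
  have hL := hw.smooth.lap
  have hLi := (hL.mul hL).slab_integrable_mul (T := T) hχ.continuous hχs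
  have hneg : IntegrableOn (fun p : Euc n × ℝ => -(lap w p.1 p.2 * lap w p.1 p.2 *
      (q p.1 * q p.1))) (univ ×ˢ Ioo 0 T) := hLi.neg
  have hTi := (hw.smooth.mul hw.smooth).slice_integrable_mul hT.le hχ.continuous hχs
  have h0i := (hw.smooth.mul hw.smooth).slice_integrable_mul le_rfl hχ.continuous hχs
  have hbound : (∫ p in univ ×ˢ Ioo 0 T, -2 * (lap w p.1 p.2 *
        (lap w p.1 p.2 * (q p.1 * q p.1) +
          2 * ∑ i, pd i w p.1 p.2 * partialD i (fun y => q y * q y) p.1 +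
          w p.1 p.2 * Laplacian.laplacian (fun y => q y * q y) p.1))) ≤
      ∫ p in univ ×ˢ Ioo 0 T, (-(lap w p.1 p.2 * lap w p.1 p.2 * (q p.1 * q p.1)) +
        (8 * n + 2) * (K / ρ) ^ 2 * (w p.1 p.2 ^ 2 + ∑ i, pd i w p.1 p.2 ^ 2)) := by
    refine integral_mono hint (hneg.add (hMi.const_mul _)) fun p => ?_
    exact cutoff_pointwise hK hρ0 (hq01 p.1).1 (fun i => hqp i p.1) (hql p.1)
  rw [integral_add hneg (hMi.const_mul _), integral_neg,
    integral_const_mul ((8 * (n : ℝ) + 2) * (K / ρ) ^ 2)] at hbound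
  have e1 : ∫ x in Metric.closedBall 0 ρ, w x T ^ 2 ≤ ∫ x, w x T * w x T * (q x * q x) := by
    rw [← integral_indicator Metric.isClosed_closedBall.measurableSet]
    refine integral_mono_of_nonneg (Eventually.of_forall fun x => ?_) hTi
      (Eventually.of_forall fun x => ?_)
    · exact indicator_nonneg (fun y _ => sq_nonneg _) x
    · by_cases hx : x ∈ Metric.closedBall 0 ρ
      · simp only [indicator_of_mem hx]
        rw [hqρ x (by simpa using hx)]
        apply le_of_eq; ring
      · simp only [indicator_of_notMem hx]
        nlinarith [mul_self_nonneg (w x T * q x)]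
  have e2 : ∫ p in Metric.closedBall 0 ρ ×ˢ Ioo 0 T, lap w p.1 p.2 ^ 2 ≤
      ∫ p in univ ×ˢ Ioo 0 T, lap w p.1 p.2 * lap w p.1 p.2 * (q p.1 * q p.1) := by
    have hm : MeasurableSet ((Metric.closedBall (0 : Euc n) ρ) ×ˢ Ioo 0 T) :=
      Metric.isClosed_closedBall.measurableSet.prod measurableSet_Ioo
    have e3 : ∫ p in Metric.closedBall 0 ρ ×ˢ Ioo 0 T, lap w p.1 p.2 ^ 2 =
        ∫ p in Metric.closedBall 0 ρ ×ˢ Ioo 0 T,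
          lap w p.1 p.2 * lap w p.1 p.2 * (q p.1 * q p.1) := by
      refine setIntegral_congr_fun hm fun p hp => ?_
      rw [hqρ p.1 (by simpa using hp.1)]
      ring
    rw [e3]
    refine setIntegral_mono_set hLi (Eventually.of_forall fun p => ?_)
      (Eventually.of_forall (prod_mono_left (subset_univ _)))
    have := mul_self_nonneg (lap w p.1 p.2 * q p.1)
    simp only [Pi.zero_apply]
    linarith
  have e4 : ∫ x, w x 0 * w x 0 * (q x * q x) ≤ ∫ x, w x 0 ^ 2 := by
    refine integral_mono h0i h0 fun x => ?_
    have h3 : q x * q x ≤ 1 := by nlinarith [(hq01 x).1, (hq01 x).2]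
    simp only
    nlinarith [sq_nonneg (w x 0)]
  have e5 : (8 * (n : ℝ) + 2) * (K / ρ) ^ 2 * M = (8 * n + 2) * K ^ 2 * M * (ρ⁻¹) ^ 2 := by
    rw [div_eq_mul_inv]; ring
  rw [← e5]
  linarith

/-- Energy estimate for solutions of the biheat equation, on bounded sets. -/
theorem Solves.energy_le (hw : Solves w) (hT : 0 < T)
    (h0 : Integrable fun x => w x 0 ^ 2)
    (h1 : IntegrableOn (fun p : Euc n × ℝ => w p.1 p.2 ^ 2) (univ ×ˢ Ioo 0 T))
    (h2 : ∀ i, IntegrableOn (fun p : Euc n × ℝ => pd i w p.1 p.2 ^ 2) (univ ×ˢ Ioo 0 T)) (r : ℝ) :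
    (∫ x in Metric.closedBall 0 r, w x T ^ 2) +
        (∫ p in Metric.closedBall 0 r ×ˢ Ioo 0 T, lap w p.1 p.2 ^ 2) ≤ ∫ x, w x 0 ^ 2 := by
  obtain ⟨A, hA⟩ := hw.energy_cutoff hT h0 h1 h2
  have hlim : Tendsto (fun ρ : ℝ => (∫ x, w x 0 ^ 2) + A * (ρ⁻¹) ^ 2) atTop
      (𝓝 ((∫ x, w x 0 ^ 2) + A * 0 ^ 2)) :=
    tendsto_const_nhds.add ((tendsto_inv_atTop_zero.pow 2).const_mul A)
  rw [show (∫ x, w x 0 ^ 2) + A * 0 ^ 2 = ∫ x, w x 0 ^ 2 by ring] at hlim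
  refine ge_of_tendsto hlim ?_
  filter_upwards [eventually_ge_atTop (max 1 r)] with ρ hρ
  refine le_trans ?_ (hA ρ ((le_max_left _ _).trans hρ))
  have hsub : Metric.closedBall (0 : Euc n) r ⊆ Metric.closedBall 0 ρ :=
    Metric.closedBall_subset_closedBall ((le_max_right _ _).trans hρ)
  have hc : IsCompact (Metric.closedBall (0 : Euc n) ρ) := isCompact_closedBall _ _
  have hL := hw.smooth.lap
  refine add_le_add (setIntegral_mono_set ?_ (Eventually.of_forall fun _ => sq_nonneg _)
    (Eventually.of_forall hsub)) (setIntegral_mono_set ?_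
    (Eventually.of_forall fun _ => sq_nonneg _) (Eventually.of_forall (prod_mono_left hsub)))
  · exact ((hw.smooth.slice hT.le).continuous.pow 2).continuousOn.integrableOn_compact hc
  · have : ContinuousOn (fun p : Euc n × ℝ => lap w p.1 p.2 ^ 2)
        (Metric.closedBall 0 ρ ×ˢ Icc 0 T) :=
      (hL.continuousOn.mono (prod_mono (subset_univ _) Icc_subset_Ici_self)).pow 2
    exact (this.integrableOn_compact (hc.prod isCompact_Icc)).mono_set
      (prod_mono_right Ioo_subset_Icc_self)

end Energy

/-! ### Energy estimates for finite energy solutions -/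

section FiniteEnergy

variable {n : ℕ} {u : Euc n → ℝ → ℝ} {T : ℝ}

theorem norm_grad_sq (u : Euc n → ℝ → ℝ) (x : Euc n) (t : ℝ) :
    ‖grad u x t‖ ^ 2 = ∑ i, pd i u x t ^ 2 :=
  norm_gradient_sq _ x

theorem dirichlet_nonneg (u : Euc n → ℝ → ℝ) : 0 ≤ dirichlet u :=
  integral_nonneg fun _ => sq_nonneg _

theorem bienergy_nonneg (u : Euc n → ℝ → ℝ) : 0 ≤ bienergy u :=
  integral_nonneg fun _ => sq_nonneg _

namespace IsFiniteEnergySolution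

theorem integrableOn_sq (hu : IsFiniteEnergySolution u) {f : Euc n → ℝ → ℝ} (hf : Smooth f)
    {l : ℕ} (hl : l ∈ Finset.Icc 1 3) (C : ℝ)
    (h : ∀ x t, 0 ≤ t → |f x t| ≤ C * ‖iteratedFDeriv ℝ l (fun y => u y t) x‖) :
    IntegrableOn (fun p : Euc n × ℝ => f p.1 p.2 ^ 2) (univ ×ˢ Ioo 0 T) := by
  have hm : MeasurableSet ((univ : Set (Euc n)) ×ˢ Ioo 0 T) :=
    MeasurableSet.univ.prod measurableSet_Ioo
  refine ((hu.integrable_slab l hl T).const_mul (C ^ 2)).mono' ?_ ?_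
  · refine ContinuousOn.aestronglyMeasurable ?_ hm
    exact (hf.continuousOn.mono (prod_mono_right
      (Ioo_subset_Icc_self.trans Icc_subset_Ici_self))).pow 2
  · refine (ae_restrict_iff' hm).2 (Eventually.of_forall fun p hp => ?_)
    have := h p.1 p.2 hp.2.1.le
    rw [Real.norm_of_nonneg (sq_nonneg _), ← mul_pow, ← sq_abs]
    gcongr

theorem integrable_sq_zero (hu : IsFiniteEnergySolution u) {f : Euc n → ℝ → ℝ} (hf : Smooth f)
    {l : ℕ} (hl : l ∈ Finset.Icc 1 3) (C : ℝ)
    (h : ∀ x t, 0 ≤ t → |f x t| ≤ C * ‖iteratedFDeriv ℝ l (fun y => u y t) x‖) :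
    Integrable (fun x => f x 0 ^ 2) := by
  refine ((hu.integrable_slice l hl 0 le_rfl).const_mul (C ^ 2)).mono'
    ((hf.slice le_rfl).continuous.pow 2).aestronglyMeasurable (Eventually.of_forall fun x => ?_)
  have := h x 0 le_rfl
  rw [Real.norm_of_nonneg (sq_nonneg _), ← mul_pow, ← sq_abs]
  gcongr

theorem integral_grad_sq_le (hu : IsFiniteEnergySolution u) (hT : 0 < T) (r : ℝ) :
    ∫ x in Metric.closedBall 0 r, ‖grad u x T‖ ^ 2 ≤ dirichlet u := by
  have hs := hu.solution.solves
  have b1 : ∀ i x t, 0 ≤ t → |pd i u x t| ≤ 1 * ‖iteratedFDeriv ℝ 1 (fun y => u y t) x‖ :=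
    fun i x t ht => by rw [one_mul]; exact abs_partialD_le (hs.smooth.slice ht) i x
  have b2 : ∀ i j x t, 0 ≤ t →
      |pd j (pd i u) x t| ≤ 1 * ‖iteratedFDeriv ℝ 2 (fun y => u y t) x‖ :=
    fun i j x t ht => by rw [one_mul]; exact abs_partialD_partialD_le (hs.smooth.slice ht) i j x
  have i0 : ∀ i, Integrable fun x => pd i u x 0 ^ 2 := fun i =>
    hu.integrable_sq_zero (hs.smooth.pd i) (l := 1) (by simp) 1 (b1 i)
  have key : ∀ i, ∫ x in Metric.closedBall 0 r, pd i u x T ^ 2 ≤ ∫ x, pd i u x 0 ^ 2 := by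
    intro i
    have h := (hs.pd i).energy_le hT (i0 i)
      (hu.integrableOn_sq (hs.smooth.pd i) (l := 1) (by simp) 1 (b1 i))
      (fun j => hu.integrableOn_sq ((hs.smooth.pd i).pd j) (l := 2) (by simp) 1 (b2 i j)) r
    have h2 : 0 ≤ ∫ p in Metric.closedBall 0 r ×ˢ Ioo 0 T, lap (pd i u) p.1 p.2 ^ 2 :=
      integral_nonneg fun _ => sq_nonneg _
    linarith
  unfold dirichlet
  simp only [norm_grad_sq]
  rw [integral_finsetSum _ fun i _ => i0 i, integral_finsetSum]
  · exact Finset.sum_le_sum fun i _ => key i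
  · intro i _
    exact (((hs.smooth.pd i).slice hT.le).continuous.pow 2).continuousOn.integrableOn_compact
      (isCompact_closedBall _ _)

/-- This is the energy inequality for `w = Δu`. Its hypotheses involve `Δu` and `∇Δu` on the slab,
which is why three derivatives of `u` are required to be square integrable. -/
theorem lap_energy (hu : IsFiniteEnergySolution u) (hT : 0 < T) (r : ℝ) :
    (∫ x in Metric.closedBall 0 r, lap u x T ^ 2) +
      (∫ p in Metric.closedBall 0 r ×ˢ Ioo 0 T, lap (lap u) p.1 p.2 ^ 2) ≤ bienergy u := by
  have hs := hu.solution.solves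
  have b1 : ∀ x t, 0 ≤ t → |lap u x t| ≤ n * ‖iteratedFDeriv ℝ 2 (fun y => u y t) x‖ :=
    fun x t ht => abs_laplacian_le (hs.smooth.slice ht) x
  have b2 : ∀ i x t, 0 ≤ t →
      |pd i (lap u) x t| ≤ n * ‖iteratedFDeriv ℝ 3 (fun y => u y t) x‖ :=
    fun i x t ht => abs_partialD_laplacian_le (hs.smooth.slice ht) i x
  exact hs.lap.energy_le hT (hu.integrable_sq_zero hs.smooth.lap (l := 2) (by simp) n b1)
    (hu.integrableOn_sq hs.smooth.lap (l := 2) (by simp) n b1)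
    (fun j => hu.integrableOn_sq (hs.smooth.lap.pd j) (l := 3) (by simp) n (b2 j)) r

theorem integral_lap_sq_le (hu : IsFiniteEnergySolution u) (hT : 0 < T) (r : ℝ) :
    ∫ x in Metric.closedBall 0 r, lap u x T ^ 2 ≤ bienergy u := by
  have h := hu.lap_energy hT r
  have : 0 ≤ ∫ p in Metric.closedBall 0 r ×ˢ Ioo 0 T, lap (lap u) p.1 p.2 ^ 2 :=
    integral_nonneg fun _ => sq_nonneg _
  linarith

theorem integral_lap_lap_sq_le (hu : IsFiniteEnergySolution u) (hT : 0 < T) (r : ℝ) :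
    ∫ p in Metric.closedBall 0 r ×ˢ Ioo 0 T, lap (lap u) p.1 p.2 ^ 2 ≤ bienergy u := by
  have h := hu.lap_energy hT r
  have : 0 ≤ ∫ x in Metric.closedBall 0 r, lap u x T ^ 2 := integral_nonneg fun _ => sq_nonneg _
  linarith

end IsFiniteEnergySolution

end FiniteEnergy

/-! ### The kernel on the support of the cut-off function -/

/-- On the ball of radius `c` the kernel at time one is continuous with values in `[0,C]`, and its
Laplacian is continuous with values in `[-C,0]`. -/
structure UnitKernelBounds (n : ℕ) (c C : ℝ) : Prop where
  c_pos : 0 < c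
  c_le_one : c ≤ 1
  C_pos : 0 < C
  continuousOn : ContinuousOn (unitKernel n) (Metric.ball 0 c)
  continuousOn_laplacian : ContinuousOn (Laplacian.laplacian (unitKernel n)) (Metric.ball 0 c)
  bounds : ∀ x ∈ Metric.ball (0 : Euc n) c, 0 ≤ unitKernel n x ∧ unitKernel n x ≤ C ∧
    -C ≤ Laplacian.laplacian (unitKernel n) x ∧ Laplacian.laplacian (unitKernel n) x ≤ 0

theorem rpow_quarter_pow_four {τ : ℝ} (hτ : 0 ≤ τ) : (τ ^ (1 / 4 : ℝ)) ^ 4 = τ := by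
  rw [← Real.rpow_natCast, ← Real.rpow_mul hτ]; norm_num

theorem pow_four_rpow_quarter {ρ : ℝ} (hρ : 0 ≤ ρ) : (ρ ^ 4) ^ (1 / 4 : ℝ) = ρ := by
  rw [← Real.rpow_natCast, ← Real.rpow_mul hρ]; norm_num

section BackKernel

variable {n : ℕ} {c C t₀ R₀ : ℝ} {x₀ : Euc n}

theorem backKernel_eq {ρ t : ℝ} (hρ : 0 < ρ) (ht : t₀ - t = ρ ^ 4) (x : Euc n) :
    backKernel x₀ t₀ x t = (ρ ^ n)⁻¹ * unitKernel n (ρ⁻¹ • (x - x₀)) := by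
  rw [backKernel, ht, kernel_pow_four _ hρ]

theorem lap_backKernel_eq {ρ t : ℝ} (hρ : 0 < ρ) (ht : t₀ - t = ρ ^ 4) (x : Euc n) :
    lap (backKernel x₀ t₀) x t =
      (ρ ^ (n + 2))⁻¹ * Laplacian.laplacian (unitKernel n) (ρ⁻¹ • (x - x₀)) := by
  unfold lap backKernel
  rw [laplacian_comp_sub (fun y => kernel n y (t₀ - t)), ht, laplacian_kernel_pow_four _ hρ]

theorem quarter_root {t : ℝ} (hR₀ : 0 < R₀) (ht : t ≤ t₀ - (R₀ / 2) ^ 4) :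
    R₀ / 2 ≤ (t₀ - t) ^ (1 / 4 : ℝ) ∧ t₀ - t = ((t₀ - t) ^ (1 / 4 : ℝ)) ^ 4 := by
  have h0 : 0 < (R₀ / 2) ^ 4 := by positivity
  have h1 : (R₀ / 2) ^ 4 ≤ t₀ - t := by linarith
  refine ⟨?_, (rpow_quarter_pow_four (h0.le.trans h1)).symm⟩
  rw [← pow_four_rpow_quarter (by positivity : 0 ≤ R₀ / 2)]
  exact Real.rpow_le_rpow h0.le h1 (by norm_num)

/-- This fixes the support radius `cR₀/2` of the cut-off: at every scale from `R₀/2` upwards the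
rescaled point stays where the kernel is controlled. -/
theorem smul_mem_ball {ρ : ℝ} {x : Euc n} (hR₀ : 0 < R₀) (hρ : R₀ / 2 ≤ ρ)
    (hx : x ∈ Metric.ball x₀ (c * R₀ / 2)) : ρ⁻¹ • (x - x₀) ∈ Metric.ball (0 : Euc n) c := by
  have hρ0 : 0 < ρ := by linarith
  have h1 : ‖x - x₀‖ < c * R₀ / 2 := by simpa [dist_eq_norm] using hx
  have hc : 0 < c := by
    have := (norm_nonneg (x - x₀)).trans_lt h1
    by_contra h
    nlinarith
  rw [mem_ball_zero_iff, norm_smul, norm_inv, Real.norm_of_nonneg hρ0.le, inv_mul_lt_iff₀ hρ0]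
  nlinarith

theorem backKernel_bounds (hk : UnitKernelBounds n c C) (hR₀ : 0 < R₀) {ρ t : ℝ} {x : Euc n}
    (hρ : R₀ / 2 ≤ ρ) (ht : t₀ - t = ρ ^ 4) (hx : x ∈ Metric.ball x₀ (c * R₀ / 2)) :
    0 ≤ backKernel x₀ t₀ x t ∧ backKernel x₀ t₀ x t ≤ C * (ρ ^ n)⁻¹ ∧
      -(C * (ρ ^ (n + 2))⁻¹) ≤ lap (backKernel x₀ t₀) x t ∧
      lap (backKernel x₀ t₀) x t ≤ 0 := by
  have hρ0 : 0 < ρ := by linarith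
  obtain ⟨h1, h2, h3, h4⟩ := hk.bounds _ (smul_mem_ball hR₀ hρ hx)
  rw [backKernel_eq hρ0 ht, lap_backKernel_eq hρ0 ht]
  have p1 : 0 < (ρ ^ n)⁻¹ := by positivity
  have p2 : 0 < (ρ ^ (n + 2))⁻¹ := by positivity
  refine ⟨by positivity, ?_, ?_, mul_nonpos_of_nonneg_of_nonpos p2.le h4⟩
  · rw [mul_comm]; gcongr
  · nlinarith

theorem continuousOn_rescaled {f : Euc n → ℝ} (hf : ContinuousOn f (Metric.ball 0 c))
    (hR₀ : 0 < R₀) (m : ℕ) :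
    ContinuousOn (fun p : Euc n × ℝ => (((t₀ - p.2) ^ (1 / 4 : ℝ)) ^ m)⁻¹ *
      f (((t₀ - p.2) ^ (1 / 4 : ℝ))⁻¹ • (p.1 - x₀)))
      (Metric.ball x₀ (c * R₀ / 2) ×ˢ Iic (t₀ - (R₀ / 2) ^ 4)) := by
  have hr : Continuous fun p : Euc n × ℝ => (t₀ - p.2) ^ (1 / 4 : ℝ) :=
    (continuous_const.sub continuous_snd).rpow_const fun _ => Or.inr (by norm_num)
  have hpos : ∀ p ∈ Metric.ball x₀ (c * R₀ / 2) ×ˢ Iic (t₀ - (R₀ / 2) ^ 4),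
      (t₀ - p.2) ^ (1 / 4 : ℝ) ≠ 0 := fun p hp => by
    have := (quarter_root hR₀ hp.2).1
    linarith
  refine ContinuousOn.mul ((hr.pow m).continuousOn.inv₀ fun p hp => pow_ne_zero _ (hpos p hp)) ?_
  refine hf.comp ((hr.continuousOn.inv₀ hpos).smul
    (continuous_fst.sub continuous_const).continuousOn) fun p hp => ?_
  exact smul_mem_ball hR₀ (quarter_root hR₀ hp.2).1 hp.1

theorem continuousOn_backKernel (hk : UnitKernelBounds n c C) (hR₀ : 0 < R₀) :
    ContinuousOn (fun p : Euc n × ℝ => backKernel x₀ t₀ p.1 p.2)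
      (Metric.ball x₀ (c * R₀ / 2) ×ˢ Iic (t₀ - (R₀ / 2) ^ 4)) := by
  refine (continuousOn_rescaled hk.continuousOn hR₀ n).congr fun p hp => ?_
  obtain ⟨h1, h2⟩ := quarter_root hR₀ hp.2
  exact backKernel_eq (by linarith) h2 p.1

theorem continuousOn_lap_backKernel (hk : UnitKernelBounds n c C) (hR₀ : 0 < R₀) :
    ContinuousOn (fun p : Euc n × ℝ => lap (backKernel x₀ t₀) p.1 p.2)
      (Metric.ball x₀ (c * R₀ / 2) ×ˢ Iic (t₀ - (R₀ / 2) ^ 4)) := by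
  refine (continuousOn_rescaled hk.continuousOn_laplacian hR₀ (n + 2)).congr fun p hp => ?_
  obtain ⟨h1, h2⟩ := quarter_root hR₀ hp.2
  exact lap_backKernel_eq (by linarith) h2 p.1

end BackKernel

/-! ### The densities -/

/-- A continuous cut-off function supported in the ball of radius `r` about `x₀`. -/
structure IsCutoff {n : ℕ} (x₀ : Euc n) (r : ℝ) (φ : Euc n → ℝ) : Prop where
  continuous : Continuous φ
  hasCompactSupport : HasCompactSupport φ
  nonneg : ∀ x, 0 ≤ φ x
  le_one : ∀ x, φ x ≤ 1
  tsupport_subset : tsupport φ ⊆ Metric.ball x₀ r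

section Densities

variable {n : ℕ} {c C t₀ R₀ : ℝ} {x₀ : Euc n} {φ : Euc n → ℝ} {u : Euc n → ℝ → ℝ}

/-- Off the closed support of `φ` the product vanishes identically nearby, whatever `a` does there.
No regularity of the kernel outside the small ball is needed. -/
theorem IsCutoff.continuousOn_mul {r : ℝ} (hφ : IsCutoff x₀ r φ) {J : Set ℝ}
    {a : Euc n × ℝ → ℝ} (ha : ContinuousOn a (Metric.ball x₀ r ×ˢ J)) :
    ContinuousOn (fun p => a p * φ p.1) (univ ×ˢ J) := by
  rintro ⟨x, t⟩ ⟨-, ht⟩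
  by_cases hx : x ∈ tsupport φ
  · have hxb := hφ.tsupport_subset hx
    have h1 : ContinuousWithinAt a (univ ×ˢ J) (x, t) := by
      refine (ha (x, t) ⟨hxb, ht⟩).mono_of_mem_nhdsWithin ?_
      rw [mem_nhdsWithin_iff_exists_mem_nhds_inter]
      refine ⟨Metric.ball x₀ r ×ˢ univ, prod_mem_nhds (Metric.isOpen_ball.mem_nhds hxb) univ_mem, ?_⟩
      rintro p ⟨⟨h1, _⟩, _, h2⟩
      exact ⟨h1, h2⟩
    exact h1.mul (hφ.continuous.comp continuous_fst).continuousWithinAt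
  · have h1 : φ =ᶠ[𝓝 x] 0 := notMem_tsupport_iff_eventuallyEq.1 hx
    have h2 : (fun p : Euc n × ℝ => a p * φ p.1) =ᶠ[𝓝 (x, t)] fun _ => 0 := by
      filter_upwards [(continuous_fst (X := Euc n) (Y := ℝ)).continuousAt (x := (x, t)) h1] with p hp
      have : φ p.1 = 0 := hp
      simp [this]
    exact (continuousAt_const.congr h2.symm).continuousWithinAt

/-- The last time for which the cut-off function lies in the region where the kernel is known to be
positive. -/
noncomputable def lastTime (t₀ R₀ : ℝ) : ℝ := t₀ - (R₀ / 2) ^ 4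

theorem layer_eq (n : ℕ) (t₀ R : ℝ) :
    layer n t₀ R = univ ×ˢ Ioo (t₀ - 16 * R ^ 4) (t₀ - R ^ 4) := by
  ext p; simp [layer]

theorem Smooth.continuousOn_Icc {f : Euc n → ℝ → ℝ} (hf : Smooth f) (s : Set (Euc n)) (b : ℝ) :
    ContinuousOn (fun p : Euc n × ℝ => f p.1 p.2) (s ×ˢ Icc 0 b) :=
  hf.continuousOn.mono (prod_mono (subset_univ _) Icc_subset_Ici_self)

theorem continuousOn_lapDensity (hk : UnitKernelBounds n c C) (hR₀ : 0 < R₀)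
    (hφ : IsCutoff x₀ (c * R₀ / 2) φ) (hu : Smooth u) :
    ContinuousOn (fun p : Euc n × ℝ => lapDensity x₀ t₀ u φ p.1 p.2)
      (univ ×ˢ Icc 0 (lastTime t₀ R₀)) :=
  hφ.continuousOn_mul (((hu.lap.continuousOn_Icc _ _).pow 2).mul
    ((continuousOn_backKernel hk hR₀).mono (prod_mono_right Icc_subset_Iic_self)))

theorem continuousOn_gradDensity (hk : UnitKernelBounds n c C) (hR₀ : 0 < R₀)
    (hφ : IsCutoff x₀ (c * R₀ / 2) φ) (hu : Smooth u) :
    ContinuousOn (fun p : Euc n × ℝ => gradDensity x₀ t₀ u φ p.1 p.2)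
      (univ ×ˢ Icc 0 (lastTime t₀ R₀)) := by
  refine hφ.continuousOn_mul (ContinuousOn.mul ?_
    ((continuousOn_lap_backKernel hk hR₀).mono (prod_mono_right Icc_subset_Iic_self)))
  simp only [norm_grad_sq]
  exact continuousOn_finsetSum _ fun i _ => ((hu.pd i).continuousOn_Icc _ _).pow 2

theorem lapDensity_eq_zero {x : Euc n} (hx : x ∉ tsupport φ) (t : ℝ) :
    lapDensity x₀ t₀ u φ x t = 0 := by
  simp [lapDensity, image_eq_zero_of_notMem_tsupport hx]

theorem gradDensity_eq_zero {x : Euc n} (hx : x ∉ tsupport φ) (t : ℝ) :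
    gradDensity x₀ t₀ u φ x t = 0 := by
  simp [gradDensity, image_eq_zero_of_notMem_tsupport hx]

/-- Earlier times have a larger scale `(t₀ - t)^(1/4) ≥ ρ`, and the size bounds decrease with the
scale, so the bounds at scale `ρ` hold at all of them. The signs are used with `ρ = R₀/2`, the sizes
with `ρ = R`. -/
theorem kernel_bounds_tsupport (hk : UnitKernelBounds n c C) (hR₀ : 0 < R₀)
    (hφ : IsCutoff x₀ (c * R₀ / 2) φ) {ρ t : ℝ} (hρ : R₀ / 2 ≤ ρ) (ht : t ≤ t₀ - ρ ^ 4)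
    {x : Euc n} (hx : x ∈ tsupport φ) :
    0 ≤ backKernel x₀ t₀ x t ∧ backKernel x₀ t₀ x t ≤ C * (ρ ^ n)⁻¹ ∧
      -(C * (ρ ^ (n + 2))⁻¹) ≤ lap (backKernel x₀ t₀) x t ∧
      lap (backKernel x₀ t₀) x t ≤ 0 := by
  have hρ0 : 0 < ρ := by linarith
  -- `quarter_root` speaks of half of its radius, hence the factor `2`.
  obtain ⟨h1, h2⟩ := quarter_root (R₀ := 2 * ρ) (t := t) (t₀ := t₀) (by linarith)
    (by rwa [mul_div_cancel_left₀ _ (two_ne_zero)])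
  rw [mul_div_cancel_left₀ _ (two_ne_zero)] at h1
  obtain ⟨b1, b2, b3, b4⟩ :=
    backKernel_bounds hk hR₀ (hρ.trans h1) h2 (hφ.tsupport_subset hx)
  have hC := hk.C_pos
  have e1 : C * (((t₀ - t) ^ (1 / 4 : ℝ)) ^ n)⁻¹ ≤ C * (ρ ^ n)⁻¹ := by gcongr
  have e2 : C * (((t₀ - t) ^ (1 / 4 : ℝ)) ^ (n + 2))⁻¹ ≤ C * (ρ ^ (n + 2))⁻¹ := by gcongr
  exact ⟨b1, b2.trans e1, by linarith, b4⟩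

theorem lapDensity_nonneg (hk : UnitKernelBounds n c C) (hR₀ : 0 < R₀)
    (hφ : IsCutoff x₀ (c * R₀ / 2) φ) {t : ℝ} (ht : t ≤ lastTime t₀ R₀) (x : Euc n) :
    0 ≤ lapDensity x₀ t₀ u φ x t := by
  by_cases hx : x ∈ tsupport φ
  · have := (kernel_bounds_tsupport hk hR₀ hφ le_rfl ht hx).1
    have := hφ.nonneg x
    unfold lapDensity
    positivity
  · rw [lapDensity_eq_zero hx]

theorem gradDensity_nonpos (hk : UnitKernelBounds n c C) (hR₀ : 0 < R₀)
    (hφ : IsCutoff x₀ (c * R₀ / 2) φ) {t : ℝ} (ht : t ≤ lastTime t₀ R₀) (x : Euc n) :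
    gradDensity x₀ t₀ u φ x t ≤ 0 := by
  by_cases hx : x ∈ tsupport φ
  · have := (kernel_bounds_tsupport hk hR₀ hφ le_rfl ht hx).2.2.2
    exact mul_nonpos_of_nonpos_of_nonneg (mul_nonpos_of_nonneg_of_nonpos (sq_nonneg _) this)
      (hφ.nonneg x)
  · rw [gradDensity_eq_zero hx]

/-- The slice integral `∫ (|Δu|² B - |∇u|² ΔB) φ dx`. -/
noncomputable def sliceEnergy (x₀ : Euc n) (t₀ : ℝ) (u : Euc n → ℝ → ℝ) (φ : Euc n → ℝ)
    (t : ℝ) : ℝ :=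
  ∫ x, (lapDensity x₀ t₀ u φ x t - gradDensity x₀ t₀ u φ x t)

theorem integrable_slice {d : Euc n → ℝ → ℝ} {K : Set (Euc n)} (hK : IsCompact K) {b t : ℝ}
    (hd : ContinuousOn (fun p : Euc n × ℝ => d p.1 p.2) (univ ×ˢ Icc 0 b))
    (h0 : ∀ x, x ∉ K → ∀ t, d x t = 0) (ht : t ∈ Icc 0 b) : Integrable fun x => d x t := by
  have hc : Continuous fun x => d x t := by
    rw [← continuousOn_univ]
    exact hd.comp (f := fun x : Euc n => (x, t)) (by fun_prop) fun x _ => ⟨mem_univ _, ht⟩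
  exact hc.integrable_of_hasCompactSupport (HasCompactSupport.intro hK fun x hx => h0 x hx t)

theorem continuousOn_sliceEnergy (hk : UnitKernelBounds n c C) (hR₀ : 0 < R₀)
    (hφ : IsCutoff x₀ (c * R₀ / 2) φ) (hu : Smooth u) :
    ContinuousOn (sliceEnergy x₀ t₀ u φ) (Icc 0 (lastTime t₀ R₀)) := by
  refine continuousOn_integral_of_compact_support hφ.hasCompactSupport.isCompact ?_ ?_
  · have h := (continuousOn_lapDensity (t₀ := t₀) hk hR₀ hφ hu).sub
      (continuousOn_gradDensity (t₀ := t₀) hk hR₀ hφ hu)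
    exact h.comp (f := fun p : ℝ × Euc n => (p.2, p.1)) (by fun_prop)
      fun p hp => ⟨mem_univ _, hp.1⟩
  · intro t x _ hx
    simp [lapDensity_eq_zero hx, gradDensity_eq_zero hx]

theorem sliceEnergy_nonneg (hk : UnitKernelBounds n c C) (hR₀ : 0 < R₀)
    (hφ : IsCutoff x₀ (c * R₀ / 2) φ) {t : ℝ} (ht : t ≤ lastTime t₀ R₀) :
    0 ≤ sliceEnergy x₀ t₀ u φ t :=
  integral_nonneg fun x => by
    have h1 := lapDensity_nonneg hk hR₀ hφ ht x (u := u)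
    have h2 := gradDensity_nonpos hk hR₀ hφ ht x (u := u)
    simp only [Pi.zero_apply]
    linarith

theorem tsupport_subset_closedBall (hφ : IsCutoff x₀ (c * R₀ / 2) φ) :
    tsupport φ ⊆ Metric.closedBall 0 (‖x₀‖ + c * R₀ / 2) := fun x hx => by
  have h1 : ‖x - x₀‖ < c * R₀ / 2 := by simpa [dist_eq_norm] using hφ.tsupport_subset hx
  have h2 : ‖x‖ ≤ ‖x₀‖ + ‖x - x₀‖ := by simpa using norm_add_le x₀ (x - x₀)
  rw [mem_closedBall_zero_iff]
  linarith

/-- The kernel bounds at scale `R` leave the energies of `u(·,t)` over a ball containing the support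
of `φ`, and these do not exceed the initial ones. -/
theorem sliceEnergy_le (hk : UnitKernelBounds n c C) (hR₀ : 0 < R₀)
    (hφ : IsCutoff x₀ (c * R₀ / 2) φ) (hu : IsFiniteEnergySolution u) {R t : ℝ}
    (hR : R₀ ≤ R) (ht0 : 0 < t) (ht : t ≤ t₀ - R ^ 4) :
    sliceEnergy x₀ t₀ u φ t ≤
      C * (R ^ n)⁻¹ * bienergy u + C * (R ^ (n + 2))⁻¹ * dirichlet u := by
  have hs := hu.solution.solves.smooth
  set B := Metric.closedBall (0 : Euc n) (‖x₀‖ + c * R₀ / 2)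
  have hB : IsCompact B := isCompact_closedBall _ _
  have hR0 : 0 < R := by linarith
  have hC := hk.C_pos
  have hlc : ContinuousOn (fun x => lap u x t ^ 2) B :=
    ((hs.lap.slice ht0.le).continuous.pow 2).continuousOn
  have hgc : ContinuousOn (fun x => ‖grad u x t‖ ^ 2) B := by
    simp only [norm_grad_sq]
    exact continuousOn_finsetSum _ fun i _ =>
      (((hs.pd i).slice ht0.le).continuous.pow 2).continuousOn
  have hli := (hlc.integrableOn_compact (μ := volume) hB).const_mul (C * (R ^ n)⁻¹)
  have hgi := (hgc.integrableOn_compact (μ := volume) hB).const_mul (C * (R ^ (n + 2))⁻¹)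
  have hle : sliceEnergy x₀ t₀ u φ t ≤
      ∫ x in B, (C * (R ^ n)⁻¹ * lap u x t ^ 2 + C * (R ^ (n + 2))⁻¹ * ‖grad u x t‖ ^ 2) := by
    rw [← integral_indicator hB.measurableSet]
    have htl : t ≤ lastTime t₀ R₀ := by
      refine ht.trans ?_
      unfold lastTime
      have : (R₀ / 2) ^ 4 ≤ R ^ 4 := by gcongr; linarith
      linarith
    refine integral_mono_of_nonneg (Eventually.of_forall fun x => ?_)
      (IntegrableOn.integrable_indicator (hli.add hgi) hB.measurableSet) (Eventually.of_forall fun x => ?_)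
    · have h1 := lapDensity_nonneg hk hR₀ hφ htl x (u := u)
      have h2 := gradDensity_nonpos hk hR₀ hφ htl x (u := u)
      simp only [Pi.zero_apply]
      linarith
    · by_cases hx : x ∈ tsupport φ
      · have hxB : x ∈ B := tsupport_subset_closedBall hφ hx
        simp only [indicator_of_mem hxB]
        obtain ⟨b1, b2, b3, b4⟩ := kernel_bounds_tsupport hk hR₀ hφ (by linarith) ht hx
        have hφ0 := hφ.nonneg x
        have hφ1 := hφ.le_one x
        have e1 : backKernel x₀ t₀ x t * φ x ≤ C * (R ^ n)⁻¹ :=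
          (mul_le_of_le_one_right b1 hφ1).trans b2
        have e2 : -lap (backKernel x₀ t₀) x t * φ x ≤ C * (R ^ (n + 2))⁻¹ :=
          (mul_le_of_le_one_right (by linarith) hφ1).trans (by linarith)
        have e3 := mul_le_mul_of_nonneg_left e1 (sq_nonneg (lap u x t))
        have e4 := mul_le_mul_of_nonneg_left e2 (sq_nonneg ‖grad u x t‖)
        unfold lapDensity gradDensity
        linarith
      · beta_reduce
        rw [lapDensity_eq_zero hx, gradDensity_eq_zero hx, sub_zero]
        refine indicator_nonneg (fun y _ => ?_) x
        positivity
  rw [integral_add hli hgi, integral_const_mul, integral_const_mul] at hle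
  have h1 := hu.integral_lap_sq_le ht0 (‖x₀‖ + c * R₀ / 2)
  have h2 := hu.integral_grad_sq_le ht0 (‖x₀‖ + c * R₀ / 2)
  refine hle.trans ?_
  gcongr

/-! ### The functional `Ψ` -/

theorem layer_subset {R : ℝ} (hR₀ : 0 < R₀) (hR : R₀ / 2 ≤ R) (ht : 16 * R ^ 4 ≤ t₀) :
    Icc (t₀ - 16 * R ^ 4) (t₀ - R ^ 4) ⊆ Icc 0 (lastTime t₀ R₀) := by
  intro t h
  refine ⟨by linarith [h.1], h.2.trans ?_⟩
  unfold lastTime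
  have : (R₀ / 2) ^ 4 ≤ R ^ 4 := by gcongr
  linarith

theorem integrableOn_layer {d : Euc n → ℝ → ℝ} {K : Set (Euc n)} (hK : IsCompact K) {b R : ℝ}
    (hd : ContinuousOn (fun p : Euc n × ℝ => d p.1 p.2) (univ ×ˢ Icc 0 b))
    (h0 : ∀ x, x ∉ K → ∀ t, d x t = 0)
    (hsub : Icc (t₀ - 16 * R ^ 4) (t₀ - R ^ 4) ⊆ Icc 0 b) :
    IntegrableOn (fun p : Euc n × ℝ => d p.1 p.2) (layer n t₀ R) := by
  rw [layer_eq]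
  exact integrableOn_slab hK (hd.mono (prod_mono_right hsub)) fun x hx t => h0 x hx t

theorem integrableOn_lapDensity (hk : UnitKernelBounds n c C) (hR₀ : 0 < R₀)
    (hφ : IsCutoff x₀ (c * R₀ / 2) φ) (hu : Smooth u) {R : ℝ} (hR : R₀ / 2 ≤ R)
    (ht : 16 * R ^ 4 ≤ t₀) :
    IntegrableOn (fun p : Euc n × ℝ => lapDensity x₀ t₀ u φ p.1 p.2) (layer n t₀ R) :=
  integrableOn_layer hφ.hasCompactSupport.isCompact (continuousOn_lapDensity hk hR₀ hφ hu)
    (fun _ hx t => lapDensity_eq_zero hx t) (layer_subset hR₀ hR ht)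

theorem integrableOn_gradDensity (hk : UnitKernelBounds n c C) (hR₀ : 0 < R₀)
    (hφ : IsCutoff x₀ (c * R₀ / 2) φ) (hu : Smooth u) {R : ℝ} (hR : R₀ / 2 ≤ R)
    (ht : 16 * R ^ 4 ≤ t₀) :
    IntegrableOn (fun p : Euc n × ℝ => gradDensity x₀ t₀ u φ p.1 p.2) (layer n t₀ R) :=
  integrableOn_layer hφ.hasCompactSupport.isCompact (continuousOn_gradDensity hk hR₀ hφ hu)
    (fun _ hx t => gradDensity_eq_zero hx t) (layer_subset hR₀ hR ht)

/-- By Fubini `Ψ` becomes a difference of two values of one primitive, with `R` only in the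
endpoints. -/
theorem Psi_eq (hk : UnitKernelBounds n c C) (hR₀ : 0 < R₀)
    (hφ : IsCutoff x₀ (c * R₀ / 2) φ) (hu : Smooth u) {R : ℝ} (hR : R₀ / 2 ≤ R)
    (ht : 16 * R ^ 4 ≤ t₀) :
    Psi x₀ t₀ u R φ = 1 / 2 * ((∫ s in 0..(t₀ - R ^ 4), sliceEnergy x₀ t₀ u φ s) -
      ∫ s in 0..(t₀ - 16 * R ^ 4), sliceEnergy x₀ t₀ u φ s) := by
  have hi1 := integrableOn_lapDensity hk hR₀ hφ hu hR ht
  have hi2 := integrableOn_gradDensity hk hR₀ hφ hu hR ht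
  have hR0 : 0 ≤ R := by linarith
  have hle : t₀ - 16 * R ^ 4 ≤ t₀ - R ^ 4 := by
    have : 0 ≤ R ^ 4 := by positivity
    linarith
  have hsub := layer_subset hR₀ hR ht
  have hcont := continuousOn_sliceEnergy (t₀ := t₀) hk hR₀ hφ hu
  have hii : ∀ a ∈ Icc 0 (lastTime t₀ R₀),
      IntervalIntegrable (sliceEnergy x₀ t₀ u φ) volume 0 a := fun a ha => by
    refine ContinuousOn.intervalIntegrable (hcont.mono ?_)
    rw [uIcc_of_le ha.1]
    exact Icc_subset_Icc_right ha.2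
  have h3 : Psi x₀ t₀ u R φ = 1 / 2 * ∫ p in layer n t₀ R,
      (lapDensity x₀ t₀ u φ p.1 p.2 - gradDensity x₀ t₀ u φ p.1 p.2) := by
    rw [integral_sub hi1 hi2]
    unfold Psi psiLap psiGrad
    ring
  have hi3 : IntegrableOn (fun p : Euc n × ℝ =>
      lapDensity x₀ t₀ u φ p.1 p.2 - gradDensity x₀ t₀ u φ p.1 p.2) (layer n t₀ R) := hi1.sub hi2
  rw [layer_eq] at hi3
  rw [h3, layer_eq, slab_integral_right hi3,
    intervalIntegral.integral_interval_sub_left (hii _ (hsub ⟨hle, le_rfl⟩))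
      (hii _ (hsub ⟨le_rfl, hle⟩)), intervalIntegral.integral_of_le hle,
    integral_Ioc_eq_integral_Ioo]
  rfl

/-- Fundamental theorem of calculus and chain rule at the two endpoints, both interior to the time
interval on which the slice integral is continuous. Working down to `R₀/2` leaves room on both sides
of `R = R₀`. -/
theorem hasDerivAt_Psi (hk : UnitKernelBounds n c C) (hR₀ : 0 < R₀)
    (hφ : IsCutoff x₀ (c * R₀ / 2) φ) (hu : Smooth u) {R : ℝ} (hR : R₀ / 2 < R)
    (ht : 16 * R ^ 4 < t₀) :
    HasDerivAt (fun r => Psi x₀ t₀ u r φ)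
      (2 * R ^ 3 * (16 * sliceEnergy x₀ t₀ u φ (t₀ - 16 * R ^ 4) -
        sliceEnergy x₀ t₀ u φ (t₀ - R ^ 4))) R := by
  have hcont := continuousOn_sliceEnergy (t₀ := t₀) hk hR₀ hφ hu
  have hR0 : 0 < R := by linarith
  have hmem : ∀ k : ℝ, 1 ≤ k → k ≤ 16 → t₀ - k * R ^ 4 ∈ Ioo 0 (lastTime t₀ R₀) := by
    intro k h1 h2
    have h3 : (R₀ / 2) ^ 4 < R ^ 4 := by gcongr
    have h4 : 0 < R ^ 4 := by positivity
    unfold lastTime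
    constructor <;> nlinarith
  have hG : ∀ s ∈ Ioo 0 (lastTime t₀ R₀),
      HasDerivAt (fun s => ∫ r in 0..s, sliceEnergy x₀ t₀ u φ r) (sliceEnergy x₀ t₀ u φ s) s := by
    intro s hs
    have hca : ContinuousAt (sliceEnergy x₀ t₀ u φ) s := hcont.continuousAt (Icc_mem_nhds hs.1 hs.2)
    refine intervalIntegral.integral_hasDerivAt_right ?_ ?_ hca
    · refine ContinuousOn.intervalIntegrable (hcont.mono ?_)
      rw [uIcc_of_le hs.1.le]
      exact Icc_subset_Icc_right hs.2.le
    · exact (hcont.mono Ioo_subset_Icc_self).stronglyMeasurableAtFilter isOpen_Ioo s hs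
  have hinner : ∀ k : ℝ, HasDerivAt (fun r : ℝ => t₀ - k * r ^ 4) (-(k * (4 * R ^ 3))) R := by
    intro k
    have := ((hasDerivAt_pow 4 R).const_mul k).const_sub t₀
    simpa using this
  have h1 := (hG _ (hmem 1 le_rfl (by norm_num))).comp R (hinner 1)
  have h2 := (hG _ (hmem 16 (by norm_num) le_rfl)).comp R (hinner 16)
  have h3 := (h1.sub h2).const_mul (1 / 2)
  have hev : (fun r => Psi x₀ t₀ u r φ) =ᶠ[𝓝 R] fun r =>
      1 / 2 * ((∫ s in 0..(t₀ - 1 * r ^ 4), sliceEnergy x₀ t₀ u φ s) -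
      ∫ s in 0..(t₀ - 16 * r ^ 4), sliceEnergy x₀ t₀ u φ s) := by
    have hc : ContinuousAt (fun r : ℝ => 16 * r ^ 4) R := by fun_prop
    filter_upwards [Ioi_mem_nhds hR, hc.eventually (Iio_mem_nhds ht)] with r hr1 hr2
    rw [one_mul]
    exact Psi_eq hk hR₀ hφ hu (le_of_lt hr1) (le_of_lt hr2)
  refine (h3.congr_of_eventuallyEq hev).congr_deriv ?_
  rw [one_mul]
  ring

/-- The differential inequality is integrated up to radii with `16R⁴ = t₀`, where `hasDerivAt_Psi`
does not apply; continuity suffices there. -/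
theorem continuousOn_Psi (hk : UnitKernelBounds n c C) (hR₀ : 0 < R₀)
    (hφ : IsCutoff x₀ (c * R₀ / 2) φ) (hu : Smooth u) :
    ContinuousOn (fun r => Psi x₀ t₀ u r φ) {r | R₀ / 2 ≤ r ∧ 16 * r ^ 4 ≤ t₀} := by
  have hcont := continuousOn_sliceEnergy (t₀ := t₀) hk hR₀ hφ hu
  by_cases hT : 0 ≤ lastTime t₀ R₀
  · have hG : ContinuousOn (fun s => ∫ r in 0..s, sliceEnergy x₀ t₀ u φ r)
        (Icc 0 (lastTime t₀ R₀)) := by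
      have := intervalIntegral.continuousOn_primitive_interval (μ := volume)
        (f := sliceEnergy x₀ t₀ u φ) (a := 0) (b := lastTime t₀ R₀) (by
          rw [uIcc_of_le hT]
          exact hcont.integrableOn_compact isCompact_Icc)
      rwa [uIcc_of_le hT] at this
    have hm : ∀ r ∈ {r | R₀ / 2 ≤ r ∧ 16 * r ^ 4 ≤ t₀}, t₀ - 16 * r ^ 4 ≤ t₀ - r ^ 4 := by
      intro r _
      have : 0 ≤ r ^ 4 := by positivity
      linarith
    refine ContinuousOn.congr (f := fun r => 1 / 2 *
      ((∫ s in 0..(t₀ - r ^ 4), sliceEnergy x₀ t₀ u φ s) -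
      ∫ s in 0..(t₀ - 16 * r ^ 4), sliceEnergy x₀ t₀ u φ s)) ?_
      fun r hr => Psi_eq hk hR₀ hφ hu hr.1 hr.2
    refine continuousOn_const.mul (ContinuousOn.sub ?_ ?_)
    · exact hG.comp (f := fun r : ℝ => t₀ - r ^ 4) (by fun_prop) fun r hr =>
        layer_subset hR₀ hr.1 hr.2 ⟨hm r hr, le_rfl⟩
    · exact hG.comp (f := fun r : ℝ => t₀ - 16 * r ^ 4) (by fun_prop) fun r hr =>
        layer_subset hR₀ hr.1 hr.2 ⟨le_rfl, hm r hr⟩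
  -- If the last time is negative, no radius is admissible and the claim is vacuous.
  · intro r hr
    exfalso
    apply hT
    have h := layer_subset hR₀ hr.1 hr.2 (left_mem_Icc.2 (by
      have : 0 ≤ r ^ 4 := by positivity
      linarith))
    exact h.1.trans h.2

end Densities

/-! ### The integral of `|Sol u|²` over a layer and the differential inequality -/

section SolDensity

variable {n : ℕ} {c C t₀ R₀ R : ℝ} {x₀ : Euc n} {φ : Euc n → ℝ} {u : Euc n → ℝ → ℝ}

theorem inner_grad (u : Euc n → ℝ → ℝ) (x y : Euc n) (t : ℝ) :
    inner ℝ (grad u x t) y = ∑ i, pd i u x t * y i := by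
  have h1 : inner ℝ (grad u x t) y = fderiv ℝ (fun z => u z t) x y := by
    rw [grad, gradient, InnerProductSpace.toDual_symm_apply]
  rw [h1]
  conv_lhs => rw [← (EuclideanSpace.basisFun (Fin n) ℝ).sum_repr y]
  rw [map_sum]
  refine Finset.sum_congr rfl fun i _ => ?_
  rw [map_smul, smul_eq_mul, mul_comm]
  rfl

/-- The integrand `|Sol u|² / (4|t₀ - t|) B φ` with the time derivative eliminated. -/
noncomputable def solDensity' (x₀ : Euc n) (t₀ : ℝ) (u : Euc n → ℝ → ℝ) (φ : Euc n → ℝ)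
    (x : Euc n) (t : ℝ) : ℝ :=
  (inner ℝ (grad u x t) (x - x₀) - 4 * (t - t₀) * lap (lap u) x t) ^ 2 / (4 * |t₀ - t|) *
    backKernel x₀ t₀ x t * φ x

/-- The equation gives the two-sided time derivative only for `t > 0`. The right-hand side uses
spatial derivatives alone, so it is continuous on the closed slab including `t = 0`. -/
theorem solDensity_eq (hu : Solves u) {t : ℝ} (ht : 0 < t) (x : Euc n) :
    solDensity x₀ t₀ u φ x t = solDensity' x₀ t₀ u φ x t := by
  unfold solDensity solDensity' sol
  rw [(hu.hasDerivAt x t ht).deriv]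
  congr 4
  ring

theorem continuousOn_solDensity' (hk : UnitKernelBounds n c C) (hR₀ : 0 < R₀)
    (hφ : IsCutoff x₀ (c * R₀ / 2) φ) (hu : Smooth u) :
    ContinuousOn (fun p : Euc n × ℝ => solDensity' x₀ t₀ u φ p.1 p.2)
      (univ ×ˢ Icc 0 (lastTime t₀ R₀)) := by
  refine hφ.continuousOn_mul (ContinuousOn.mul ?_
    ((continuousOn_backKernel hk hR₀).mono (prod_mono_right Icc_subset_Iic_self)))
  simp only [inner_grad]
  refine ContinuousOn.div (((continuousOn_finsetSum _ fun i _ =>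
    ((hu.pd i).continuousOn_Icc _ _).mul ?_).sub (ContinuousOn.mul ?_
      (hu.lap.lap.continuousOn_Icc _ _))).pow 2) ?_ ?_
  · have : Continuous fun p : Euc n × ℝ => (p.1 - x₀) i := by fun_prop
    exact this.continuousOn
  · fun_prop
  · fun_prop
  · rintro p ⟨_, hp⟩
    have h1 : 0 < (R₀ / 2) ^ 4 := by positivity
    have h2 : 0 < t₀ - p.2 := by
      have := hp.2
      unfold lastTime at this
      linarith
    have := abs_pos.2 h2.ne'
    positivity

theorem solDensity'_eq_zero {x : Euc n} (hx : x ∉ tsupport φ) (t : ℝ) :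
    solDensity' x₀ t₀ u φ x t = 0 := by
  simp [solDensity', image_eq_zero_of_notMem_tsupport hx]

theorem solDensity_eqOn (hu : Solves u) (ht : 16 * R ^ 4 ≤ t₀) :
    EqOn (fun p : Euc n × ℝ => solDensity x₀ t₀ u φ p.1 p.2)
      (fun p => solDensity' x₀ t₀ u φ p.1 p.2) (layer n t₀ R) := fun p hp =>
  solDensity_eq hu (by linarith [hp.1]) p.1

theorem measurableSet_layer : MeasurableSet (layer n t₀ R) := by
  rw [layer_eq]
  exact MeasurableSet.univ.prod measurableSet_Ioo

theorem integrableOn_solDensity (hk : UnitKernelBounds n c C) (hR₀ : 0 < R₀)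
    (hφ : IsCutoff x₀ (c * R₀ / 2) φ) (hu : Solves u) (hR : R₀ / 2 ≤ R)
    (ht : 16 * R ^ 4 ≤ t₀) :
    IntegrableOn (fun p : Euc n × ℝ => solDensity x₀ t₀ u φ p.1 p.2) (layer n t₀ R) :=
  IntegrableOn.congr_fun (integrableOn_layer hφ.hasCompactSupport.isCompact
    (continuousOn_solDensity' hk hR₀ hφ hu.smooth) (fun _ hx t => solDensity'_eq_zero hx t)
    (layer_subset hR₀ hR ht)) (solDensity_eqOn hu ht).symm measurableSet_layer

/-- Split the square by `(a + b)² ≤ 2a² + 2b²` and use `|x - x₀| ≤ R` on the support and `R⁴ < t₀ -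
t < 16R⁴` in the layer. The constant `2048` is generous; this argument would allow `128`. -/
theorem solDensity'_le (hk : UnitKernelBounds n c C) (hR₀ : 0 < R₀)
    (hφ : IsCutoff x₀ (c * R₀ / 2) φ) (hR : R₀ ≤ R) {x : Euc n} (hx : x ∈ tsupport φ) {t : ℝ}
    (h1 : t₀ - 16 * R ^ 4 < t) (h2 : t < t₀ - R ^ 4) :
    solDensity' x₀ t₀ u φ x t ≤ C * (R ^ n)⁻¹ *
      (1 / 2 * (R ^ 2)⁻¹ * ‖grad u x t‖ ^ 2 + 2048 * R ^ 4 * lap (lap u) x t ^ 2) := by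
  have hR0 : 0 < R := by linarith
  have hR4 : 0 < R ^ 4 := by positivity
  obtain ⟨b1, b2, -, -⟩ := kernel_bounds_tsupport hk hR₀ hφ (by linarith) h2.le hx
  have hφ0 := hφ.nonneg x
  have hφ1 := hφ.le_one x
  have e1 : backKernel x₀ t₀ x t * φ x ≤ C * (R ^ n)⁻¹ := (mul_le_of_le_one_right b1 hφ1).trans b2
  have hxr : ‖x - x₀‖ ≤ R := by
    have h := hφ.tsupport_subset hx
    have h3 : ‖x - x₀‖ < c * R₀ / 2 := by simpa [dist_eq_norm] using h
    have := hk.c_le_one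
    have := hk.c_pos
    nlinarith
  set τ := t₀ - t with hτ
  have hτ1 : R ^ 4 < τ := by rw [hτ]; linarith
  have hτ2 : τ < 16 * R ^ 4 := by rw [hτ]; linarith
  have hτ0 : 0 < τ := hR4.trans hτ1
  set a := inner ℝ (grad u x t) (x - x₀)
  set L := lap (lap u) x t
  set G := ‖grad u x t‖
  have ha : a ^ 2 ≤ G ^ 2 * R ^ 2 := by
    have h : |a| ≤ G * R := (abs_real_inner_le_norm _ _).trans (by gcongr)
    rw [← sq_abs, ← mul_pow]
    gcongr
  have e2 : (a - 4 * (t - t₀) * L) ^ 2 / (4 * |τ|) ≤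
      1 / 2 * (R ^ 2)⁻¹ * G ^ 2 + 2048 * R ^ 4 * L ^ 2 := by
    rw [abs_of_pos hτ0, div_le_iff₀ (by positivity), show t - t₀ = -τ by rw [hτ]; ring]
    have h3 : (a - 4 * -τ * L) ^ 2 ≤ 2 * (G ^ 2 * R ^ 2) + 32 * τ * (τ * L ^ 2) := by
      nlinarith [sq_nonneg (a - 4 * τ * L)]
    have h4 : 2 * (G ^ 2 * R ^ 2) ≤ 1 / 2 * (R ^ 2)⁻¹ * G ^ 2 * (4 * τ) := by
      have h5 : (R ^ 2)⁻¹ * R ^ 4 = R ^ 2 := by field_simp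
      have h6 : 0 ≤ (R ^ 2)⁻¹ * G ^ 2 := by positivity
      have h7 := mul_le_mul_of_nonneg_left hτ1.le h6
      have h8 : (R ^ 2)⁻¹ * G ^ 2 * R ^ 4 = G ^ 2 * R ^ 2 := by
        rw [mul_right_comm, h5, mul_comm]
      linarith
    have h9 : 32 * τ * (τ * L ^ 2) ≤ 2048 * R ^ 4 * L ^ 2 * (4 * τ) := by
      have h10 : 0 ≤ τ * L ^ 2 := by positivity
      have h11 := mul_le_mul_of_nonneg_right hτ2.le h10
      have h12 : 0 ≤ R ^ 4 * (τ * L ^ 2) := by positivity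
      linarith
    linarith
  have e3 : 0 ≤ 1 / 2 * (R ^ 2)⁻¹ * G ^ 2 + 2048 * R ^ 4 * L ^ 2 := by positivity
  calc solDensity' x₀ t₀ u φ x t
      = (a - 4 * (t - t₀) * L) ^ 2 / (4 * |τ|) * (backKernel x₀ t₀ x t * φ x) := by
        unfold solDensity'; ring
    _ ≤ (1 / 2 * (R ^ 2)⁻¹ * G ^ 2 + 2048 * R ^ 4 * L ^ 2) * (C * (R ^ n)⁻¹) := by gcongr
    _ = _ := by ring

theorem integral_solDensity_le (hk : UnitKernelBounds n c C) (hR₀ : 0 < R₀)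
    (hφ : IsCutoff x₀ (c * R₀ / 2) φ) (hu : IsFiniteEnergySolution u) (hR : R₀ ≤ R)
    (ht : 16 * R ^ 4 ≤ t₀) :
    ∫ p in layer n t₀ R, solDensity x₀ t₀ u φ p.1 p.2 ≤
      C * (R ^ n)⁻¹ * (8 * R ^ 2 * dirichlet u + 2048 * R ^ 4 * bienergy u) := by
  have hsol := hu.solution.solves
  have hs := hsol.smooth
  set r := ‖x₀‖ + c * R₀ / 2 with hr
  set B := Metric.closedBall (0 : Euc n) r with hBdef
  have hB : IsCompact B := isCompact_closedBall _ _
  have hR0 : 0 < R := by linarith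
  have hC := hk.C_pos
  have hR4 : 0 < R ^ 4 := by positivity
  set a := t₀ - 16 * R ^ 4 with ha
  set b := t₀ - R ^ 4 with hb
  have hab : a < b := by rw [ha, hb]; linarith
  have ha0 : 0 ≤ a := by rw [ha]; linarith
  have hb0 : 0 < b := ha0.trans_lt hab
  have hsub : Icc a b ⊆ Icc 0 b := Icc_subset_Icc_left ha0
  have hgi : IntegrableOn (fun p : Euc n × ℝ => ‖grad u p.1 p.2‖ ^ 2) (B ×ˢ Ioo a b) := by
    have : ContinuousOn (fun p : Euc n × ℝ => ‖grad u p.1 p.2‖ ^ 2) (B ×ˢ Icc a b) := by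
      simp only [norm_grad_sq]
      exact continuousOn_finsetSum _ fun i _ =>
        (((hs.pd i).continuousOn_Icc B b).mono (prod_mono_right hsub)).pow 2
    exact (this.integrableOn_compact (hB.prod isCompact_Icc)).mono_set
      (prod_mono_right Ioo_subset_Icc_self)
  have hli0 : IntegrableOn (fun p : Euc n × ℝ => lap (lap u) p.1 p.2 ^ 2) (B ×ˢ Ioo 0 b) :=
    (((hs.lap.lap.continuousOn_Icc B b).pow 2).integrableOn_compact
      (hB.prod isCompact_Icc)).mono_set (prod_mono_right Ioo_subset_Icc_self)
  have hss : B ×ˢ Ioo a b ⊆ B ×ˢ Ioo 0 b := prod_mono_right (Ioo_subset_Ioo_left ha0)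
  have hli := hli0.mono_set hss
  have hm : MeasurableSet (B ×ˢ Ioo a b) := hB.measurableSet.prod measurableSet_Ioo
  have hsi : IntegrableOn (fun p : Euc n × ℝ => solDensity' x₀ t₀ u φ p.1 p.2)
      (univ ×ˢ Ioo a b) := by
    have h := integrableOn_layer hφ.hasCompactSupport.isCompact
      (continuousOn_solDensity' (t₀ := t₀) hk hR₀ hφ hs) (fun _ hx t => solDensity'_eq_zero hx t)
      (layer_subset hR₀ (by linarith) ht)
    rwa [layer_eq] at h
  have h1 : ∫ p in layer n t₀ R, solDensity x₀ t₀ u φ p.1 p.2 =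
      ∫ p in B ×ˢ Ioo a b, solDensity' x₀ t₀ u φ p.1 p.2 := by
    rw [setIntegral_congr_fun measurableSet_layer (solDensity_eqOn hsol ht), layer_eq]
    have hmU : MeasurableSet ((univ : Set (Euc n)) ×ˢ Ioo a b) :=
      MeasurableSet.univ.prod measurableSet_Ioo
    refine setIntegral_eq_of_subset_of_forall_sdiff_eq_zero hmU (prod_mono_left (subset_univ _)) ?_
    rintro p ⟨hp1, hp2⟩
    exact solDensity'_eq_zero (fun hx => hp2 ⟨tsupport_subset_closedBall hφ hx, hp1.2⟩) _
  have hgc := hgi.const_mul (1 / 2 * (R ^ 2)⁻¹)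
  have hlc := hli.const_mul (2048 * R ^ 4)
  have h2 : ∫ p in B ×ˢ Ioo a b, solDensity' x₀ t₀ u φ p.1 p.2 ≤
      ∫ p in B ×ˢ Ioo a b, C * (R ^ n)⁻¹ *
        (1 / 2 * (R ^ 2)⁻¹ * ‖grad u p.1 p.2‖ ^ 2 + 2048 * R ^ 4 * lap (lap u) p.1 p.2 ^ 2) := by
    refine setIntegral_mono_on (hsi.mono_set (prod_mono_left (subset_univ _)))
      ((hgc.add hlc).const_mul _) hm fun p hp => ?_
    by_cases hx : p.1 ∈ tsupport φ
    · exact solDensity'_le hk hR₀ hφ hR hx hp.2.1 hp.2.2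
    · rw [solDensity'_eq_zero hx]
      positivity
  rw [integral_const_mul, integral_add hgc hlc, integral_const_mul (1 / 2 * (R ^ 2)⁻¹),
    integral_const_mul (2048 * R ^ 4)] at h2
  have h3 : ∫ p in B ×ˢ Ioo a b, lap (lap u) p.1 p.2 ^ 2 ≤ bienergy u :=
    (setIntegral_mono_set hli0 (Eventually.of_forall fun _ => sq_nonneg _)
      (Eventually.of_forall hss)).trans (hu.integral_lap_lap_sq_le hb0 r)
  have h4 : ∫ p in B ×ˢ Ioo a b, ‖grad u p.1 p.2‖ ^ 2 ≤ 15 * R ^ 4 * dirichlet u := by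
    have h5 : (volume : Measure (Euc n × ℝ)).restrict (B ×ˢ Ioo a b) =
      ((volume : Measure (Euc n)).restrict B).prod ((volume : Measure ℝ).restrict (Ioo a b)) := by
      rw [Measure.volume_eq_prod, ← Measure.prod_restrict]
    have hgi' := hgi
    rw [IntegrableOn, h5] at hgi'
    rw [h5, integral_prod_symm _ hgi']
    have h6 : ∫ t in Ioo a b, ∫ x in B, ‖grad u x t‖ ^ 2 ≤ ∫ _t in Ioo a b, dirichlet u := by
      refine setIntegral_mono_on hgi'.integral_prod_right (integrable_const _) measurableSet_Ioo ?_
      intro t htt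
      exact hu.integral_grad_sq_le (ha0.trans_lt htt.1) r
    refine h6.trans (le_of_eq ?_)
    rw [setIntegral_const, Real.volume_real_Ioo_of_le hab.le, smul_eq_mul, ha, hb]
    ring
  rw [h1]
  refine h2.trans ?_
  have hD := dirichlet_nonneg u
  have h7 : (R ^ 2)⁻¹ * R ^ 4 = R ^ 2 := by field_simp
  have h8 : 1 / 2 * (R ^ 2)⁻¹ * (∫ p in B ×ˢ Ioo a b, ‖grad u p.1 p.2‖ ^ 2) ≤
      8 * R ^ 2 * dirichlet u := by
    calc 1 / 2 * (R ^ 2)⁻¹ * (∫ p in B ×ˢ Ioo a b, ‖grad u p.1 p.2‖ ^ 2)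
        ≤ 1 / 2 * (R ^ 2)⁻¹ * (15 * R ^ 4 * dirichlet u) := by gcongr
      _ = 15 / 2 * ((R ^ 2)⁻¹ * R ^ 4) * dirichlet u := by ring
      _ = 15 / 2 * R ^ 2 * dirichlet u := by rw [h7]
      _ ≤ 8 * R ^ 2 * dirichlet u := by gcongr; norm_num
  gcongr

/-- The differential inequality for `Ψ`. -/
theorem deriv_Psi_ge (hk : UnitKernelBounds n c C) (hR₀ : 0 < R₀)
    (hφ : IsCutoff x₀ (c * R₀ / 2) φ) (hu : IsFiniteEnergySolution u) (hR : R₀ ≤ R)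
    (ht : 16 * R ^ 4 < t₀) :
    1 / 2 * (1 / R) * (∫ p in layer n t₀ R, solDensity x₀ t₀ u φ p.1 p.2) -
        1026 * C * (1 + R ^ (1 - (n : ℤ))) * dirichlet u -
        1026 * C * (R ^ 4 + R ^ (3 - (n : ℤ))) * bienergy u ≤
      deriv (fun r => Psi x₀ t₀ u r φ) R := by
  have hs := hu.solution.solves.smooth
  have hR0 : 0 < R := by linarith
  have hC := hk.C_pos
  have hR4 : 0 < R ^ 4 := by positivity
  have hD := dirichlet_nonneg u
  have hE := bienergy_nonneg u
  rw [(hasDerivAt_Psi hk hR₀ hφ hs (by linarith) ht).deriv]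
  -- The contribution of the bottom of the layer has the favourable sign and is discarded.
  have h1 : 0 ≤ sliceEnergy x₀ t₀ u φ (t₀ - 16 * R ^ 4) := by
    refine sliceEnergy_nonneg hk hR₀ hφ ?_
    exact (layer_subset hR₀ (by linarith) ht.le ⟨le_rfl, by linarith⟩).2
  have h2 := sliceEnergy_le hk hR₀ hφ hu hR (t := t₀ - R ^ 4) (by linarith) le_rfl
  have h3 := integral_solDensity_le hk hR₀ hφ hu hR ht.le
  have z1 : R ^ (1 - (n : ℤ)) = R * (R ^ n)⁻¹ := by
    rw [zpow_sub₀ hR0.ne', zpow_one, zpow_natCast, div_eq_mul_inv]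
  have z3 : R ^ (3 - (n : ℤ)) = R ^ 3 * (R ^ n)⁻¹ := by
    rw [zpow_sub₀ hR0.ne', zpow_natCast, div_eq_mul_inv]
    norm_cast
  have e1 : R ^ 3 * (R ^ (n + 2))⁻¹ = R ^ (1 - (n : ℤ)) := by
    rw [z1, pow_add]; field_simp
  have p1 : 0 < R ^ (1 - (n : ℤ)) := by positivity
  have p3 : 0 < R ^ (3 - (n : ℤ)) := by positivity
  have f1 : R ^ 3 * sliceEnergy x₀ t₀ u φ (t₀ - R ^ 4) ≤
      C * R ^ (3 - (n : ℤ)) * bienergy u + C * R ^ (1 - (n : ℤ)) * dirichlet u := by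
    have := mul_le_mul_of_nonneg_left h2 (pow_nonneg hR0.le 3)
    rw [← e1, z3]
    linarith
  -- The soliton term is itself within the error terms. In `1026 = 1024 + 2` the first summand pays
  -- for it and the second for the slice at `t₀ - R⁴`.
  have f2 : 1 / 2 * (1 / R) * (∫ p in layer n t₀ R, solDensity x₀ t₀ u φ p.1 p.2) ≤
      4 * (C * R ^ (1 - (n : ℤ)) * dirichlet u) +
        1024 * (C * R ^ (3 - (n : ℤ)) * bienergy u) := by
    have := mul_le_mul_of_nonneg_left h3 (by positivity : 0 ≤ 1 / 2 * (1 / R))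
    refine this.trans (le_of_eq ?_)
    rw [z1, z3]
    field_simp
    ring
  have f3 : 0 ≤ R ^ 3 * sliceEnergy x₀ t₀ u φ (t₀ - 16 * R ^ 4) := by positivity
  have q1 : 0 ≤ C * dirichlet u := by positivity
  have q2 : 0 ≤ C * R ^ (1 - (n : ℤ)) * dirichlet u := by positivity
  have q3 : 0 ≤ C * R ^ 4 * bienergy u := by positivity
  have q4 : 0 ≤ C * R ^ (3 - (n : ℤ)) * bienergy u := by positivity
  nlinarith

end SolDensity

/-! ### Parabolic rescaling -/

section Rescale

variable {n : ℕ} {t₀ R : ℝ} {x₀ : Euc n} {φ : Euc n → ℝ} {u : Euc n → ℝ → ℝ}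

/-- The parabolic homothety about `(x₀,t₀)`. -/
noncomputable def homothety (x₀ : Euc n) (t₀ R : ℝ) : Euc n × ℝ → Euc n × ℝ :=
  Prod.map (fun x => x₀ + R • (x - x₀)) (fun t => t₀ + R ^ 4 * (t - t₀))

theorem measurableEmbedding_homothety (hR : R ≠ 0) :
    MeasurableEmbedding (homothety x₀ t₀ R) := by
  have h1 : MeasurableEmbedding fun x : Euc n => x₀ + R • (x - x₀) :=
    (((Homeomorph.subRight x₀).trans (Homeomorph.smulOfNeZero R hR)).trans
      (Homeomorph.addLeft x₀)).measurableEmbedding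
  have h2 : MeasurableEmbedding fun t : ℝ => t₀ + R ^ 4 * (t - t₀) :=
    (((Homeomorph.subRight t₀).trans (Homeomorph.mulLeft₀ (R ^ 4) (pow_ne_zero 4 hR))).trans
      (Homeomorph.addLeft t₀)).measurableEmbedding
  exact h1.prodMap h2

theorem map_affine {E : Type*} [NormedAddCommGroup E] [NormedSpace ℝ E] [MeasurableSpace E]
    [BorelSpace E] [FiniteDimensional ℝ E] (μ : Measure E) [μ.IsAddHaarMeasure] (a : E) {k : ℝ}
    (hk : 0 < k) : μ.map (fun x => a + k • (x - a)) =
      ENNReal.ofReal (k ^ Module.finrank ℝ E)⁻¹ • μ := by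
  have h1 : (fun x : E => a + k • (x - a)) =
      (fun x => a + x) ∘ (fun x => k • x) ∘ fun x => x - a := rfl
  rw [h1, ← Measure.map_map (by fun_prop) (by fun_prop), ← Measure.map_map (by fun_prop)
    (by fun_prop), (measurePreserving_sub_right μ a).map_eq, Measure.map_addHaar_smul μ hk.ne',
    Measure.map_smul, (measurePreserving_add_left μ a).map_eq,
    abs_of_pos (by positivity)]

theorem map_homothety (hR : 0 < R) :
    (volume : Measure (Euc n × ℝ)).map (homothety x₀ t₀ R) =
      ENNReal.ofReal (R ^ (n + 4))⁻¹ • volume := by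
  have h1 := map_affine (volume : Measure (Euc n)) x₀ hR
  have h2 := map_affine (volume : Measure ℝ) t₀ (pow_pos hR 4)
  simp only [finrank_euclideanSpace, Fintype.card_fin, Module.finrank_self, pow_one,
    smul_eq_mul] at h1 h2
  rw [homothety, Measure.volume_eq_prod, ← Measure.map_prod_map _ _ (by fun_prop) (by fun_prop),
    h1, h2, Measure.prod_smul_left, Measure.prod_smul_right, smul_smul,
    ← ENNReal.ofReal_mul (by positivity)]
  congr 2
  rw [pow_add, mul_inv]

theorem setIntegral_homothety (hR : 0 < R) (f : Euc n × ℝ → ℝ) (s : Set (Euc n × ℝ)) :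
    ∫ p in s, f p = ∫ p in homothety x₀ t₀ R ⁻¹' s, R ^ (n + 4) * f (homothety x₀ t₀ R p) := by
  have h := (measurableEmbedding_homothety (x₀ := x₀) (t₀ := t₀) hR.ne').setIntegral_map
    (μ := volume) f s
  rw [map_homothety hR, Measure.restrict_smul, integral_smul_measure,
    ENNReal.toReal_ofReal (by positivity), smul_eq_mul] at h
  rw [integral_const_mul, ← h]
  field_simp

theorem homothety_preimage_layer (hR : 0 < R) :
    homothety x₀ t₀ R ⁻¹' layer n t₀ R = layer n t₀ 1 := by
  ext ⟨x, t⟩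
  have h4 : 0 < R ^ 4 := by positivity
  simp only [homothety, layer, mem_preimage, Prod.map_apply, mem_ofPred_eq, one_pow, mul_one]
  constructor
  · rintro ⟨h1, h2⟩
    constructor <;> nlinarith
  · rintro ⟨h1, h2⟩
    constructor <;> nlinarith

theorem lap_rescale (hR : R ≠ 0) (u : Euc n → ℝ → ℝ) (x : Euc n) (t : ℝ) :
    lap (rescale x₀ t₀ R u) x t =
      R ^ 2 * lap u (x₀ + R • (x - x₀)) (t₀ + R ^ 4 * (t - t₀)) := by
  unfold lap rescale
  rw [laplacian_comp_sub (fun z => u (x₀ + R • z) (t₀ + R ^ 4 * (t - t₀))) x₀ x,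
    laplacian_comp_smul (fun w => u (x₀ + w) (t₀ + R ^ 4 * (t - t₀))) hR,
    laplacian_comp_add (fun w => u w (t₀ + R ^ 4 * (t - t₀)))]

theorem norm_grad_eq (u : Euc n → ℝ → ℝ) (x : Euc n) (t : ℝ) :
    ‖grad u x t‖ = ‖fderiv ℝ (fun y => u y t) x‖ := by
  rw [grad, gradient, LinearIsometryEquiv.norm_map]

theorem norm_grad_rescale (u : Euc n → ℝ → ℝ) (x : Euc n) (t : ℝ) :
    ‖grad (rescale x₀ t₀ R u) x t‖ ^ 2 =
      R ^ 2 * ‖grad u (x₀ + R • (x - x₀)) (t₀ + R ^ 4 * (t - t₀))‖ ^ 2 := by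
  rw [norm_grad_eq, norm_grad_eq]
  unfold rescale
  have h : fderiv ℝ (fun y => u (x₀ + R • (y - x₀)) (t₀ + R ^ 4 * (t - t₀))) x =
      R • fderiv ℝ (fun y => u y (t₀ + R ^ 4 * (t - t₀))) (x₀ + R • (x - x₀)) := by
    rw [fderiv_comp_sub (f := fun z => u (x₀ + R • z) (t₀ + R ^ 4 * (t - t₀))) x₀,
      fderiv_comp_smul (f := fun w => u (x₀ + w) (t₀ + R ^ 4 * (t - t₀))),
      fderiv_comp_add_left (f := fun w => u w (t₀ + R ^ 4 * (t - t₀)))]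
  rw [h, norm_smul, mul_pow, Real.norm_eq_abs, sq_abs]

/-- Self-similarity: a point and its image under the homothety have the same rescaled argument `(x -
x₀)/(t₀ - t)^(1/4)`. -/
theorem backKernel_homothety (hR : 0 < R) (x : Euc n) {t : ℝ} (ht : t < t₀) :
    R ^ n * backKernel x₀ t₀ (x₀ + R • (x - x₀)) (t₀ + R ^ 4 * (t - t₀)) =
        backKernel x₀ t₀ x t ∧
      R ^ (n + 2) * lap (backKernel x₀ t₀) (x₀ + R • (x - x₀)) (t₀ + R ^ 4 * (t - t₀)) =
        lap (backKernel x₀ t₀) x t := by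
  have hτ : 0 < t₀ - t := by linarith
  set ρ := (t₀ - t) ^ (1 / 4 : ℝ) with hρ
  have hρ0 : 0 < ρ := Real.rpow_pos_of_pos hτ _
  have e1 : t₀ - t = ρ ^ 4 := (rpow_quarter_pow_four hτ.le).symm
  have e2 : t₀ - (t₀ + R ^ 4 * (t - t₀)) = (R * ρ) ^ 4 := by rw [mul_pow, ← e1]; ring
  have e3 : (R * ρ)⁻¹ • (x₀ + R • (x - x₀) - x₀) = ρ⁻¹ • (x - x₀) := by
    rw [add_sub_cancel_left, smul_smul]
    congr 1
    field_simp
  have hRρ : 0 < R * ρ := by positivity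
  rw [backKernel_eq hρ0 e1, lap_backKernel_eq hρ0 e1, backKernel_eq hRρ e2,
    lap_backKernel_eq hRρ e2, e3]
  constructor
  · rw [mul_pow]; field_simp
  · rw [mul_pow]; field_simp

/-- The Jacobian `R^(n+4)` is used up exactly, as `R⁴·Rⁿ` by `|Δu|²` and `B`, and as `R²·R^(n+2)` by
`|∇u|²` and `ΔB`. Neither regularity nor integrability is needed. -/
theorem Psi_rescale (hR : 0 < R) (u : Euc n → ℝ → ℝ) (φ : Euc n → ℝ) :
    Psi x₀ t₀ u R φ =
      Psi x₀ t₀ (rescale x₀ t₀ R u) 1 (fun x => φ (x₀ + R • (x - x₀))) := by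
  have hm : MeasurableSet (layer n t₀ 1) := measurableSet_layer
  unfold Psi psiLap psiGrad
  rw [setIntegral_homothety (x₀ := x₀) (t₀ := t₀) hR _ (layer n t₀ R),
    setIntegral_homothety (x₀ := x₀) (t₀ := t₀) hR (fun p => gradDensity x₀ t₀ u φ p.1 p.2)
      (layer n t₀ R), homothety_preimage_layer hR]
  congr 2
  · refine setIntegral_congr_fun hm fun p hp => ?_
    obtain ⟨h1, -⟩ := backKernel_homothety (x₀ := x₀) hR p.1
      (show p.2 < t₀ by linarith [hp.2] )
    simp only [lapDensity, homothety, Prod.map_fst, Prod.map_snd]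
    rw [lap_rescale hR.ne', ← h1]
    ring
  · congr 1
    refine setIntegral_congr_fun hm fun p hp => ?_
    obtain ⟨-, h1⟩ := backKernel_homothety (x₀ := x₀) hR p.1
      (show p.2 < t₀ by linarith [hp.2] )
    simp only [gradDensity, homothety, Prod.map_fst, Prod.map_snd]
    rw [norm_grad_rescale, ← h1]
    ring

/-! ### Shrinking solitons -/

/-- Along `s ↦ (x₀ + s y, t₀ + s⁴τ)` the derivative of `v`, multiplied by `s`, is `Sol v = 0`. The
largest `s` reaches the earliest time, so the curve stays in the domain between its two ends. -/
theorem IsShrinkingSoliton.const_along_homothety {a : ℝ} {v : Euc n → ℝ → ℝ}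
    (hv : IsShrinkingSoliton x₀ t₀ a v) (y : Euc n) {τ : ℝ} (hτ : τ < 0) {r r' : ℝ} (hr : 0 < r)
    (hr' : 0 < r') (ha : a < t₀ + r ^ 4 * τ) (ha' : a < t₀ + r' ^ 4 * τ) :
    v (x₀ + r • y) (t₀ + r ^ 4 * τ) = v (x₀ + r' • y) (t₀ + r' ^ 4 * τ) := by
  set M := max r r' with hM
  have hMa : a < t₀ + M ^ 4 * τ := by
    rcases max_choice r r' with h | h <;> rw [hM, h] <;> assumption
  have hd : ∀ s ∈ Icc (min r r') M,
      HasDerivAt (fun s : ℝ => v (x₀ + s • y) (t₀ + s ^ 4 * τ)) 0 s := by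
    intro s hs
    have hs0 : 0 < s := (lt_min hr hr').trans_le hs.1
    have hs4 : 0 < s ^ 4 := by positivity
    have hsM : s ^ 4 ≤ M ^ 4 := by gcongr; exact hs.2
    have hT : t₀ + s ^ 4 * τ ∈ Ioo a t₀ := by constructor <;> nlinarith
    set X := x₀ + s • y with hX
    set T := t₀ + s ^ 4 * τ with hTd
    set V : Euc n × ℝ → ℝ := fun p => v p.1 p.2
    have hV : DifferentiableAt ℝ V (X, T) :=
      (hv.1.1.contDiffAt (prod_mem_nhds univ_mem (isOpen_Ioo.mem_nhds hT))).differentiableAt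
        (by simp)
    have h1 : HasDerivAt (fun s : ℝ => (x₀ + s • y, t₀ + s ^ 4 * τ)) (y, 4 * s ^ 3 * τ) s := by
      have e1 : HasDerivAt (fun s : ℝ => x₀ + s • y) y s := by
        simpa using ((hasDerivAt_id s).smul_const y).const_add x₀
      have e2 : HasDerivAt (fun s : ℝ => t₀ + s ^ 4 * τ) (4 * s ^ 3 * τ) s := by
        simpa using ((hasDerivAt_pow 4 s).mul_const τ).const_add t₀
      exact e1.prodMk e2
    have h2 := hV.hasFDerivAt.comp_hasDerivAt s h1
    refine h2.congr_deriv ?_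
    have g1 : inner ℝ (grad v X T) (X - x₀) = fderiv ℝ V (X, T) (X - x₀, 0) := by
      rw [grad, gradient, InnerProductSpace.toDual_symm_apply]
      have h3 := hV.hasFDerivAt.comp (f := fun z : Euc n => (z, T)) X (hasFDerivAt_prodMk_left X T)
      have h4 := h3.fderiv
      change fderiv ℝ (fun z => v z T) X = _ at h4
      rw [h4]
      simp
    have g2 : deriv (fun s => v X s) T = fderiv ℝ V (X, T) (0, 1) :=
      (hV.hasFDerivAt.comp_hasDerivAt T ((hasDerivAt_const T X).prodMk (hasDerivAt_id T))).deriv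
    have h5 := hv.2 X T hT
    unfold sol at h5
    rw [g1, g2, hTd, hX, add_sub_cancel_left, add_sub_cancel_left] at h5
    rw [← hTd, ← hX] at h5
    have h6 : s * fderiv ℝ V (X, T) (y, 4 * s ^ 3 * τ) = 0 := by
      rw [← h5, ← smul_eq_mul, ← smul_eq_mul (4 * (s ^ 4 * τ)), ← map_smul, ← map_smul, ← map_add]
      congr 1
      ext
      · simp
      · simp; ring
    exact (mul_eq_zero.1 h6).resolve_left hs0.ne'
  have hconst := constant_of_has_deriv_right_zero
    (f := fun s : ℝ => v (x₀ + s • y) (t₀ + s ^ 4 * τ))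
    (fun s hs => (hd s hs).continuousAt.continuousWithinAt)
    (fun s hs => (hd s (Ico_subset_Icc_self hs)).hasDerivWithinAt)
  exact (hconst r ⟨min_le_left _ _, le_max_left _ _⟩).trans
    (hconst r' ⟨min_le_right _ _, le_max_right _ _⟩).symm

theorem Psi_congr {v w : Euc n → ℝ → ℝ} (h : ∀ x t, t₀ - 16 < t → t < t₀ - 1 → v x t = w x t) :
    Psi x₀ t₀ v 1 φ = Psi x₀ t₀ w 1 φ := by
  have hm : MeasurableSet (layer n t₀ 1) := measurableSet_layer
  have hs : ∀ p ∈ layer n t₀ 1, (fun y => v y p.2) = fun y => w y p.2 := fun p hp =>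
    funext fun y => h y p.2 (by simpa using hp.1) (by simpa using hp.2)
  unfold Psi psiLap psiGrad
  congr 2
  · refine setIntegral_congr_fun hm fun p hp => ?_
    simp only [lapDensity, lap, hs p hp]
  · congr 1
    refine setIntegral_congr_fun hm fun p hp => ?_
    simp only [gradDensity, grad, hs p hp]

/-- Rescaled to radius one, both sides have the same integrands. The equality thus also holds when
an integral diverges and takes the value `0`. -/
theorem IsShrinkingSoliton.Psi_eq {a : ℝ} {v : Euc n → ℝ → ℝ}
    (hv : IsShrinkingSoliton x₀ t₀ a v) {r r' : ℝ} (hr : 0 < r) (hr' : 0 < r')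
    (ha : a < t₀ - 16 * r ^ 4) (ha' : a < t₀ - 16 * r' ^ 4) :
    Psi x₀ t₀ v r (fun _ => 1) = Psi x₀ t₀ v r' (fun _ => 1) := by
  rw [Psi_rescale hr, Psi_rescale hr']
  refine Psi_congr fun x t h1 h2 => ?_
  have p1 : 0 < r ^ 4 := by positivity
  have p2 : 0 < r' ^ 4 := by positivity
  exact hv.const_along_homothety (x - x₀) (by linarith) hr hr' (by nlinarith) (by nlinarith)

theorem IsShrinkingSoliton.hasDerivAt_Psi {a : ℝ} {v : Euc n → ℝ → ℝ}
    (hv : IsShrinkingSoliton x₀ t₀ a v) (hR : 0 < R) (ha : a < t₀ - 16 * R ^ 4) :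
    HasDerivAt (fun r => Psi x₀ t₀ v r (fun _ => 1)) 0 R := by
  refine (hasDerivAt_const R (Psi x₀ t₀ v R (fun _ => 1))).congr_of_eventuallyEq ?_
  have hc : ContinuousAt (fun r : ℝ => t₀ - 16 * r ^ 4) R := by fun_prop
  filter_upwards [Ioi_mem_nhds hR, hc.eventually (Ioi_mem_nhds ha)] with r h1 h2
  exact hv.Psi_eq h1 hR h2 ha

end Rescale

/-! ### Signs of the terms, monotonicity in dimension one, and the pre-entropy property -/

section Main

variable {n : ℕ} {c C t₀ R₀ R : ℝ} {x₀ : Euc n} {φ : Euc n → ℝ} {u : Euc n → ℝ → ℝ}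

theorem le_quarter_root_iff (ht₀ : 0 < t₀) (hR : 0 ≤ R) :
    R ≤ t₀ ^ (1 / 4 : ℝ) / 2 ↔ 16 * R ^ 4 ≤ t₀ := by
  have h0 : 0 ≤ t₀ ^ (1 / 4 : ℝ) := by positivity
  rw [show 16 * R ^ 4 = (2 * R) ^ 4 by ring]
  conv_rhs => rw [← rpow_quarter_pow_four ht₀.le]
  rw [pow_le_pow_iff_left₀ (by positivity) h0 (by norm_num), le_div_iff₀ two_pos, mul_comm]

theorem lt_quarter_root_iff (ht₀ : 0 < t₀) (hR : 0 ≤ R) :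
    R < t₀ ^ (1 / 4 : ℝ) / 2 ↔ 16 * R ^ 4 < t₀ := by
  have h0 : 0 ≤ t₀ ^ (1 / 4 : ℝ) := by positivity
  rw [show 16 * R ^ 4 = (2 * R) ^ 4 by ring]
  conv_rhs => rw [← rpow_quarter_pow_four ht₀.le]
  rw [pow_lt_pow_iff_left₀ (by positivity) h0 (by norm_num), lt_div_iff₀ two_pos, mul_comm]

theorem terms_nonneg (hk : UnitKernelBounds n c C) (hR₀ : 0 < R₀)
    (hφ : IsCutoff x₀ (c * R₀ / 2) φ) (hR : R₀ ≤ R) :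
    0 ≤ psiLap x₀ t₀ u R φ ∧ 0 ≤ psiGrad x₀ t₀ u R φ ∧ 0 ≤ phiLap x₀ t₀ u R φ ∧
      0 ≤ phiGrad x₀ t₀ u R φ := by
  have hR4 : (R₀ / 2) ^ 4 ≤ R ^ 4 := by gcongr; linarith
  have hl : ∀ t, t ≤ t₀ - R ^ 4 → t ≤ lastTime t₀ R₀ := fun t ht => by
    unfold lastTime; linarith
  have hR0 : 0 ≤ R ^ 4 := by positivity
  have h1 : 0 ≤ ∫ p in layer n t₀ R, lapDensity x₀ t₀ u φ p.1 p.2 :=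
    setIntegral_nonneg measurableSet_layer fun p hp =>
      lapDensity_nonneg hk hR₀ hφ (hl _ hp.2.le) p.1
  have h2 : ∫ p in layer n t₀ R, gradDensity x₀ t₀ u φ p.1 p.2 ≤ 0 :=
    setIntegral_nonpos measurableSet_layer fun p hp =>
      gradDensity_nonpos hk hR₀ hφ (hl _ hp.2.le) p.1
  have h3 : 0 ≤ ∫ x, lapDensity x₀ t₀ u φ x (t₀ - R ^ 4) :=
    integral_nonneg fun x => lapDensity_nonneg hk hR₀ hφ (hl _ le_rfl) x
  have h4 : ∫ x, gradDensity x₀ t₀ u φ x (t₀ - R ^ 4) ≤ 0 :=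
    integral_nonpos fun x => gradDensity_nonpos hk hR₀ hφ (hl _ le_rfl) x
  unfold psiLap psiGrad phiLap phiGrad
  refine ⟨by positivity, by linarith, by positivity, ?_⟩
  nlinarith

/-- For `n = 1` the powers in the error terms are `1` and `R²`, and `R⁴ ≤ R²` for `R ≤ 1`. Adding
multiples of `R` and `R³` to `Ψ` therefore makes it non-decreasing; `2052` is twice `1026`. -/
theorem Psi_le_Psi_add {x₀ : Euc 1} {φ : Euc 1 → ℝ} {u : Euc 1 → ℝ → ℝ}
    (hk : UnitKernelBounds 1 c C) (hR₀ : 0 < R₀)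
    (hφ : IsCutoff x₀ (c * R₀ / 2) φ) (hu : IsFiniteEnergySolution u) {R₁ R₂ : ℝ} (h1 : R₀ ≤ R₁)
    (h12 : R₁ < R₂) (h2 : 16 * R₂ ^ 4 ≤ t₀) (hR₂ : R₂ ≤ 1) :
    Psi x₀ t₀ u R₁ φ ≤ Psi x₀ t₀ u R₂ φ + 2052 * C * (R₂ - R₁) * dirichlet u +
      2052 * C * (R₂ ^ 3 - R₁ ^ 3) * bienergy u := by
  have hs := hu.solution.solves.smooth
  have hC := hk.C_pos
  have hD := dirichlet_nonneg u
  have hE := bienergy_nonneg u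
  set F : ℝ → ℝ := fun r => Psi x₀ t₀ u r φ + 2052 * C * dirichlet u * r +
    2052 * C * bienergy u * r ^ 3 with hF
  have hmono : MonotoneOn F (Icc R₁ R₂) := by
    have hd : ∀ r ∈ Ioo R₁ R₂, DifferentiableAt ℝ (fun r => Psi x₀ t₀ u r φ) r ∧
        0 ≤ deriv (fun r => Psi x₀ t₀ u r φ) r + 2052 * C * dirichlet u +
          2052 * C * bienergy u * (3 * r ^ 2) := by
      intro r hr
      have hr0 : 0 < r := by linarith [hr.1]
      have hr4 : 16 * r ^ 4 < t₀ := by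
        have : r ^ 4 < R₂ ^ 4 := by gcongr; exact hr.2
        linarith
      have hrR : R₀ ≤ r := by linarith [hr.1]
      refine ⟨(hasDerivAt_Psi hk hR₀ hφ hs (by linarith) hr4).differentiableAt, ?_⟩
      have h := deriv_Psi_ge hk hR₀ hφ hu hrR hr4
      have hsol : 0 ≤ ∫ p in layer 1 t₀ r, solDensity x₀ t₀ u φ p.1 p.2 := by
        refine setIntegral_nonneg measurableSet_layer fun p hp => ?_
        unfold solDensity
        by_cases hx : p.1 ∈ tsupport φ
        · have := (kernel_bounds_tsupport hk hR₀ hφ (by linarith) hp.2.le hx).1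
          have := hφ.nonneg p.1
          positivity
        · simp [image_eq_zero_of_notMem_tsupport hx]
      have e1 : r ^ (1 - ((1 : ℕ) : ℤ)) = 1 := by simp
      have e3 : r ^ (3 - ((1 : ℕ) : ℤ)) = r ^ 2 := by
        rw [show (3 - ((1 : ℕ) : ℤ)) = ((2 : ℕ) : ℤ) by norm_num, zpow_natCast]
      rw [e1, e3] at h
      have hr42 : r ^ 4 ≤ r ^ 2 := pow_le_pow_of_le_one hr0.le (by linarith [hr.2]) (by norm_num)
      have q : 0 ≤ C * bienergy u := by positivity
      have q1 := mul_le_mul_of_nonneg_left hr42 q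
      have q2 : 0 ≤ C * bienergy u * r ^ 2 := by positivity
      have q3 : 0 ≤ 1 / 2 * (1 / r) *
        (∫ p in layer 1 t₀ r, solDensity x₀ t₀ u φ p.1 p.2) := by positivity
      linarith
    have hFd : ∀ r ∈ Ioo R₁ R₂, HasDerivAt F (deriv (fun r => Psi x₀ t₀ u r φ) r +
        2052 * C * dirichlet u + 2052 * C * bienergy u * (3 * r ^ 2)) r := by
      intro r hr
      have e1 := (hasDerivAt_id r).const_mul (2052 * C * dirichlet u)
      have e2 := (hasDerivAt_pow 3 r).const_mul (2052 * C * bienergy u)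
      have e3 := ((hd r hr).1.hasDerivAt.add e1).add e2
      refine e3.congr_deriv ?_
      norm_num
    refine monotoneOn_of_deriv_nonneg (convex_Icc _ _) ?_ ?_ ?_
    · refine ContinuousOn.add (ContinuousOn.add ?_ (by fun_prop)) (by fun_prop)
      refine (continuousOn_Psi hk hR₀ hφ hs).mono fun r hr => ⟨by linarith [hr.1], ?_⟩
      have hr0 : 0 < r := by linarith [hr.1]
      have : r ^ 4 ≤ R₂ ^ 4 := by gcongr; exact hr.2
      linarith
    · rw [interior_Icc]
      exact fun r hr => (hFd r hr).differentiableAt.differentiableWithinAt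
    · rw [interior_Icc]
      intro r hr
      rw [(hFd r hr).deriv]
      exact (hd r hr).2
  have h := hmono (left_mem_Icc.2 h12.le) (right_mem_Icc.2 h12.le) h12.le
  simp only [hF] at h
  linarith

theorem exists_cutoff_ball (n : ℕ) {r : ℝ} (hr : 0 < r) : ∃ φ₀ : Euc n → ℝ,
    (ContDiff ℝ ∞ φ₀ ∧ HasCompactSupport φ₀ ∧ (∀ x, 0 ≤ φ₀ x ∧ φ₀ x ≤ 1) ∧
      ∀ᶠ x in 𝓝 0, φ₀ x = 1) ∧ ∀ x₀ : Euc n, IsCutoff x₀ r (fun x => φ₀ (x - x₀)) := by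
  -- The outer radius `r/2` keeps the closed support inside the open ball of radius `r`.
  let ζ : ContDiffBump (0 : Euc n) := ⟨r / 4, r / 2, by positivity, by linarith⟩
  refine ⟨ζ, ⟨ζ.contDiff, ζ.hasCompactSupport, fun x => ⟨ζ.nonneg, ζ.le_one⟩,
    ζ.eventuallyEq_one⟩, fun x₀ => ?_⟩
  have hsub : Function.support (fun x => ζ (x - x₀)) ⊆ Metric.closedBall x₀ (r / 2) := by
    intro x hx
    have h : x - x₀ ∈ Function.support ζ := hx
    rw [ζ.support_eq] at h
    have h2 : ‖x - x₀‖ < r / 2 := by simpa [ζ] using h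
    rw [mem_closedBall_iff_norm]
    exact h2.le
  exact
    { continuous := ζ.continuous.comp (continuous_id.sub continuous_const)
      hasCompactSupport := HasCompactSupport.of_support_subset_isCompact
        (isCompact_closedBall x₀ (r / 2)) hsub
      nonneg := fun x => ζ.nonneg
      le_one := fun x => ζ.le_one
      tsupport_subset := (closure_minimal hsub Metric.isClosed_closedBall).trans
        (Metric.closedBall_subset_ball (by linarith)) }

theorem isPreEntropy_Psi {x₀ : Euc 1} {φ : Euc 1 → ℝ} (hk : UnitKernelBounds 1 c C)
    (hR₀ : 0 < R₀) (ht₀ : 0 < t₀) (hφ : IsCutoff x₀ (c * R₀ / 2) φ) :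
    IsPreEntropy x₀ t₀ R₀ (min (t₀ ^ (1 / 4 : ℝ) / 2) 1) φ (Psi x₀ t₀) dirichlet where
  nonneg u _ R hR _ := by
    obtain ⟨h1, h2, -, -⟩ := terms_nonneg (t₀ := t₀) (u := u) hk hR₀ hφ hR
    exact add_nonneg h1 h2
  scaling u _ R hR _ := Psi_rescale hR u φ
  soliton_critical _ _ hv _ hR ha := hv.hasDerivAt_Psi hR ha
  monotone := by
    have hC := hk.C_pos
    -- No exponential factor is needed. `12312 = 6·2052`: a factor `3` from `s³ - r³ ≤ 3(s - r)` for
    -- radii at most one, and a factor `2` for the `1/2` in front of the initial energy.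
    refine ⟨1, 1, 0, 12312 * C, le_rfl, le_rfl, le_rfl, by positivity,
      fun u hu r s hr hrs hs => ?_⟩
    have hs1 : s ≤ 1 := hs.trans (min_le_right _ _)
    have hr0 : 0 < r := by linarith
    have h := Psi_le_Psi_add hk hR₀ hφ hu hr hrs
      ((le_quarter_root_iff ht₀ (by linarith)).1 (hs.trans (min_le_left _ _))) hs1
    rw [zero_mul, Real.exp_zero, one_mul, pow_one, pow_one]
    have hD := dirichlet_nonneg u
    have hE := bienergy_nonneg u
    have h3 : s ^ 3 - r ^ 3 ≤ 3 * (s - r) := by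
      have : s ^ 2 + s * r + r ^ 2 ≤ 3 := by nlinarith
      nlinarith
    have q1 := mul_le_mul_of_nonneg_left h3 (mul_nonneg hC.le hE)
    have q2 : 0 ≤ C * dirichlet u * (s - r) := mul_nonneg (mul_nonneg hC.le hD) (by linarith)
    linarith

end Main

end Biheat

theorem mainTheorem5 (n : ℕ) (hn : 1 ≤ n) :
    ∃ C : ℝ, 0 < C ∧ ∀ R₀ : ℝ, 0 < R₀ → R₀ ≤ 1 →
      ∃ φ₀ : Biheat.Euc n → ℝ,
        (ContDiff ℝ ∞ φ₀ ∧ HasCompactSupport φ₀ ∧ (∀ x, 0 ≤ φ₀ x ∧ φ₀ x ≤ 1) ∧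
          ∀ᶠ x in 𝓝 0, φ₀ x = 1) ∧
        ∀ (x₀ : Biheat.Euc n) (t₀ : ℝ), 0 < t₀ → R₀ ≤ t₀ ^ (1 / 4 : ℝ) / 2 →
        ∀ φ : Biheat.Euc n → ℝ, φ = (fun x => φ₀ (x - x₀)) →
          (∀ u : Biheat.Euc n → ℝ → ℝ, Biheat.IsFiniteEnergySolution u →
            -- the integrals in `Ψ` and `Φ` converge and both terms of each are non-negative
            (∀ R : ℝ, R₀ ≤ R → R ≤ t₀ ^ (1 / 4 : ℝ) / 2 →
              (IntegrableOn (fun p : Biheat.Euc n × ℝ => Biheat.lapDensity x₀ t₀ u φ p.1 p.2)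
                  (Biheat.layer n t₀ R) ∧ 0 ≤ Biheat.psiLap x₀ t₀ u R φ) ∧
              (IntegrableOn (fun p : Biheat.Euc n × ℝ => Biheat.gradDensity x₀ t₀ u φ p.1 p.2)
                  (Biheat.layer n t₀ R) ∧ 0 ≤ Biheat.psiGrad x₀ t₀ u R φ) ∧
              (Integrable (fun x => Biheat.lapDensity x₀ t₀ u φ x (t₀ - R ^ 4)) ∧
                0 ≤ Biheat.phiLap x₀ t₀ u R φ) ∧
              (Integrable (fun x => Biheat.gradDensity x₀ t₀ u φ x (t₀ - R ^ 4)) ∧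
                0 ≤ Biheat.phiGrad x₀ t₀ u R φ)) ∧
            -- the differential inequality
            (∀ R : ℝ, R₀ ≤ R → R < t₀ ^ (1 / 4 : ℝ) / 2 →
              DifferentiableAt ℝ (fun r => Biheat.Psi x₀ t₀ u r φ) R ∧
              IntegrableOn (fun p : Biheat.Euc n × ℝ => Biheat.solDensity x₀ t₀ u φ p.1 p.2)
                (Biheat.layer n t₀ R) ∧
              deriv (fun r => Biheat.Psi x₀ t₀ u r φ) R ≥
                1 / 2 * (1 / R) *
                    (∫ p in Biheat.layer n t₀ R, Biheat.solDensity x₀ t₀ u φ p.1 p.2)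
                  - C * (1 + R ^ (1 - (n : ℤ))) * Biheat.dirichlet u
                  - C * (R ^ 4 + R ^ (3 - (n : ℤ))) * Biheat.bienergy u) ∧
            -- the monotonicity formula in dimension one
            (n = 1 → ∀ R₁ R₂ : ℝ, R₀ ≤ R₁ → R₁ < R₂ → R₂ ≤ min (t₀ ^ (1 / 4 : ℝ) / 2) 1 →
              Biheat.Psi x₀ t₀ u R₁ φ ≤ Biheat.Psi x₀ t₀ u R₂ φ
                + C * (R₂ - R₁) * Biheat.dirichlet u
                + C * (R₂ ^ 3 - R₁ ^ 3) * Biheat.bienergy u)) ∧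
          (n = 1 →
            Biheat.IsPreEntropy x₀ t₀ R₀ (min (t₀ ^ (1 / 4 : ℝ) / 2) 1) φ
              (Biheat.Psi x₀ t₀) Biheat.dirichlet) := by
  obtain ⟨c, C, hc, hc1, hC, h1, h2, h3⟩ := Biheat.exists_unitKernel_bounds hn
  have hk : Biheat.UnitKernelBounds n c C := ⟨hc, hc1, hC, h1, h2, h3⟩
  -- The constant of the integrated inequality; it also covers the `1026 * C` of the differential
  -- inequality.
  refine ⟨2052 * C, by positivity, fun R₀ hR₀ _ => ?_⟩
  obtain ⟨φ₀, hφ₀, hcut⟩ := Biheat.exists_cutoff_ball n (r := c * R₀ / 2) (by positivity)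
  refine ⟨φ₀, hφ₀, fun x₀ t₀ ht₀ _ φ hφe => ?_⟩
  have hφ : Biheat.IsCutoff x₀ (c * R₀ / 2) φ := hφe ▸ hcut x₀
  refine ⟨fun u hu => ⟨fun R hR hRt => ?_, fun R hR hRt => ?_, ?_⟩, ?_⟩
  · have hs := hu.solution.solves.smooth
    have ht := (Biheat.le_quarter_root_iff ht₀ (by linarith)).1 hRt
    have hR2 : R₀ / 2 ≤ R := by linarith
    obtain ⟨p1, p2, p3, p4⟩ := Biheat.terms_nonneg (t₀ := t₀) (u := u) hk hR₀ hφ hR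
    have hmem : t₀ - R ^ 4 ∈ Icc 0 (Biheat.lastTime t₀ R₀) := by
      have h0 : 0 ≤ R ^ 4 := by positivity
      exact Biheat.layer_subset hR₀ hR2 ht ⟨by linarith, le_rfl⟩
    exact ⟨⟨Biheat.integrableOn_lapDensity hk hR₀ hφ hs hR2 ht, p1⟩,
      ⟨Biheat.integrableOn_gradDensity hk hR₀ hφ hs hR2 ht, p2⟩,
      ⟨Biheat.integrable_slice hφ.hasCompactSupport.isCompact
        (Biheat.continuousOn_lapDensity hk hR₀ hφ hs)
        (fun _ hx t => Biheat.lapDensity_eq_zero hx t) hmem, p3⟩,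
      ⟨Biheat.integrable_slice hφ.hasCompactSupport.isCompact
        (Biheat.continuousOn_gradDensity hk hR₀ hφ hs)
        (fun _ hx t => Biheat.gradDensity_eq_zero hx t) hmem, p4⟩⟩
  · have hR0 : 0 < R := by linarith
    have ht := (Biheat.lt_quarter_root_iff ht₀ hR0.le).1 hRt
    have hR2 : R₀ / 2 < R := by linarith
    refine ⟨(Biheat.hasDerivAt_Psi hk hR₀ hφ hu.solution.solves.smooth hR2 ht).differentiableAt,
      Biheat.integrableOn_solDensity hk hR₀ hφ hu.solution.solves hR2.le ht.le, ?_⟩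
    have h := Biheat.deriv_Psi_ge hk hR₀ hφ hu hR ht
    have hD := Biheat.dirichlet_nonneg u
    have hE := Biheat.bienergy_nonneg u
    have q1 : 0 ≤ C * (1 + R ^ (1 - (n : ℤ))) * Biheat.dirichlet u := by positivity
    have q2 : 0 ≤ C * (R ^ 4 + R ^ (3 - (n : ℤ))) * Biheat.bienergy u := by positivity
    linarith
  · rintro rfl R₁ R₂ hR₁ h12 hR₂
    exact Biheat.Psi_le_Psi_add hk hR₀ hφ hu hR₁ h12
      ((Biheat.le_quarter_root_iff ht₀ (by linarith)).1 (hR₂.trans (min_le_left _ _)))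
      (hR₂.trans (min_le_right _ _))
  · rintro rfl
    exact Biheat.isPreEntropy_Psi hk hR₀ ht₀ hφ
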